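/- Throughout, $\lambda$ is the security parameter, QPT means (uniform) quantum polynomial time, all algorithms are given $1^\lambda$, and $\mathsf{negl}$ denotes a negligible function. **Quantum group actions.** A quantum group action (QGA) is a pair $(G,S)$ of QPT algorithms such that $G(1^\lambda)$ outputs a classical description $[g]$ (a quantum circuit) of a unitary $g$ and $S(1^\lambda)$ outputs a classical description $[|s\rangle]$ (a quantum circuit that generates it from $|0\cdots0\rangle$) of a pure state $|s\rangle$, where $g$ and $|s\rangle$ are on the same number $n(\lambda)$ of qubits, $n$ being computable in polynomial time. It is *one-way* if for every QPT adversary $\mathcal A$ and every polynomial $t$, for $[|s\rangle]\gets S(1^\lambda)$, $[g]\gets G(1^\lambda)$ and $[g']\gets\mathcal A(1^\lambda,|s\rangle^{\otimes t(\lambda)},(g|s\rangle)^{\otimes t(\lambda)})$, where $[g']$ describes a unitary $g'$ on $n(\lambda)$ qubits (not necessarily in the support of $G$), the probability that the projection of $g|s\rangle$ onto $g'|s\rangle$ succeeds is negligible, i.e. $$\mathbb E\left[\,|\langle s|g'^\dagger g|s\rangle|^2\,\right]\le\mathsf{negl}(\lambda).$$ **One-way state generators.** A one-way state generator (OWSG)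 is a triple of QPT algorithms: $\mathsf{KeyGen}(1^\lambda)$ outputs a bit string $k$ of polynomial length; $\mathsf{StateGen}(k)$ outputs a quantum state $\phi_k$; and $\mathsf{Ver}(k',\phi_k)$ outputs $\top$ or $\bot$; such that * (correctness) $\Pr[\top\gets\mathsf{Ver}(k,\phi_k):k\gets\mathsf{KeyGen}(1^\lambda)]\ge1-\mathsf{negl}(\lambda)$; * (one-wayness) for every QPT adversary $\mathcal A$ and every polynomial $t$, $$\Pr[\top\gets\mathsf{Ver}(k',\phi_k):k\gets\mathsf{KeyGen}(1^\lambda),\ k'\gets\mathcal A(1^\lambda,\phi_k^{\otimes t(\lambda)})]\le\mathsf{negl}(\lambda).$$ It is *pure* if every $\phi_k$ is a pure state $|\phi_k\rangle$, and a pure OWSG has *canonical verification* if $\mathsf{Ver}(k',\cdot)$ projects its input onto $|\phi_{k'}\rangle$ and outputs $\top$ exactly when the projection succeeds, so that it accepts $|\psi\rangle$ with probability $|\langle\phi_{k'}|\psi\rangle|^2$. **Lemma.** If a one-way QGA exists, then a pure OWSG with canonical verification exists. -/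

import Mathlib

open scoped Matrix

noncomputable section

/-! ### Qubits, gates and circuits -/

/-- Labels of the computational basis of `n` qubits. -/
abbrev Bits (n : ℕ) : Type := Fin n → Bool

/-- Operators on `n` qubits (unitaries, density operators), in the computational basis. -/
abbrev QOp (n : ℕ) : Type := Matrix (Bits n) (Bits n) ℂ

/-- State vectors of `n` qubits. -/
abbrev Ket (n : ℕ) : Type := Bits n → ℂ

/-- The universal gate set Clifford+T, closed under inverses: Hadamard, T, its inverse,
NOT, controlled NOT (control, target) and Toffoli (control, control, target). -/
inductive Gate : Type
  | had (i : ℕ)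
  | tee (i : ℕ)
  | teeInv (i : ℕ)
  | flip (i : ℕ)
  | cnot (i j : ℕ)
  | ccnot (i j k : ℕ)

/-- Hadamard matrix. -/
def hadMat : Matrix Bool Bool ℂ :=
  fun a b => (if (a && b) = true then -1 else 1) / (Real.sqrt 2 : ℂ)

/-- The phase gate `diag(1, exp(iθ))`. -/
def phaseMat (θ : ℝ) : Matrix Bool Bool ℂ :=
  fun a b => if a = b then (if a = true then Complex.exp (θ * Complex.I) else 1) else 0

/-- A one-qubit operator acting on wire `i`. -/
def onWire {N : ℕ} (u : Matrix Bool Bool ℂ) (i : Fin N) : QOp N :=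
  fun x y => if ∀ l, l ≠ i → x l = y l then u (x i) (y i) else 0

/-- The operator `|y⟩ ↦ |f y⟩`. -/
def basisMap {N : ℕ} (f : Bits N → Bits N) : QOp N :=
  fun x y => if x = f y then 1 else 0

/-- The unitary of a gate on `N` wires. A gate that names a wire out of range, or names
the same wire twice, acts as the identity, so every list of gates denotes a unitary. -/
def Gate.mat (N : ℕ) : Gate → QOp N
  | .had i => if h : i < N then onWire hadMat ⟨i, h⟩ else 1
  | .tee i => if h : i < N then onWire (phaseMat (Real.pi / 4)) ⟨i, h⟩ else 1
  | .teeInv i => if h : i < N then onWire (phaseMat (-(Real.pi / 4))) ⟨i, h⟩ else 1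
  | .flip i =>
      if h : i < N then basisMap (fun y => Function.update y ⟨i, h⟩ (!(y ⟨i, h⟩))) else 1
  | .cnot i j =>
      if h : i < N ∧ j < N ∧ i ≠ j then
        basisMap (fun y => Function.update y ⟨j, h.2.1⟩
          (xor (y ⟨j, h.2.1⟩) (y ⟨i, h.1⟩)))
      else 1
  | .ccnot i j k =>
      if h : i < N ∧ j < N ∧ k < N ∧ i ≠ j ∧ i ≠ k ∧ j ≠ k then
        basisMap (fun y => Function.update y ⟨k, h.2.2.1⟩
          (xor (y ⟨k, h.2.2.1⟩) (y ⟨i, h.1⟩ && y ⟨j, h.2.1⟩)))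
      else 1

/-- The unitary of a list of gates on `N` wires; the head of the list is applied first. -/
def gatesMat (N : ℕ) : List Gate → QOp N
  | [] => 1
  | g :: gs => gatesMat N gs * g.mat N

/-! ### Descriptions of circuits as bit strings -/

/-- The list `[a, b, …]` is written `1^a 0 1^b 0 …`. -/
def encNats (l : List ℕ) : List Bool :=
  l.flatMap (fun a => List.replicate a true ++ [false])

/-- Reads `1^a 0 1^b 0 …`, starting with a counter `c`; an unfinished number is dropped. -/
def decNatsFrom : ℕ → List Bool → List ℕ
  | _, [] => []
  | c, true :: w => decNatsFrom (c + 1) w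
  | c, false :: w => c :: decNatsFrom 0 w

/-- A gate is written as four numbers, an operation code followed by wires. -/
def Gate.toNats : Gate → List ℕ
  | .had i => [1, i, 0, 0]
  | .tee i => [2, i, 0, 0]
  | .teeInv i => [3, i, 0, 0]
  | .flip i => [4, i, 0, 0]
  | .cnot i j => [5, i, j, 0]
  | .ccnot i j k => [6, i, j, k]

/-- Reads four numbers at a time; an operation code that is not in use denotes no gate,
in particular a description may be padded with zeros. -/
def decGates : List ℕ → List Gate
  | 1 :: i :: _ :: _ :: l => .had i :: decGates l
  | 2 :: i :: _ :: _ :: l => .tee i :: decGates l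
  | 3 :: i :: _ :: _ :: l => .teeInv i :: decGates l
  | 4 :: i :: _ :: _ :: l => .flip i :: decGates l
  | 5 :: i :: j :: _ :: l => .cnot i j :: decGates l
  | 6 :: i :: j :: k :: l => .ccnot i j k :: decGates l
  | _ :: _ :: _ :: _ :: l => decGates l
  | _ => []

/-- The `n`-qubit unitary `g` with classical description `[g] = d`. -/
def descUnitary (n : ℕ) (d : List Bool) : QOp n :=
  gatesMat n (decGates (decNatsFrom 0 d))

/-- The `n`-qubit state with classical description `d`: the described circuit is applied
to `|0…0⟩`. -/
def descKet (n : ℕ) (d : List Bool) : Ket n :=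
  fun x => descUnitary n d x (fun _ => false)

/-! ### States -/

/-- `|ψ⟩⟨ψ|`. -/
def pureState {n : ℕ} (ψ : Ket n) : QOp n := Matrix.vecMulVec ψ (star ψ)

/-- `⟨φ|ψ⟩`. -/
def braket {n : ℕ} (φ ψ : Ket n) : ℂ := star φ ⬝ᵥ ψ

/-- `|ψ⟩ ⊗ |φ⟩`. -/
def tensorKet {m n : ℕ} (ψ : Ket m) (φ : Ket n) : Ket (m + n) :=
  fun x => ψ (fun i => x (Fin.castAdd n i)) * φ (fun j => x (Fin.natAdd m j))

/-- `ρ ⊗ ⋯ ⊗ ρ` (`t` copies); qubit `j` of copy `i` is wire `m * i + j`. -/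
def copies (t : ℕ) {m : ℕ} (ρ : QOp m) : QOp (t * m) :=
  fun x y => ∏ i : Fin t,
    ρ (fun j => x (finProdFinEquiv (i, j))) (fun j => y (finProdFinEquiv (i, j)))

/-- The density operator of no qubits. -/
def noInput : QOp 0 := 1

/-- `ρ ⊗ |0…0⟩⟨0…0|` with `a` new qubits. -/
def addAncillas {m : ℕ} (a : ℕ) (ρ : QOp m) : QOp (m + a) :=
  fun x y =>
    if (∀ j : Fin a, x (Fin.natAdd m j) = false) ∧ (∀ j : Fin a, y (Fin.natAdd m j) = false) then
      ρ (fun i => x (Fin.castAdd a i)) (fun i => y (Fin.castAdd a i))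
    else 0

/-! ### Quantum polynomial-time algorithms -/

/-- A quantum circuit that adds `anc` qubits in state `|0⟩` after its input qubits, applies
the gates, and outputs the first `out` wires; all the other wires are discarded. -/
structure QCircuit where
  anc : ℕ
  out : ℕ
  gates : List Gate

/-- The description of a circuit. Numbers are in unary, hence the length of the description
bounds the number of ancillas, of outputs and of gates. -/
def QCircuit.encode (C : QCircuit) : List Bool :=
  encNats (C.anc :: C.out :: C.gates.flatMap Gate.toNats)

/-- The joint state of all wires at the end, on input `ρ`. -/
def QCircuit.final (C : QCircuit) {m : ℕ} (ρ : QOp m) : QOp (m + C.anc) :=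
  gatesMat (m + C.anc) C.gates * addAncillas C.anc ρ * (gatesMat (m + C.anc) C.gates)ᴴ

/-- `E[f(y)]`, where `y` is the bit string obtained by running `C` on `ρ` and measuring
the output wires in the computational basis. -/
def QCircuit.expect (C : QCircuit) {m : ℕ} (ρ : QOp m) (f : List Bool → ℝ) : ℝ :=
  ∑ x : Bits (m + C.anc), (C.final ρ x x).re * f ((List.ofFn x).take C.out)

/-- The probability that measuring the output of `C` on `ρ` gives the one-bit string `1`. -/
def QCircuit.acceptProb (C : QCircuit) {m : ℕ} (ρ : QOp m) : ℝ :=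
  C.expect ρ (fun y => if y = [true] then 1 else 0)

/-- The first `k` wires (a wire that does not exist is read as `0`). -/
def firstWires {N : ℕ} (k : ℕ) (x : Bits N) : Bits k :=
  fun i => if h : (i : ℕ) < N then x ⟨i, h⟩ else false

/-- The state of the first `k` wires at the end, on input `ρ`: the partial trace of the
final state over all the other wires. -/
def QCircuit.outState (C : QCircuit) {m : ℕ} (ρ : QOp m) (k : ℕ) : QOp k :=
  fun a b => ∑ x : Bits (m + C.anc), ∑ y : Bits (m + C.anc),
    if firstWires k x = a ∧ firstWires k y = b ∧
        (∀ i : Fin (m + C.anc), k ≤ (i : ℕ) → x i = y i) then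
      C.final ρ x y
    else 0

/-- A quantum polynomial-time algorithm: a deterministic Turing machine computes, in time
polynomial in the length of the encoded classical input `a`, a description of the circuit
`F a` that is then run (on the quantum input, if any). -/
def IsQPT {α : Type} (enc : α → List Bool) (F : α → QCircuit) : Prop :=
  Nonempty (Turing.TM2ComputableInPolyTime enc QCircuit.encode F)

/-- The classical input `1^l`. -/
abbrev encSec : ℕ → List Bool := Computability.unaryEncodeNat

/-- The classical input `(1^l, k)`, written `1^l 0 k`. -/
def encSecKey (p : ℕ × List Bool) : List Bool := encSec p.1 ++ false :: p.2

/-- Negligible functions: `l ^ c * ν l → 0` for every `c`. -/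
def Negligible (ν : ℕ → ℝ) : Prop :=
  Asymptotics.SuperpolynomialDecay Filter.atTop (fun l : ℕ => (l : ℝ)) ν

/-! ### Quantum group actions -/

/-- A quantum group action: `G(1^l)` outputs a description of a unitary and `S(1^l)` a
description of a state, both on `qubits l` qubits. -/
structure QGA where
  qubits : ℕ → ℕ
  G : ℕ → QCircuit
  S : ℕ → QCircuit
  qubits_poly : Nonempty (Turing.TM2ComputableInPolyTime encSec encSec qubits)
  G_qpt : IsQPT encSec G
  S_qpt : IsQPT encSec S

/-- The probability that the challenger outputs `⊤` when the adversary, a circuit `A`,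
receives `t` copies of `|s⟩` and `t` copies of `g|s⟩` and outputs `[g']`: the challenger
projects `g|s⟩` onto `g'|s⟩`. -/
def QGA.winProb (Q : QGA) (l t : ℕ) (A : QCircuit) : ℝ :=
  (Q.S l).expect noInput fun ds =>
    (Q.G l).expect noInput fun dg =>
      let s : Ket (Q.qubits l) := descKet (Q.qubits l) ds
      let gs : Ket (Q.qubits l) := descUnitary (Q.qubits l) dg *ᵥ s
      A.expect (copies t (pureState (tensorKet s gs))) fun d' =>
        ‖braket (descUnitary (Q.qubits l) d' *ᵥ s) gs‖ ^ 2

/-- One-wayness of a quantum group action. -/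
def QGA.IsOneWay (Q : QGA) : Prop :=
  ∀ A : ℕ → QCircuit, IsQPT encSec A → ∀ t : Polynomial ℕ,
    ∃ ν : ℕ → ℝ, Negligible ν ∧ ∀ l, Q.winProb l (t.eval l) (A l) ≤ ν l

/-! ### One-way state generators -/

/-- The three algorithms `KeyGen(1^l)`, `StateGen(k)` and `Ver(k, ·)` of a state generator;
as usual all of them know `1^l`. The state generated for security parameter `l` has
`qubits l` qubits. -/
structure StateGenerator where
  qubits : ℕ → ℕ
  keyGen : ℕ → QCircuit
  stateGen : ℕ × List Bool → QCircuit
  ver : ℕ × List Bool → QCircuit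
  keyGen_qpt : IsQPT encSec keyGen
  stateGen_qpt : IsQPT encSecKey stateGen
  ver_qpt : IsQPT encSecKey ver
  stateGen_out : ∀ l k, (stateGen (l, k)).out = qubits l

/-- The density operator of the output of `StateGen(k)`. -/
def StateGenerator.state (W : StateGenerator) (l : ℕ) (k : List Bool) : QOp (W.qubits l) :=
  (W.stateGen (l, k)).outState noInput (W.qubits l)

/-- The probability that `Ver(k, ρ)` outputs `⊤`. -/
def StateGenerator.verProb (W : StateGenerator) (l : ℕ) (k : List Bool)
    (ρ : QOp (W.qubits l)) : ℝ :=
  (W.ver (l, k)).acceptProb ρ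

/-- Correctness: an honestly generated state passes, except with negligible probability. -/
def StateGenerator.IsCorrect (W : StateGenerator) : Prop :=
  ∃ ν : ℕ → ℝ, Negligible ν ∧
    ∀ l, 1 - ν l ≤ (W.keyGen l).expect noInput fun k => W.verProb l k (W.state l k)

/-- The probability that the key `k'` output by the adversary, a circuit `A` that receives
`t` copies of the state of `k ← KeyGen(1^l)`, passes verification on that state. -/
def StateGenerator.winProb (W : StateGenerator) (l t : ℕ) (A : QCircuit) : ℝ :=
  (W.keyGen l).expect noInput fun k =>
    A.expect (copies t (W.state l k)) fun k' => W.verProb l k' (W.state l k)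

/-- One-wayness of a state generator. -/
def StateGenerator.IsOneWay (W : StateGenerator) : Prop :=
  ∀ A : ℕ → QCircuit, IsQPT encSec A → ∀ t : Polynomial ℕ,
    ∃ ν : ℕ → ℝ, Negligible ν ∧ ∀ l, W.winProb l (t.eval l) (A l) ≤ ν l

/-- One-way state generators. -/
def StateGenerator.IsOWSG (W : StateGenerator) : Prop :=
  W.IsCorrect ∧ W.IsOneWay

/-- Every generated state is pure, `StateGen(k) = |φ_k⟩`, and `Ver(k, ·)` is the canonical
verification: it accepts `|ψ⟩` with probability `|⟨φ_k|ψ⟩|²`, i.e. projects onto `|φ_k⟩`. -/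
def StateGenerator.IsPureCanonical (W : StateGenerator) : Prop :=
  ∀ l k, ∃ φ : Ket (W.qubits l), W.state l k = pureState φ ∧
    ∀ ψ : Ket (W.qubits l), braket ψ ψ = 1 →
      W.verProb l k (pureState ψ) = ‖braket φ ψ‖ ^ 2

end

/-! Take as key the measured wires of the circuits of `S` and `G`: these contain a description of a
circuit C and of a unitary g, plus bits that are ignored. The state of the key is |s⟩ ⊗ g|s⟩ with
|s⟩ = C|0…0⟩. It equals U|0…0⟩ for a circuit U computed from the key, so running U⁻¹ and testing for
zero implements the projection onto it exactly (`verCircuit_acceptProb`). Purity and canonical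
verification follow, and correctness holds without error.

For one-wayness, t copies of this state are the same thing as t copies of |s⟩ and t copies of g|s⟩.
Let an adversary A against the generator answer with (C', g') and put |s'⟩ = C'|0…0⟩. It passes with
probability |⟨s'|s⟩|² |⟨g's'|gs⟩|². The unitary g' alone may be useless against the group action,
because the component of |s⟩ orthogonal to |s'⟩ can interfere destructively. The remedy is to answer
g' C' Z C'⁻¹ with Z a uniformly random diagonal matrix of signs (-1)^(z·y). Every Z fixes |0…0⟩, and
the other basis states average out by orthogonality of characters (`sum_bitSign`). Hence the mean of
the amplitude ⟨g'C'ZC'⁻¹s|gs⟩ over z is ⟨s|s'⟩⟨g's'|gs⟩, and the square of a mean is at most the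
mean of the squares (`le_average_bitSign`, `twirl_le`). The new adversary therefore wins at least as
often as A, and the same negligible bound serves (`QGA.stateGenerator_winProb_le`).

The new adversary has to be one circuit, although the key of A exists only as the content of wires.
Measuring and then computing has the same distribution as computing reversibly and then measuring
(`QCircuit.expect_classical`), so the description of g'C'ZC'⁻¹ is produced by classical gates. For
each position and each possible gate, a wire records whether that gate starts there
(`startItems_spec`, `actAll_readGates`). The candidates form a fixed list, which can be reversed,
inverted and concatenated in advance. Each candidate is then written either as itself or as an
equally long description of no gate (`itemBits_affVal`, `descGates_twirl`). Fresh wires in the state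
|+⟩ supply z (`twirlCircuit_expect`).

All these circuits must be generated uniformly in polynomial time. The predicate `PT` is closed
under composition, pairing, case distinction and folds with polynomially bounded states; it is
realized by subroutines of stack machines and linked to the machine model by `Trans.of_polyTime` and
`Trans.polyTime`. -/

set_option linter.unusedSectionVars false

/-! ### Subroutines of stack machines and their control flow. -/

noncomputable section


namespace StackMachine

open Turing Turing.TM2 Function

/-- Several steps of a stack machine. -/
def Reach {K Λ σ : Type} {Γ : K → Type} [DecidableEq K] (m : Λ → Stmt Γ Λ σ) (n : ℕ)
    (c c' : Cfg Γ Λ σ) : Prop :=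
  (flip bind (TM2.step m))^[n] (some c) = some c'

section Reach

variable {K Λ σ : Type} {Γ : K → Type} [DecidableEq K] {m : Λ → Stmt Γ Λ σ}

theorem Reach.refl (c : Cfg Γ Λ σ) : Reach m 0 c c := rfl

theorem Reach.trans {n n' : ℕ} {c c' c'' : Cfg Γ Λ σ} (h : Reach m n c c')
    (h' : Reach m n' c' c'') : Reach m (n + n') c c'' := by
  unfold Reach at *
  rw [Nat.add_comm, Function.iterate_add_apply, h, h']

theorem reach_succ {n : ℕ} {c c'' : Cfg Γ Λ σ} :
    Reach m (n + 1) c c'' ↔ ∃ c', TM2.step m c = some c' ∧ Reach m n c' c'' := by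
  unfold Reach
  rw [Function.iterate_succ_apply]
  have key : flip bind (TM2.step m) (some c) = TM2.step m c := rfl
  rw [key]
  constructor
  · intro h
    cases hc : TM2.step m c with
    | none =>
      rw [hc] at h
      have : ∀ n, (flip bind (TM2.step m))^[n] none = none := by
        intro n
        induction n with
        | zero => rfl
        | succ n ih => rw [Function.iterate_succ_apply]; exact ih
      rw [this] at h
      cases h
    | some c' => rw [hc] at h; exact ⟨c', rfl, h⟩
  · rintro ⟨c', hc, h⟩
    rw [hc]; exact h

theorem reach_label_succ {n : ℕ} {l : Λ} {v : σ} {S : ∀ k, List (Γ k)} {c'' : Cfg Γ Λ σ} :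
    Reach m (n + 1) ⟨some l, v, S⟩ c'' ↔ Reach m n (stepAux (m l) v S) c'' := by
  rw [reach_succ]
  constructor
  · rintro ⟨c', hc, h⟩
    rw [TM2.step] at hc
    cases hc; exact h
  · intro h; exact ⟨_, rfl, h⟩

/-- A step from a halted configuration is `none`, so a run that ends in an actual configuration
cannot continue past the halt. -/
theorem reach_halted {n : ℕ} {v : σ} {S : ∀ k, List (Γ k)} {c : Cfg Γ Λ σ}
    (h : Reach m n ⟨none, v, S⟩ c) : c = ⟨none, v, S⟩ := by
  cases n with
  | zero => exact (Option.some.inj h).symm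
  | succ n =>
    rw [reach_succ] at h
    obtain ⟨c', hc, _⟩ := h
    cases hc

end Reach

/-- The lens through which the variable of a subroutine is stored. -/
structure VarLens (σ σ' : Type) where
  get : σ' → σ
  set : σ → σ' → σ'
  get_set : ∀ s v, get (set s v) = s
  set_set : ∀ s s' v, set s (set s' v) = set s v
  set_get : ∀ v, set (get v) v = v

section Embed

variable {K K' Λ Λ' σ σ' : Type} {Γ : K → Type} {Γ' : K' → Type}

/-- A statement of a subroutine as a statement of the calling machine. -/
def embed (L : VarLens σ σ') (lab : Λ → Λ') (exit : Stmt Γ' Λ' σ') (e : K → K')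
    (ε : ∀ k, Γ k ≃ Γ' (e k)) : Stmt Γ Λ σ → Stmt Γ' Λ' σ'
  | .push k f q => .push (e k) (fun v => ε k (f (L.get v))) (embed L lab exit e ε q)
  | .peek k f q => .peek (e k)
      (fun v o => L.set (f (L.get v) (o.map (ε k).symm)) v) (embed L lab exit e ε q)
  | .pop k f q => .pop (e k)
      (fun v o => L.set (f (L.get v) (o.map (ε k).symm)) v) (embed L lab exit e ε q)
  | .load f q => .load (fun v => L.set (f (L.get v)) v) (embed L lab exit e ε q)
  | .branch f q₁ q₂ => .branch (fun v => f (L.get v)) (embed L lab exit e ε q₁)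
      (embed L lab exit e ε q₂)
  | .goto f => .goto (fun v => lab (f (L.get v)))
  | .halt => exit

/-- The stacks `S` of a subroutine are stored in the stacks `S'`. -/
def Stored (e : K → K') (ε : ∀ k, Γ k ≃ Γ' (e k)) (S : ∀ k, List (Γ k))
    (S' : ∀ k, List (Γ' k)) : Prop :=
  ∀ k, S' (e k) = (S k).map (ε k)

/-- The stacks that do not belong to a subroutine agree. -/
def Framed (e : K → K') (S' T' : ∀ k, List (Γ' k)) : Prop :=
  ∀ k', (∀ k, e k ≠ k') → T' k' = S' k'

variable [DecidableEq K] [DecidableEq K'] {e : K → K'} {ε : ∀ k, Γ k ≃ Γ' (e k)}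

theorem Stored.unique {S : ∀ k, List (Γ k)} {B S' T' : ∀ k, List (Γ' k)}
    (h : Stored e ε S S') (h' : Stored e ε S T') (f : Framed e B S') (f' : Framed e B T') :
    S' = T' := by
  funext k'
  by_cases hk : ∃ k, e k = k'
  · obtain ⟨k, rfl⟩ := hk
    rw [h k, h' k]
  · have : ∀ k, e k ≠ k' := fun k hk' => hk ⟨k, hk'⟩
    rw [f k' this, f' k' this]

theorem Stored.update (he : Injective e) {S : ∀ k, List (Γ k)} {S' : ∀ k, List (Γ' k)}
    (h : Stored e ε S S') (k : K) {l : List (Γ k)} {l' : List (Γ' (e k))}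
    (hl : l' = l.map (ε k)) :
    Stored e ε (update S k l) (update S' (e k) l') := by
  intro j
  by_cases hj : j = k
  · subst hj; simp [hl]
  · rw [update_of_ne (fun h => hj (he h)), update_of_ne hj, h j]

theorem Framed.update {B S' : ∀ k, List (Γ' k)} (h : Framed e B S') (k : K)
    (l' : List (Γ' (e k))) : Framed e B (update S' (e k) l') := by
  intro j hj
  rw [update_of_ne (fun h => hj k h.symm), h j hj]

/-- Simulation of one statement, by induction on it. A `halt` of the subroutine becomes `exit`,
which is executed within the same step; stacks outside the range of `e` keep the contents recorded
in `B`. -/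
theorem stepAux_embed (he : Injective e) (L : VarLens σ σ') (lab : Λ → Λ')
    (exit : Stmt Γ' Λ' σ') (B : ∀ k, List (Γ' k)) (q : Stmt Γ Λ σ) :
    ∀ (v : σ') (S : ∀ k, List (Γ k)) (S' : ∀ k, List (Γ' k)), Stored e ε S S' → Framed e B S' →
      ∃ T', Stored e ε (stepAux q (L.get v) S).stk T' ∧ Framed e B T' ∧
        stepAux (embed L lab exit e ε q) v S' =
          match (stepAux q (L.get v) S).l with
          | some l => ⟨some (lab l), L.set (stepAux q (L.get v) S).var v, T'⟩
          | none => stepAux exit (L.set (stepAux q (L.get v) S).var v) T' := by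
  induction q with
  | push k f q ih =>
    intro v S S' h hf
    exact ih v _ _ (h.update he k (by simp [h k])) (hf.update k _)
  | peek k f q ih =>
    intro v S S' h hf
    have := ih (L.set (f (L.get v) (S k).head?) v) S S' h hf
    rw [L.get_set, L.set_set] at this
    simpa [embed, h k, Function.comp_def] using this
  | pop k f q ih =>
    intro v S S' h hf
    have := ih (L.set (f (L.get v) (S k).head?) v) _ _
      (h.update he k (l := (S k).tail) (l' := (S' (e k)).tail) (by simp [h k])) (hf.update k _)
    rw [L.get_set, L.set_set] at this
    simpa [embed, h k, Function.comp_def] using this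
  | load f q ih =>
    intro v S S' h hf
    have := ih (L.set (f (L.get v)) v) S S' h hf
    rw [L.get_set, L.set_set] at this
    simpa [embed] using this
  | branch f q₁ q₂ ih₁ ih₂ =>
    intro v S S' h hf
    simp only [embed, stepAux]
    cases f (L.get v)
    · exact ih₂ v S S' h hf
    · exact ih₁ v S S' h hf
  | goto f =>
    intro v S S' h hf
    refine ⟨S', h, hf, ?_⟩
    simp [embed, L.set_get]
  | halt =>
    intro v S S' h hf
    refine ⟨S', h, hf, ?_⟩
    simp [embed, L.set_get]

/-- Every step of the subroutine is one step of the caller. Since `exit` is merged into the last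
step, returning costs no additional time. -/
theorem reach_embed (he : Injective e) (L : VarLens σ σ') (lab : Λ → Λ')
    (exit : Stmt Γ' Λ' σ') (B : ∀ k, List (Γ' k)) {m : Λ → Stmt Γ Λ σ} {m' : Λ' → Stmt Γ' Λ' σ'}
    (hm : ∀ l, m' (lab l) = embed L lab exit e ε (m l)) (n : ℕ) :
    ∀ (l : Λ) (v : σ') (S S₁ : ∀ k, List (Γ k)) (s₁ : σ) (S' : ∀ k, List (Γ' k)),
      Stored e ε S S' → Framed e B S' → Reach m n ⟨some l, L.get v, S⟩ ⟨none, s₁, S₁⟩ →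
      ∃ T', Stored e ε S₁ T' ∧ Framed e B T' ∧ ∃ n' ≤ n,
        Reach m' n' ⟨some (lab l), v, S'⟩ (stepAux exit (L.set s₁ v) T') := by
  induction n with
  | zero => intro l v S S₁ s₁ S' _ _ h; cases (Option.some.inj h)
  | succ n ih =>
    intro l v S S₁ s₁ S' h hf hr
    rw [reach_label_succ] at hr
    obtain ⟨T', hT, hTf, hc⟩ := stepAux_embed he L lab exit B (m l) v S S' h hf
    rcases hs : stepAux (m l) (L.get v) S with ⟨l', s', S₂⟩
    rw [hs] at hT hc hr
    cases l' with
    | none =>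
      have := reach_halted hr
      cases this
      refine ⟨T', hT, hTf, 1, by omega, ?_⟩
      rw [reach_label_succ, hm, hc]
      exact Reach.refl _
    | some l' =>
      have hr' : Reach m n ⟨some l', L.get (L.set s' v), S₂⟩ ⟨none, s₁, S₁⟩ := by
        rw [L.get_set]; exact hr
      obtain ⟨T₂, h2, hf2, n', hn', hr2⟩ := ih l' (L.set s' v) S₂ S₁ s₁ T' hT hTf hr'
      refine ⟨T₂, h2, hf2, n' + 1, by omega, ?_⟩
      rw [reach_label_succ, hm, hc]
      rw [L.set_set] at hr2
      exact hr2

end Embed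

/-- A subroutine that works on the stacks `Γ`. -/
structure Frag {K : Type} (Γ : K → Type) where
  Λ : Type
  σ : Type
  [finΛ : Fintype Λ]
  [finσ : Fintype σ]
  main : Λ
  init : σ
  m : Λ → Stmt Γ Λ σ

attribute [instance] Frag.finΛ Frag.finσ

/-- The subroutine turns the stacks `S` into `S'` in at most `t` steps. -/
def Does {K : Type} [DecidableEq K] {Γ : K → Type} (F : Frag Γ) (t : ℕ)
    (S S' : ∀ k, List (Γ k)) : Prop :=
  ∃ n ≤ t, Reach F.m n ⟨some F.main, F.init, S⟩ ⟨none, F.init, S'⟩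

section Frag

variable {K : Type} [DecidableEq K] {Γ : K → Type}

theorem Does.mono {F : Frag Γ} {t t' : ℕ} {S S' : ∀ k, List (Γ k)} (h : Does F t S S')
    (ht : t ≤ t') : Does F t' S S' :=
  let ⟨n, hn, hr⟩ := h
  ⟨n, hn.trans ht, hr⟩

/-- The identity lens. -/
def VarLens.id (σ : Type) : VarLens σ σ := ⟨fun v => v, fun s _ => s, by simp, by simp, by simp⟩

/-- A subroutine moved to other stacks. -/
def Frag.lift {K' : Type} {Γ' : K' → Type} (F : Frag Γ) (e : K → K')
    (ε : ∀ k, Γ k ≃ Γ' (e k)) : Frag Γ' where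
  Λ := F.Λ
  σ := F.σ
  main := F.main
  init := F.init
  m l := embed (VarLens.id F.σ) (fun l => l) .halt e ε (F.m l)

theorem Does.lift {K' : Type} [DecidableEq K'] {Γ' : K' → Type} {F : Frag Γ} {t : ℕ}
    {S S₁ : ∀ k, List (Γ k)} (h : Does F t S S₁) {e : K → K'} (he : Injective e)
    {ε : ∀ k, Γ k ≃ Γ' (e k)} {S' T' : ∀ k, List (Γ' k)} (hS : Stored e ε S S')
    (hT : Stored e ε S₁ T') (hf : Framed e S' T') : Does (F.lift e ε) t S' T' := by
  obtain ⟨n, hn, hr⟩ := h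
  obtain ⟨T₂, h1, h2, n', hn', hr'⟩ := reach_embed (ε := ε) (m' := (F.lift e ε).m) he
    (VarLens.id F.σ) (fun l => l) .halt S' (fun l => rfl) n F.main F.init S S₁ F.init S' hS
    (fun _ _ => rfl) hr
  rw [Stored.unique h1 hT h2 hf] at hr'
  exact ⟨n', hn'.trans hn, hr'⟩

/-- A subroutine that executes a single statement without jumps. -/
def Frag.stmt (Γ : K → Type) (q : Stmt Γ Unit Unit) : Frag Γ := ⟨Unit, Unit, (), (), fun _ => q⟩

/-- Control flow: `ctl none` is executed first, it chooses a subroutine `F i`, after which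
`ctl (some i)` is executed. -/
def Frag.flow {I : Type} [Fintype I] [DecidableEq I] (F : I → Frag Γ) {τ : Type} [Fintype τ]
    (v₀ : τ) (ctl : Option I → Stmt Γ I τ) : Frag Γ where
  Λ := Option I ⊕ Σ i, (F i).Λ
  σ := (∀ i, (F i).σ) × τ
  main := .inl none
  init := (fun i => (F i).init, v₀)
  m := Sum.elim
    (fun o => embed ⟨Prod.snd, fun s v => (v.1, s), by simp, by simp, by simp⟩
      (fun i => .inr ⟨i, (F i).main⟩) .halt (fun k => k) (fun _ => Equiv.refl _) (ctl o))
    (fun p => embed ⟨fun v => v.1 p.1, fun s v => (update v.1 p.1 s, v.2), by simp, by simp,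
        by simp⟩
      (fun l => .inr ⟨p.1, l⟩) (.goto fun _ => .inl (some p.1)) (fun k => k)
      (fun _ => Equiv.refl _) ((F p.1).m p.2))

section Flow

variable {I : Type} [Fintype I] [DecidableEq I] {F : I → Frag Γ} {τ : Type} [Fintype τ] {v₀ : τ}
  {ctl : Option I → Stmt Γ I τ}

theorem stored_refl_iff {S S' : ∀ k, List (Γ k)} :
    Stored (fun k => k) (fun k => Equiv.refl (Γ k)) S S' ↔ S' = S := by
  constructor
  · intro h
    funext k
    have := h k
    simpa using this
  · rintro rfl k
    simp

theorem flow_halt {o : Option I} {v v' : τ} {S S' : ∀ k, List (Γ k)}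
    (h : stepAux (ctl o) v S = ⟨none, v', S'⟩) :
    Reach (Frag.flow F v₀ ctl).m 1 ⟨some (.inl o), (fun i => (F i).init, v), S⟩
      ⟨none, (fun i => (F i).init, v'), S'⟩ := by
  refine reach_label_succ.2 ?_
  obtain ⟨T', h1, -, h2⟩ := stepAux_embed (e := fun k => k) (ε := fun k => Equiv.refl (Γ k))
    injective_id
    (⟨Prod.snd, fun s v => (v.1, s), by simp, by simp, by simp⟩ :
      VarLens τ ((∀ i, (F i).σ) × τ))
    (fun i => (.inr ⟨i, (F i).main⟩ : Option I ⊕ Σ i, (F i).Λ)) .halt S (ctl o)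
    (fun i => (F i).init, v) S S (stored_refl_iff.2 rfl) (fun _ _ => rfl)
  simp only [h] at h1 h2
  cases stored_refl_iff.1 h1
  simp only [Frag.flow, Sum.elim_inl]
  rw [h2]
  exact Reach.refl _

/-- At each control point all variables of the subroutines have their initial values. This invariant
survives a call because `Does` requires a subroutine to restore its variable, and so the same
subroutine may be called repeatedly. The extra step is the dispatching control statement. -/
theorem flow_step {o : Option I} {i : I} {v v' : τ} {S S' S₁ : ∀ k, List (Γ k)} {t : ℕ}
    (h : stepAux (ctl o) v S = ⟨some i, v', S'⟩) (hF : Does (F i) t S' S₁) :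
    ∃ n ≤ t + 1, Reach (Frag.flow F v₀ ctl).m n ⟨some (.inl o), (fun i => (F i).init, v), S⟩
      ⟨some (.inl (some i)), (fun i => (F i).init, v'), S₁⟩ := by
  obtain ⟨T', h1, -, h2⟩ := stepAux_embed (e := fun k => k) (ε := fun k => Equiv.refl (Γ k))
    injective_id
    (⟨Prod.snd, fun s v => (v.1, s), by simp, by simp, by simp⟩ :
      VarLens τ ((∀ i, (F i).σ) × τ))
    (fun i => (.inr ⟨i, (F i).main⟩ : Option I ⊕ Σ i, (F i).Λ)) .halt S (ctl o)
    (fun i => (F i).init, v) S S (stored_refl_iff.2 rfl) (fun _ _ => rfl)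
  simp only [h] at h1 h2
  cases stored_refl_iff.1 h1
  obtain ⟨n, hn, hr⟩ := hF
  obtain ⟨T₂, h3, -, n', hn', hr'⟩ := reach_embed (m' := (Frag.flow F v₀ ctl).m)
    (e := fun k => k) (ε := fun k => Equiv.refl (Γ k)) injective_id
    (⟨fun v => v.1 i, fun s v => (update v.1 i s, v.2), by simp, by simp, by simp⟩ :
      VarLens (F i).σ ((∀ i, (F i).σ) × τ))
    (fun l => .inr ⟨i, l⟩) (.goto fun _ => .inl (some i)) S' (fun l => rfl) n (F i).main
    (fun i => (F i).init, v') S' S₁ (F i).init S' (stored_refl_iff.2 rfl) (fun _ _ => rfl) hr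
  cases stored_refl_iff.1 h3
  refine ⟨n' + 1, by omega, ?_⟩
  refine reach_label_succ.2 ?_
  simp only [Frag.flow, Sum.elim_inl]
  rw [h2]
  simp only [Function.update_eq_self] at hr'
  exact hr'

end Flow

/-- Sequential composition. -/
def Frag.seq (F G : Frag Γ) : Frag Γ :=
  Frag.flow (fun b : Bool => if b then G else F) ()
    (fun o => match o with
      | none => .goto fun _ => false
      | some false => .goto fun _ => true
      | some true => .halt)

theorem Does.seq {F G : Frag Γ} {t t' : ℕ} {S S' S'' : ∀ k, List (Γ k)} (h : Does F t S S')
    (h' : Does G t' S' S'') : Does (F.seq G) (t + t' + 3) S S'' := by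
  obtain ⟨n, hn, hr⟩ := flow_step (F := fun b : Bool => if b then G else F) (v₀ := ())
    (ctl := (fun o => match o with
      | none => .goto fun _ => false
      | some false => .goto fun _ => true
      | some true => .halt)) (o := none) (i := false) (v := ()) (v' := ()) (S := S) rfl h
  obtain ⟨n', hn', hr'⟩ := flow_step (F := fun b : Bool => if b then G else F) (v₀ := ())
    (ctl := (fun o => match o with
      | none => .goto fun _ => false
      | some false => .goto fun _ => true
      | some true => .halt)) (o := some false) (i := true) (v := ()) (v' := ()) (S := S') rfl h'
  have h3 := flow_halt (F := fun b : Bool => if b then G else F) (v₀ := ())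
    (ctl := (fun o => match o with
      | none => .goto fun _ => false
      | some false => .goto fun _ => true
      | some true => .halt)) (o := some true) (v := ()) (v' := ()) (S := S'') rfl
  exact ⟨n + n' + 1, by omega, (hr.trans hr').trans h3⟩

/-- Pop an element of the stack `k`, classify it, run the chosen subroutine, and repeat if
`cont` says so. -/
def Frag.popLoop (k : K) (cls : Γ k → Bool) (body : Option Bool → Frag Γ)
    (cont : Option Bool → Bool) : Frag Γ :=
  Frag.flow body (none : Option Bool)
    (fun o => if o.elim true cont then .pop k (fun _ a => a.map cls) (.goto id)
      else .load (fun _ => none) .halt)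

theorem Does.popLoop_reach {k : K} {cls : Γ k → Bool} {body : Option Bool → Frag Γ}
    {cont : Option Bool → Bool} {t : ℕ} {S S₁ : ∀ k, List (Γ k)}
    (h : Does (body ((S k).head?.map cls)) t (update S k (S k).tail) S₁)
    (o : Option (Option Bool)) (ho : o.elim true cont = true) (v : Option Bool) :
    ∃ n ≤ t + 1, Reach (Frag.popLoop k cls body cont).m n
      ⟨some (.inl o), (fun i => (body i).init, v), S⟩
      ⟨some (.inl (some ((S k).head?.map cls))),
        (fun i => (body i).init, (S k).head?.map cls), S₁⟩ :=
  flow_step (by simp only [ho]; rfl) h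

theorem Does.popLoop_exit {k : K} {cls : Γ k → Bool} {body : Option Bool → Frag Γ}
    {cont : Option Bool → Bool} {t : ℕ} {S S₁ : ∀ k, List (Γ k)}
    (h : Does (body ((S k).head?.map cls)) t (update S k (S k).tail) S₁)
    (hc : cont ((S k).head?.map cls) = false) :
    Does (Frag.popLoop k cls body cont) (t + 2) S S₁ := by
  obtain ⟨n, hn, hr⟩ := h.popLoop_reach (cont := cont) none rfl none
  have := flow_halt (F := body) (v₀ := none) (ctl := fun o =>
    if o.elim true cont then .pop k (fun _ a => a.map cls) (.goto id)
      else .load (fun _ => none) .halt) (o := some ((S k).head?.map cls))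
      (v := (S k).head?.map cls) (v' := none) (S := S₁) (S' := S₁) (by simp [hc])
  exact ⟨n + 1, by omega, hr.trans this⟩

theorem Does.popLoop_again {k : K} {cls : Γ k → Bool} {body : Option Bool → Frag Γ}
    {cont : Option Bool → Bool} {t t' : ℕ} {S S₁ S₂ : ∀ k, List (Γ k)}
    (h : Does (body ((S k).head?.map cls)) t (update S k (S k).tail) S₁)
    (hc : cont ((S k).head?.map cls) = true)
    (h' : Does (Frag.popLoop k cls body cont) t' S₁ S₂) :
    Does (Frag.popLoop k cls body cont) (t + t' + 1) S S₂ := by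
  obtain ⟨n, hn, hr⟩ := h.popLoop_reach (cont := cont) none rfl none
  obtain ⟨n', hn', hr'⟩ := h'
  cases n' with
  | zero => cases Option.some.inj hr'
  | succ n' =>
    refine ⟨n + (n' + 1), by omega, hr.trans ?_⟩
    -- The run `h'` starts at the entry of the loop, whereas the machine now stands at the control
    -- point after the body, with another value of the control variable. As `cont` holds, both
    -- execute the same `pop`, which overwrites that variable, so the configurations agree after one
    -- step.
    have key := reach_label_succ.1 hr'
    refine reach_label_succ.2 ?_
    convert key using 1
    simp [Frag.popLoop, Frag.flow, embed, hc]

end Frag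

end StackMachine
end

/-! ### Polynomial-time relations between words. -/

noncomputable section

namespace StackMachine

open Turing Turing.TM2 Function

theorem eval_mono (p : Polynomial ℕ) {m n : ℕ} (h : m ≤ n) : p.eval m ≤ p.eval n := by
  rw [Polynomial.eval_eq_sum, Polynomial.eval_eq_sum]
  exact Finset.sum_le_sum fun i _ => Nat.mul_le_mul_left _ (Nat.pow_le_pow_left h i)

/-- The alphabets `Γ` together with a main stack of bits. -/
def Alph {K : Type} (Γ : K → Type) : Option K → Type
  | none => Bool
  | some k => Γ k

/-- The main stack holds `w`, all others are empty. -/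
def only {K : Type} {Γ : K → Type} (w : List Bool) : ∀ k, List (Alph Γ k)
  | none => w
  | some _ => []

/-- Some stack machine turns `w` into `w'` in polynomial time whenever `R w w'`. -/
def Comp (R : List Bool → List Bool → Prop) : Prop :=
  ∃ (K : Type) (_ : DecidableEq K) (_ : Fintype K) (Γ : K → Type) (F : Frag (Alph Γ))
    (p : Polynomial ℕ), ∀ w w', R w w' → Does F (p.eval w.length) (only w) (only w')

/-- The number of pushes in a statement. -/
def pushes {K Λ σ : Type} {Γ : K → Type} : Stmt Γ Λ σ → ℕ
  | .push _ _ q => pushes q + 1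
  | .peek _ _ q => pushes q
  | .pop _ _ q => pushes q
  | .load _ q => pushes q
  | .branch _ q₁ q₂ => pushes q₁ + pushes q₂
  | .goto _ => 0
  | .halt => 0

theorem length_stepAux_le {K Λ σ : Type} {Γ : K → Type} [DecidableEq K] (q : Stmt Γ Λ σ) (k : K) :
    ∀ (v : σ) (S : ∀ k, List (Γ k)),
      ((stepAux q v S).stk k).length ≤ (S k).length + pushes q := by
  induction q with
  | push k' f q ih =>
    intro v S
    refine (ih v _).trans ?_
    by_cases h : k = k'
    · subst h; simp [pushes]; omega
    · rw [update_of_ne h, pushes]; omega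
  | peek k' f q ih => intro v S; exact ih _ _
  | pop k' f q ih =>
    intro v S
    refine (ih _ _).trans ?_
    by_cases h : k = k'
    · subst h; simp [pushes]
    · rw [update_of_ne h]; exact le_rfl
  | load f q ih => intro v S; exact ih _ _
  | branch f q₁ q₂ ih₁ ih₂ =>
    intro v S
    simp only [stepAux, pushes]
    cases f v
    · exact (ih₂ v S).trans (by omega)
    · exact (ih₁ v S).trans (by omega)
  | goto f => intro v S; simp [pushes]
  | halt => intro v S; simp [pushes]

theorem length_reach_le {K Λ σ : Type} {Γ : K → Type} [DecidableEq K] {m : Λ → Stmt Γ Λ σ} (c : ℕ)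
    (hc : ∀ l, pushes (m l) ≤ c) (k : K) (n : ℕ) :
    ∀ {a b : Cfg Γ Λ σ}, Reach m n a b → (b.stk k).length ≤ (a.stk k).length + n * c := by
  induction n with
  | zero => intro a b h; cases Option.some.inj h; simp
  | succ n ih =>
    intro a b h
    obtain ⟨c', h1, h2⟩ := reach_succ.1 h
    obtain ⟨l, v, S⟩ := a
    cases l with
    | none => cases h1
    | some l =>
      cases h1
      have h3 := length_stepAux_le (m l) k v S
      have h4 := ih h2
      have h5 := hc l
      simp only [Nat.add_mul, Nat.one_mul] at *
      omega

/-- One step pushes at most as many symbols as the longest statement contains, so the output is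
bounded by the input length plus a constant times the running time. Composing machines needs this,
since the time of the second is measured in the output of the first. -/
theorem Comp.length_le {R : List Bool → List Bool → Prop} (h : Comp R) :
    ∃ q : Polynomial ℕ, ∀ w w', R w w' → w'.length ≤ q.eval w.length := by
  obtain ⟨K, _, _, Γ, F, p, hp⟩ := h
  let c := Finset.univ.sup fun l => pushes (F.m l)
  refine ⟨Polynomial.X + p * Polynomial.C c, fun w w' hw => ?_⟩
  obtain ⟨n, hn, hr⟩ := hp w w' hw
  have := length_reach_le c (fun l => Finset.le_sup (f := fun l => pushes (F.m l))
    (Finset.mem_univ l)) none n hr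
  simp only [only] at this
  simp only [Polynomial.eval_add, Polynomial.eval_X, Polynomial.eval_mul, Polynomial.eval_C]
  exact this.trans (Nat.add_le_add_left (Nat.mul_le_mul_right _ hn) _)

theorem Comp.mono {R R' : List Bool → List Bool → Prop} (h : Comp R)
    (h' : ∀ w w', R' w w' → R w w') : Comp R' :=
  let ⟨K, d, f, Γ, F, p, hp⟩ := h
  ⟨K, d, f, Γ, F, p, fun w w' hw => hp w w' (h' w w' hw)⟩

/-! ### Programs with three registers and subroutines -/

section Prog

variable {I : Type} [DecidableEq I] {Ki : I → Type} [∀ i, DecidableEq (Ki i)]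
  {Γi : ∀ i, Ki i → Type}

/-- Stacks of a program: two auxiliary registers and the stacks of the subroutines. -/
abbrev ProgAlph (Γi : ∀ i, Ki i → Type) : (Bool ⊕ Σ i, Ki i) → Type :=
  Sum.elim (fun _ => Bool) (fun p => Γi p.1 p.2)

/-- The stack of a register. -/
def reg (Ki : I → Type) : Option Bool → Option (Bool ⊕ Σ i, Ki i) := Option.map Sum.inl

/-- Registers hold bits. -/
def regEquiv (Γi : ∀ i, Ki i → Type) : ∀ r, Bool ≃ Alph (ProgAlph Γi) (reg Ki r)
  | none => Equiv.refl Bool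
  | some _ => Equiv.refl Bool

/-- The stacks when the registers hold `s`. -/
def regStacks (Γi : ∀ i, Ki i → Type) (s : Option Bool → List Bool) :
    ∀ k, List (Alph (ProgAlph Γi) k)
  | none => s none
  | some (.inl r) => s (some r)
  | some (.inr _) => []

theorem stacks_reg (s : Option Bool → List Bool) (r : Option Bool) :
    regStacks Γi s (reg Ki r) = (s r).map (regEquiv Γi r) := by
  cases r <;> exact (List.map_id _).symm

theorem update_stacks (s : Option Bool → List Bool) (r : Option Bool) (l : List Bool) :
    update (regStacks Γi s) (reg Ki r) (l.map (regEquiv Γi r)) = regStacks Γi (update s r l) := by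
  funext k
  by_cases hk : k = reg Ki r
  · subst hk; rw [update_self, stacks_reg, update_self]
  · rw [update_of_ne hk]
    rcases k with _ | k | k
    · have : none ≠ r := by rintro rfl; exact hk rfl
      simp only [regStacks, update_of_ne this]; rfl
    · have : some k ≠ r := by rintro rfl; exact hk rfl
      simp only [regStacks, update_of_ne this]; rfl
    · rfl

/-- The program `P` turns the registers `s` into `s'` in `t` steps. -/
def Run (P : Frag (Alph (ProgAlph Γi))) (t : ℕ) (s s' : Option Bool → List Bool) : Prop :=
  Does P t (regStacks Γi s) (regStacks Γi s')

theorem Run.mono {P : Frag (Alph (ProgAlph Γi))} {t t' : ℕ} {s s' : Option Bool → List Bool}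
    (h : Run P t s s') (ht : t ≤ t') : Run P t' s s' := Does.mono h ht

theorem Run.seq {P Q : Frag (Alph (ProgAlph Γi))} {t t' : ℕ} {s s' s'' : Option Bool → List Bool}
    (h : Run P t s s') (h' : Run Q t' s' s'') : Run (P.seq Q) (t + t' + 3) s s'' :=
  Does.seq h h'

/-- Do nothing. -/
def skip : Frag (Alph (ProgAlph Γi)) := Frag.stmt _ .halt

theorem run_skip (s : Option Bool → List Bool) : Run (skip (Γi := Γi)) 1 s s :=
  ⟨1, le_rfl, rfl⟩

/-- Push a bit. -/
def push (r : Option Bool) (b : Bool) : Frag (Alph (ProgAlph Γi)) :=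
  Frag.stmt _ (.push (reg Ki r) (fun _ => regEquiv Γi r b) .halt)

theorem run_push (r : Option Bool) (b : Bool) (s : Option Bool → List Bool) :
    Run (push (Γi := Γi) r b) 1 s (update s r (b :: s r)) := by
  refine ⟨1, le_rfl, reach_label_succ.2 ?_⟩
  rw [← update_stacks, List.map_cons, ← stacks_reg]
  rfl

/-- Call a subroutine on a register. -/
def call (F : ∀ i, Frag (Alph (Γi i))) (i : I) (r : Option Bool) : Frag (Alph (ProgAlph Γi)) :=
  (F i).lift (fun o => o.elim (reg Ki r) (fun k => some (.inr ⟨i, k⟩)))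
    (fun o => match o with
      | none => regEquiv Γi r
      | some _ => Equiv.refl _)

/-- The main stack of the subroutine is identified with register `r` and its other stacks with its
private copies, which are empty before and after the call. -/
theorem run_call {F : ∀ i, Frag (Alph (Γi i))} {i : I} {r : Option Bool} {t : ℕ}
    {s : Option Bool → List Bool} {w : List Bool} (h : Does (F i) t (only (s r)) (only w)) :
    Run (call F i r) t s (update s r w) := by
  refine Does.lift h ?_ ?_ ?_ ?_
  · intro a b hab
    cases a <;> cases b
    · rfl
    · cases r <;> simp [reg] at hab
    · cases r <;> simp [reg] at hab
    · simpa using hab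
  · intro k
    cases k
    · exact stacks_reg s r
    · rfl
  · intro k
    cases k
    · simp only [Option.elim, stacks_reg, update_self]; rfl
    · rfl
  · intro k' hk
    rw [← update_stacks, update_of_ne]
    exact fun h => hk none h.symm

/-- Pop a bit, run the chosen program, and repeat if `cont` says so. -/
def loop (r : Option Bool) (body : Option Bool → Frag (Alph (ProgAlph Γi)))
    (cont : Option Bool → Bool) : Frag (Alph (ProgAlph Γi)) :=
  Frag.popLoop (reg Ki r) (regEquiv Γi r).symm body cont

theorem head_stacks (s : Option Bool → List Bool) (r : Option Bool) :
    (regStacks Γi s (reg Ki r)).head?.map (regEquiv Γi r).symm = (s r).head? := by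
  rw [stacks_reg]
  cases s r <;> simp

theorem pop_stacks (s : Option Bool → List Bool) (r : Option Bool) :
    update (regStacks Γi s) (reg Ki r) (regStacks Γi s (reg Ki r)).tail =
      regStacks Γi (update s r (s r).tail) := by
  rw [← update_stacks, stacks_reg, List.map_tail]

theorem Run.loop_exit {r : Option Bool} {body : Option Bool → Frag (Alph (ProgAlph Γi))}
    {cont : Option Bool → Bool} {t : ℕ} {s s' : Option Bool → List Bool}
    (h : Run (body (s r).head?) t (update s r (s r).tail) s') (hc : cont (s r).head? = false) :
    Run (loop r body cont) (t + 2) s s' := by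
  refine Does.popLoop_exit ?_ ?_
  · rw [head_stacks, pop_stacks]; exact h
  · rw [head_stacks]; exact hc

theorem Run.loop_again {r : Option Bool} {body : Option Bool → Frag (Alph (ProgAlph Γi))}
    {cont : Option Bool → Bool} {t t' : ℕ} {s s' s'' : Option Bool → List Bool}
    (h : Run (body (s r).head?) t (update s r (s r).tail) s') (hc : cont (s r).head? = true)
    (h' : Run (loop r body cont) t' s' s'') :
    Run (loop r body cont) (t + t' + 1) s s'' := by
  refine Does.popLoop_again ?_ ?_ h'
  · rw [head_stacks, pop_stacks]; exact h
  · rw [head_stacks]; exact hc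

/-- Registers with contents `a`, `b` and `c`. -/
def regs (a b c : List Bool) : Option Bool → List Bool
  | none => a
  | some false => b
  | some true => c

@[simp] theorem update_regs_none (a b c x : List Bool) :
    update (regs a b c) none x = regs x b c := by
  funext r; rcases r with _ | _ | _ <;> simp [regs]

@[simp] theorem update_regs_false (a b c x : List Bool) :
    update (regs a b c) (some false) x = regs a x c := by
  funext r; rcases r with _ | _ | _ <;> simp [regs]

@[simp] theorem update_regs_true (a b c x : List Bool) :
    update (regs a b c) (some true) x = regs a b x := by
  funext r; rcases r with _ | _ | _ <;> simp [regs]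

theorem stacks_regs (w : List Bool) : regStacks Γi (regs w [] []) = only w := by
  funext k; rcases k with _ | (_ | _) | k <;> rfl

theorem Comp.of_run [Fintype I] [∀ i, Fintype (Ki i)] {R : List Bool → List Bool → Prop}
    (P : Frag (Alph (ProgAlph Γi))) (p : Polynomial ℕ)
    (h : ∀ w w', R w w' → Run P (p.eval w.length) (regs w [] []) (regs w' [] [])) : Comp R := by
  refine ⟨Bool ⊕ Σ i, Ki i, inferInstance, inferInstance, ProgAlph Γi, P, p, fun w w' hw => ?_⟩
  rw [← stacks_regs (Γi := Γi), ← stacks_regs (Γi := Γi)]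
  exact h w w' hw

/-- Pop all bits of `r`; `body b` is executed for each bit `b`. -/
def forBits (r : Option Bool) (body : Bool → Frag (Alph (ProgAlph Γi))) :
    Frag (Alph (ProgAlph Γi)) :=
  loop r (fun o => o.elim skip body) Option.isSome

theorem Run.forBits_nil {r : Option Bool} {body : Bool → Frag (Alph (ProgAlph Γi))}
    {s : Option Bool → List Bool} (h : s r = []) : Run (forBits r body) 3 s s := by
  unfold forBits
  refine Run.loop_exit (t := 1) ?_ (by simp [h])
  have h' : update s r (s r).tail = s := by rw [h, List.tail_nil, ← h, update_eq_self]
  rw [h', h]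
  exact run_skip (Γi := Γi) s

theorem Run.forBits_cons {r : Option Bool} {body : Bool → Frag (Alph (ProgAlph Γi))}
    {s s' s'' : Option Bool → List Bool} {b : Bool} {l : List Bool} {t t' : ℕ} (hs : s r = b :: l)
    (h : Run (body b) t (update s r l) s') (h' : Run (forBits r body) t' s' s'') :
    Run (forBits r body) (t + t' + 1) s s'' := by
  refine Run.loop_again (s' := s') ?_ (by simp [hs]) h'
  rw [hs]; exact h

/-- Move the bits of register `r` to `r'`, in reverse order. -/
def move (r r' : Option Bool) : Frag (Alph (ProgAlph Γi)) := forBits r (fun b => push r' b)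

theorem run_move {r r' : Option Bool} (hr : r ≠ r') (l : List Bool) :
    ∀ s : Option Bool → List Bool, s r = l →
      Run (move (Γi := Γi) r r') (2 * l.length + 3) s
        (update (update s r []) r' (l.reverse ++ s r')) := by
  induction l with
  | nil =>
    intro s hs
    have : update (update s r []) r' ([].reverse ++ s r') = s := by
      rw [← hs, update_eq_self, hs]; simp
    rw [this]
    exact Run.forBits_nil hs
  | cons b l ih =>
    intro s hs
    have h1 := run_push (Γi := Γi) r' b (update s r l)
    rw [update_of_ne hr.symm] at h1
    have h2 := ih (update (update s r l) r' (b :: s r')) (by rw [update_of_ne hr, update_self])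
    have h3 : Run (move (Γi := Γi) r r') _ _ _ := Run.forBits_cons hs h1 h2
    refine Run.mono (t := 1 + (2 * l.length + 3) + 1) ?_ (by simp; omega)
    convert h3 using 1
    funext x
    by_cases e1 : x = r'
    · subst e1; simp
    · by_cases e2 : x = r
      · subst e2; simp [update_of_ne e1]
      · simp [update_of_ne e1, update_of_ne e2]

end Prog

end StackMachine
end

/-! ### Equivalence with polynomial time on `FinTM2` machines. -/

noncomputable section

namespace StackMachine

open Turing Turing.TM2 Function

/-- In polynomial time the word `ea a` is turned into `eb a`. -/
def Trans {α : Type} (ea eb : α → List Bool) : Prop :=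
  Comp (fun w w' => ∃ a, w = ea a ∧ w' = eb a)

section PolyTime

variable {α β : Type} {ea : α → List Bool} {eb : β → List Bool} {f : α → β}

/-- With the main stack as both input and output stack, `only w` is exactly the stack content of the
initial and of the halting configuration. -/
theorem Trans.polyTime (h : Trans ea (fun a => eb (f a))) :
    Nonempty (TM2ComputableInPolyTime ea eb f) := by
  obtain ⟨K, _, _, Γ, F, p, hp⟩ := h
  let tm : FinTM2 :=
    { K := Option K
      k₀ := none
      k₁ := none
      Γ := Alph Γ
      Λ := F.Λ
      main := F.main
      σ := F.σ
      initialState := F.init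
      Γk₀Fin := inferInstanceAs (Fintype Bool)
      m := F.m }
  refine ⟨⟨⟨tm, Equiv.refl Bool, Equiv.refl Bool⟩, p, fun a => ?_⟩⟩
  have h := hp (ea a) (eb (f a)) ⟨a, rfl, rfl⟩
  have hm : ∀ w : List Bool, w.map (Equiv.refl Bool).invFun = w := List.map_id
  have hi : ∀ w w' : List Bool, w' = w → initList tm w' = ⟨some F.main, F.init, only w⟩ := by
    rintro w _ rfl
    refine congrArg (Cfg.mk _ _) ?_
    funext k
    cases k <;> rfl
  have ho : ∀ w w' : List Bool, w' = w → haltList tm w' = ⟨none, F.init, only w⟩ := by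
    rintro w _ rfl
    refine congrArg (Cfg.mk _ _) ?_
    funext k
    cases k <;> rfl
  refine ⟨⟨h.choose, ?_⟩, h.choose_spec.1⟩
  exact (congrArg _ (congrArg some (hi _ _ (hm _)))).trans
    (Eq.trans h.choose_spec.2 (congrArg some (ho _ _ (hm _)).symm))

/-- The stacks of a machine together with registers. -/
def fullStacks {K : Type} (Γ : K → Type) (s : Option Bool → List Bool) (T : ∀ k, List (Γ k)) :
    ∀ k, List (Alph (ProgAlph fun _ : Unit => Γ) k)
  | none => s none
  | some (.inl r) => s (some r)
  | some (.inr ⟨_, k⟩) => T k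

section Full

variable {K : Type} [DecidableEq K] {Γ : K → Type}

theorem update_fullStacks_false (a b c x : List Bool) (T : ∀ k, List (Γ k)) :
    update (fullStacks Γ (regs a b c) T) (some (.inl false)) x = fullStacks Γ (regs a x c) T := by
  funext k
  rcases k with _ | (_ | _) | ⟨_, k⟩
  all_goals rfl

theorem update_fullStacks_inr (s : Option Bool → List Bool) (T : ∀ k, List (Γ k)) (k : K)
    (x : List (Γ k)) :
    update (fullStacks Γ s T) (some (.inr ⟨(), k⟩)) x = fullStacks Γ s (update T k x) := by
  funext j
  rcases j with _ | r | ⟨u, j⟩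
  · exact update_of_ne (by simp) ..
  · exact update_of_ne (by simp) ..
  · by_cases h : j = k
    · subst h
      exact (update_self ..).trans (update_self (f := T) ..).symm
    · exact (update_of_ne (by simpa using h) ..).trans (update_of_ne (f := T) h ..).symm

/-- Popping from one stack and pushing to another reverses the word. The callers therefore pair this
transfer, and likewise `does_drain`, with a `move`, which restores the order. -/
theorem does_feed (k : K) (φ : Γ k ≃ Bool) (l : List Bool) :
    ∀ T : ∀ k, List (Γ k), Does
      (Frag.popLoop (Γ := Alph (ProgAlph fun _ : Unit => Γ)) (some (.inl false)) (fun b : Bool => b)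
        (fun o => o.elim (Frag.stmt _ .halt) fun b =>
          Frag.stmt _ (.push (some (.inr ⟨(), k⟩)) (fun _ => φ.symm b) .halt)) Option.isSome)
      (2 * l.length + 3) (fullStacks Γ (regs [] l []) T)
      (fullStacks Γ (regs [] [] []) (update T k (l.reverse.map φ.symm ++ T k))) := by
  induction l with
  | nil =>
    intro T
    refine Does.popLoop_exit (t := 1) ⟨1, le_rfl, reach_label_succ.2 ?_⟩ rfl
    simp only [List.reverse_nil, List.map_nil, List.nil_append, update_eq_self]
    exact congrArg (fun S => some (⟨none, (), S⟩ : Cfg _ Unit Unit))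
      (update_fullStacks_false [] [] [] [] T)
  | cons b l ih =>
    intro T
    have h2 := ih (update T k (φ.symm b :: T k))
    refine Does.mono (Does.popLoop_again (t := 1)
      (S₁ := fullStacks Γ (regs [] l []) (update T k (φ.symm b :: T k)))
      ⟨1, le_rfl, reach_label_succ.2 ?_⟩ rfl ?_) (t := 1 + (2 * l.length + 3) + 1)
        (by simp; omega)
    · have h3 := update_fullStacks_false [] (b :: l) [] l T
      have h4 := update_fullStacks_inr (regs [] l []) T k (φ.symm b :: T k)
      rw [← h4, ← h3]
      rfl
    · simpa using h2

theorem does_drain (k : K) (φ : Γ k ≃ Bool) (l : List Bool) :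
    ∀ (x : List Bool) (T : ∀ k, List (Γ k)), T k = l.map φ.symm → Does
      (Frag.popLoop (Γ := Alph (ProgAlph fun _ : Unit => Γ)) (some (.inr ⟨(), k⟩)) φ
        (fun o => o.elim (Frag.stmt _ .halt) fun b =>
          Frag.stmt _ (.push (some (.inl false)) (fun _ => b) .halt)) Option.isSome)
      (2 * l.length + 3) (fullStacks Γ (regs [] x []) T)
      (fullStacks Γ (regs [] (l.reverse ++ x) []) (update T k [])) := by
  induction l with
  | nil =>
    intro x T hT
    have h0 : (fullStacks Γ (regs [] x []) T) (some (.inr ⟨(), k⟩)) = [] := hT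
    refine Does.popLoop_exit (t := 1) ?_ ?_
    · rw [h0]
      refine ⟨1, le_rfl, reach_label_succ.2 ?_⟩
      exact congrArg (fun S => some (⟨none, (), S⟩ : Cfg _ Unit Unit))
        (update_fullStacks_inr (regs [] x []) T k [])
    · rw [h0]; rfl
  | cons b l ih =>
    intro x T hT
    have h0 : (fullStacks Γ (regs [] x []) T) (some (.inr ⟨(), k⟩)) =
      φ.symm b :: l.map φ.symm := hT
    have h2 := ih (b :: x) (update T k (l.map φ.symm)) (update_self ..)
    refine Does.mono (Does.popLoop_again (t := 1)
      (S₁ := fullStacks Γ (regs [] (b :: x) []) (update T k (l.map φ.symm))) ?_ ?_ ?_)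
        (t := 1 + (2 * l.length + 3) + 1) (by simp; omega)
    · rw [h0]
      have hb : Option.map (⇑φ) (some (φ.symm b)) = some b := by simp
      change Does (Option.elim (Option.map (⇑φ) (some (φ.symm b))) _ _) _ _ _
      rw [hb]
      refine ⟨1, le_rfl, reach_label_succ.2 ?_⟩
      have h3 := update_fullStacks_inr (regs [] x []) T k (l.map φ.symm)
      have h4 := update_fullStacks_false [] x [] (b :: x) (update T k (l.map φ.symm))
      rw [← h4, ← h3]
      rfl
    · rw [h0]; rfl
    · simpa using h2

end Full

/-- A given machine has its own input and output stacks, whose alphabets are only in bijection with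
`Bool`. It is wrapped: the word is moved to the input stack, the machine runs on private stacks, and
the result is moved back. -/
theorem Trans.of_polyTime (h : TM2ComputableInPolyTime ea eb f) :
    Trans ea (fun a => eb (f a)) := by
  obtain ⟨⟨M, φ₀, φ₁⟩, p, hp⟩ := h
  let _ := M.kDecidableEq
  let _ := M.kFin
  let _ := M.ΛFin
  let _ := M.σFin
  let F : Frag M.Γ := ⟨M.Λ, M.σ, M.main, M.initialState, M.m⟩
  have hF : ∀ a, Does F (p.eval (ea a).length)
      (update (fun _ => []) M.k₀ ((ea a).map φ₀.symm))
      (update (fun _ => []) M.k₁ ((eb (f a)).map φ₁.symm)) := by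
    intro a
    obtain ⟨⟨n, h1⟩, h2⟩ := hp a
    refine ⟨n, h2, ?_⟩
    refine Eq.trans ?_ (h1.trans ?_)
    · congr 2
      rw [initList]
      congr 1
      funext k
      by_cases hk : k = M.k₀
      · subst hk; simp
      · simp [hk]
    · simp only [Option.map_some]
      rw [haltList]
      congr 2
      funext k
      by_cases hk : k = M.k₁
      · subst hk; simp
      · simp [hk]
  -- Moving the result back takes time linear in its length, so that length has to be polynomial in
  -- the input.
  have hq : ∃ q : Polynomial ℕ, ∀ a, (eb (f a)).length ≤ q.eval (ea a).length := by
    let c := Finset.univ.sup fun l => pushes (F.m l)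
    refine ⟨Polynomial.X + p * Polynomial.C c, fun a => ?_⟩
    obtain ⟨n, hn, hr⟩ := hF a
    have := length_reach_le c (fun l => Finset.le_sup (f := fun l => pushes (F.m l))
      (Finset.mem_univ l)) M.k₁ n hr
    simp only [update_self, List.length_map] at this
    simp only [Polynomial.eval_add, Polynomial.eval_X, Polynomial.eval_mul, Polynomial.eval_C]
    refine this.trans (Nat.add_le_add ?_ (Nat.mul_le_mul_right _ hn))
    -- If the two stacks coincide, the output stack starts with the input on it; otherwise it starts
    -- empty.
    by_cases h : M.k₁ = M.k₀
    · rw [h]; simp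
    · rw [update_of_ne h]; simp
  obtain ⟨q, hq⟩ := hq
  let Q : Frag (Alph (ProgAlph fun _ : Unit => M.Γ)) :=
    (move none (some false)).seq ((Frag.popLoop (some (.inl false)) (fun b : Bool => b)
        (fun o => o.elim (Frag.stmt _ .halt) fun b =>
          Frag.stmt _ (.push (some (.inr ⟨(), M.k₀⟩)) (fun _ => φ₀.symm b) .halt))
          Option.isSome).seq
    ((F.lift (fun k => some (.inr ⟨(), k⟩)) (fun _ => Equiv.refl _)).seq
    ((Frag.popLoop (some (.inr ⟨(), M.k₁⟩)) φ₁
        (fun o => o.elim (Frag.stmt _ .halt) fun b =>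
          Frag.stmt _ (.push (some (.inl false)) (fun _ => b) .halt)) Option.isSome).seq
    (move (some false) none))))
  refine Comp.of_run Q (4 * Polynomial.X + p + 4 * q + 24) ?_
  rintro _ _ ⟨a, rfl, rfl⟩
  have e1 : ∀ x y z, fullStacks M.Γ (regs x y z) (fun _ => []) =
      regStacks (fun _ : Unit => M.Γ) (regs x y z) := by
    intro x y z
    funext k
    rcases k with _ | (_ | _) | ⟨_, k⟩ <;> rfl
  have s1 := run_move (Γi := fun _ : Unit => M.Γ) (r := none) (r' := some false) (by simp)
    (ea a) (regs (ea a) [] []) rfl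
  simp only [update_regs_none, update_regs_false] at s1
  have s2 := does_feed M.k₀ φ₀ (ea a).reverse (fun _ => [])
  have s3 := (hF a).lift (Γ' := Alph (ProgAlph fun _ : Unit => M.Γ))
    (e := fun k => some (.inr ⟨(), k⟩)) (by intro a b h; simpa using h)
    (ε := fun _ => Equiv.refl _)
    (S' := fullStacks M.Γ (regs [] [] []) (update (fun _ => []) M.k₀ ((ea a).map φ₀.symm)))
    (T' := fullStacks M.Γ (regs [] [] []) (update (fun _ => []) M.k₁ ((eb (f a)).map φ₁.symm)))
    (fun k => (List.map_id _).symm) (fun k => (List.map_id _).symm) (by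
      intro k hk
      rcases k with _ | k | ⟨u, k⟩
      · rfl
      · rfl
      · exact absurd rfl (hk k))
  have s4 := does_drain M.k₁ φ₁ (eb (f a)) [] (update (fun _ => []) M.k₁ ((eb (f a)).map φ₁.symm))
    (update_self ..)
  have s5 := run_move (Γi := fun _ : Unit => M.Γ) (r := some false) (r' := none) (by simp)
    (eb (f a)).reverse (regs [] (eb (f a)).reverse []) rfl
  simp only [update_regs_none, update_regs_false] at s5
  simp only [List.reverse_reverse, List.append_nil, update_idem, List.length_reverse] at s2 s4 s5
  have e2 : update (fun k => ([] : List (M.Γ k))) M.k₁ [] = fun _ => [] := update_eq_self ..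
  rw [e2, e1] at s4
  have s1' := s1
  unfold Run at s1'
  simp only [← e1] at s1'
  simp only [regs, List.append_nil] at s1'
  have := s1'.seq (s2.seq (s3.seq (s4.seq s5)))
  simp only [regs, List.append_nil] at this
  rw [e1] at this
  refine Does.mono this ?_
  have := hq a
  simp only [Polynomial.eval_add, Polynomial.eval_mul, Polynomial.eval_X, Polynomial.eval_ofNat]
  omega

end PolyTime

end StackMachine
end

/-! ### Closure properties of polynomial-time translations. -/

noncomputable section

namespace StackMachine

open Turing Turing.TM2 Function

/-- Every bit is preceded by `true`. -/
def flagged (u : List Bool) : List Bool := u.flatMap fun b => [true, b]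

@[simp] theorem flagged_nil : flagged [] = [] := rfl

@[simp] theorem flagged_cons (b : Bool) (u : List Bool) :
    flagged (b :: u) = true :: b :: flagged u := rfl

@[simp] theorem flagged_append (u v : List Bool) : flagged (u ++ v) = flagged u ++ flagged v :=
  List.flatMap_append ..

/-- A pair of words. -/
def pw (u v : List Bool) : List Bool := flagged u ++ false :: v

@[simp] theorem pw_nil (v : List Bool) : pw [] v = false :: v := rfl

@[simp] theorem pw_cons (b : Bool) (u v : List Bool) : pw (b :: u) v = true :: b :: pw u v := rfl

@[simp] theorem length_pw (u v : List Bool) : (pw u v).length = 2 * u.length + v.length + 1 := by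
  induction u with
  | nil => simp
  | cons b u ih => simp only [pw_cons, List.length_cons, ih]; omega

theorem Comp.family {I : Type} {R : I → List Bool → List Bool → Prop} (h : ∀ i, Comp (R i)) :
    ∃ (Ki : I → Type) (_ : ∀ i, DecidableEq (Ki i)) (_ : ∀ i, Fintype (Ki i))
      (Γi : ∀ i, Ki i → Type) (F : ∀ i, Frag (Alph (Γi i))) (p : I → Polynomial ℕ),
      ∀ i w w', R i w w' → Does (F i) ((p i).eval w.length) (only w) (only w') := by
  choose Ki d f Γi F p hp using h
  exact ⟨Ki, d, f, Γi, F, p, hp⟩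

section Programs

variable {I : Type} [DecidableEq I] {Ki : I → Type} [∀ i, DecidableEq (Ki i)]
  {Γi : ∀ i, Ki i → Type}

/-- Empty a register. -/
def clear (r : Option Bool) : Frag (Alph (ProgAlph Γi)) := forBits r fun _ => skip

theorem run_clear (r : Option Bool) (l : List Bool) : ∀ s : Option Bool → List Bool, s r = l →
    Run (clear (Γi := Γi) r) (2 * l.length + 3) s (update s r []) := by
  induction l with
  | nil =>
    intro s hs
    rw [← hs, update_eq_self, hs]
    exact Run.forBits_nil hs
  | cons b l ih =>
    intro s hs
    have h2 := ih (update s r l) (update_self ..)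
    rw [update_idem] at h2
    have h3 : Run (clear (Γi := Γi) r) _ _ _ := Run.forBits_cons hs (run_skip _) h2
    exact h3.mono (by simp; omega)

/-- Move the main register to both auxiliary registers. -/
def spread : Frag (Alph (ProgAlph Γi)) :=
  forBits none fun b => (push (some false) b).seq (push (some true) b)

theorem run_spread (l : List Bool) : ∀ b c, Run (spread (Γi := Γi)) (6 * l.length + 3)
    (regs l b c) (regs [] (l.reverse ++ b) (l.reverse ++ c)) := by
  induction l with
  | nil => intro b c; exact Run.forBits_nil rfl
  | cons x l ih =>
    intro b c
    have h1 := run_push (Γi := Γi) (some false) x (regs l b c)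
    have h2 := run_push (Γi := Γi) (some true) x (regs l (x :: b) c)
    simp only [update_regs_false, update_regs_true, regs] at h1 h2
    have h3 : Run (spread (Γi := Γi)) _ (regs (x :: l) b c) _ :=
      Run.forBits_cons rfl (by simpa using h1.seq h2) (ih (x :: b) (x :: c))
    exact Run.mono (by simpa using h3) (by simp; omega)

/-- Put the bits of the second auxiliary register, each with a flag, on the first one. -/
def putFlagged : Frag (Alph (ProgAlph Γi)) :=
  forBits (some true) fun b => (push (some false) b).seq (push (some false) true)

theorem run_putFlagged (l : List Bool) : ∀ a b, Run (putFlagged (Γi := Γi)) (6 * l.length + 3)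
    (regs a b l) (regs a (flagged l.reverse ++ b) []) := by
  induction l with
  | nil => intro a b; exact Run.forBits_nil rfl
  | cons x l ih =>
    intro a b
    have h1 := run_push (Γi := Γi) (some false) x (regs a b l)
    have h2 := run_push (Γi := Γi) (some false) true (regs a (x :: b) l)
    simp only [update_regs_false, regs] at h1 h2
    have h3 : Run (putFlagged (Γi := Γi)) _ (regs a b (x :: l)) _ :=
      Run.forBits_cons rfl (by simpa using h1.seq h2) (ih a (true :: x :: b))
    exact Run.mono (by simpa using h3) (by simp; omega)

/-- Split the pair in the main register. -/
def unpack : Frag (Alph (ProgAlph Γi)) :=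
  loop none (fun o => if o = some true then
    loop none (fun o => o.elim skip (push (some false))) (fun _ => false) else skip)
    (fun o => o == some true)

theorem run_unpack (u v : List Bool) : ∀ b c, Run (unpack (Γi := Γi)) (4 * u.length + 3)
    (regs (pw u v) b c) (regs v (u.reverse ++ b) c) := by
  induction u with
  | nil =>
    intro b c
    refine Run.loop_exit (t := 1) ?_ rfl
    have := run_skip (Γi := Γi) (regs v b c)
    simpa [regs] using this
  | cons x u ih =>
    intro b c
    have h1 : Run (loop (Γi := Γi) none (fun o => o.elim skip (push (some false)))
        (fun _ => false)) (1 + 2) (regs (x :: pw u v) b c) (regs (pw u v) (x :: b) c) := by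
      refine Run.loop_exit ?_ rfl
      have := run_push (Γi := Γi) (some false) x (regs (pw u v) b c)
      simpa [regs] using this
    have h3 : Run (unpack (Γi := Γi)) _ (regs (pw (x :: u) v) b c) _ :=
      Run.loop_again (by simpa [regs] using h1) rfl (ih (x :: b) c)
    exact Run.mono (by simpa using h3) (by simp; omega)

end Programs

variable {α : Type} {e e₁ e₂ e₃ u v out : α → List Bool}

theorem Trans.length_le (h : Trans e e₁) :
    ∃ q : Polynomial ℕ, ∀ a, (e₁ a).length ≤ q.eval (e a).length := by
  obtain ⟨q, hq⟩ := Comp.length_le h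
  exact ⟨q, fun a => hq _ _ ⟨a, rfl, rfl⟩⟩

theorem Trans.reindex {β : Type} (h : Trans e e₁) (φ : β → α) :
    Trans (fun b => e (φ b)) (fun b => e₁ (φ b)) :=
  Comp.mono h (by rintro _ _ ⟨b, rfl, rfl⟩; exact ⟨φ b, rfl, rfl⟩)

/-- The two machines run one after the other on the main register; the time of the second is its
polynomial composed with the length bound for the intermediate word. -/
theorem Trans.comp (h : Trans e e₁) (h' : Trans e₁ e₂) : Trans e e₂ := by
  obtain ⟨q, hq⟩ := h.length_le
  have h2 : ∀ b : Bool, Comp (fun w w' => ∃ a, w = (cond b e₁ e) a ∧ w' = (cond b e₂ e₁) a) := by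
    rintro (_ | _)
    · exact h
    · exact h'
  obtain ⟨Ki, _, _, Γi, F, p, hp⟩ := Comp.family h2
  refine Comp.of_run ((call F false none).seq (call F true none))
    (p false + (p true).comp q + 3) ?_
  rintro _ _ ⟨a, rfl, rfl⟩
  have c1 := run_call (s := regs (e a) [] []) (r := none) (hp false (e a) (e₁ a) ⟨a, rfl, rfl⟩)
  have c2 := run_call (s := regs (e₁ a) [] []) (r := none) (hp true (e₁ a) (e₂ a) ⟨a, rfl, rfl⟩)
  rw [update_regs_none] at c1 c2
  refine (c1.seq c2).mono ?_
  have := eval_mono (p true) (hq a)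
  simp only [Polynomial.eval_add, Polynomial.eval_comp, Polynomial.eval_ofNat]
  omega

/-- The input is duplicated first, so that each machine can consume its own copy; the remaining
moves interleave the flags. -/
theorem Trans.pair (h : Trans e e₁) (h' : Trans e e₂) :
    Trans e (fun a => pw (e₁ a) (e₂ a)) := by
  obtain ⟨q₁, hq₁⟩ := h.length_le
  obtain ⟨q₂, hq₂⟩ := h'.length_le
  have h2 : ∀ b : Bool, Comp (fun w w' => ∃ a, w = e a ∧ w' = (cond b e₂ e₁) a) := by
    rintro (_ | _)
    · exact h
    · exact h'
  obtain ⟨Ki, _, _, Γi, F, p, hp⟩ := Comp.family h2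
  refine Comp.of_run (spread.seq ((move (some false) none).seq ((move (some true) (some false)).seq
    ((call F false none).seq ((call F true (some false)).seq ((move none (some true)).seq
    ((push (some false) false).seq (putFlagged.seq ((move (some false) (some true)).seq
    (move (some true) none))))))))))
    (10 * Polynomial.X + p false + p true + 16 * q₁ + 4 * q₂ + 100) ?_
  rintro _ _ ⟨a, rfl, rfl⟩
  have s1 := run_spread (Γi := Γi) (e a) [] []
  have s2 := run_move (Γi := Γi) (r := some false) (r' := none) (by simp) (e a).reverse
    (regs [] (e a).reverse (e a).reverse) rfl
  have s3 := run_move (Γi := Γi) (r := some true) (r' := some false) (by simp) (e a).reverse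
    (regs (e a) [] (e a).reverse) rfl
  have s4 := run_call (s := regs (e a) (e a) []) (r := none) (hp false (e a) (e₁ a) ⟨a, rfl, rfl⟩)
  have s5 := run_call (s := regs (e₁ a) (e a) []) (r := some false)
    (hp true (e a) (e₂ a) ⟨a, rfl, rfl⟩)
  have s6 := run_move (Γi := Γi) (r := none) (r' := some true) (by simp) (e₁ a)
    (regs (e₁ a) (e₂ a) []) rfl
  have s7 := run_push (Γi := Γi) (some false) false (regs [] (e₂ a) (e₁ a).reverse)
  have s8 := run_putFlagged (Γi := Γi) (e₁ a).reverse [] (false :: e₂ a)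
  have s9 := run_move (Γi := Γi) (r := some false) (r' := some true) (by simp)
    (pw (e₁ a) (e₂ a)) (regs [] (pw (e₁ a) (e₂ a)) []) rfl
  have s10 := run_move (Γi := Γi) (r := some true) (r' := none) (by simp)
    (pw (e₁ a) (e₂ a)).reverse (regs [] [] (pw (e₁ a) (e₂ a)).reverse) rfl
  simp only [update_regs_none, update_regs_false, update_regs_true, regs, List.append_nil,
    List.reverse_reverse, List.length_reverse, length_pw] at s1 s2 s3 s4 s5 s6 s7 s8 s9 s10
  refine (s1.seq (s2.seq (s3.seq (s4.seq (s5.seq (s6.seq (s7.seq (s8.seq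
    (s9.seq s10))))))))).mono ?_
  have h1 := hq₁ a
  have h2 := hq₂ a
  simp only [Polynomial.eval_add, Polynomial.eval_mul, Polynomial.eval_X, Polynomial.eval_ofNat]
  omega

theorem Trans.fst : Trans (fun a => pw (u a) (v a)) u := by
  refine Comp.of_run (Γi := fun (i : Empty) (k : Empty) => Empty)
    (unpack.seq ((clear none).seq (move (some false) none))) (8 * Polynomial.X + 15) ?_
  rintro _ _ ⟨a, rfl, rfl⟩
  have s1 := run_unpack (Γi := fun (i : Empty) (k : Empty) => Empty) (u a) (v a) [] []
  have s2 := run_clear (Γi := fun (i : Empty) (k : Empty) => Empty) none (v a)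
    (regs (v a) (u a).reverse []) rfl
  have s3 := run_move (Γi := fun (i : Empty) (k : Empty) => Empty) (r := some false) (r' := none)
    (by simp) (u a).reverse (regs [] (u a).reverse []) rfl
  simp only [update_regs_none, update_regs_false, regs, List.append_nil,
    List.reverse_reverse, List.length_reverse] at s1 s2 s3
  refine (s1.seq (s2.seq s3)).mono ?_
  simp only [Polynomial.eval_add, Polynomial.eval_mul, Polynomial.eval_X, Polynomial.eval_ofNat,
    length_pw]
  omega

theorem Trans.snd : Trans (fun a => pw (u a) (v a)) v := by
  refine Comp.of_run (Γi := fun (i : Empty) (k : Empty) => Empty)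
    (unpack.seq (clear (some false))) (8 * Polynomial.X + 15) ?_
  rintro _ _ ⟨a, rfl, rfl⟩
  have s1 := run_unpack (Γi := fun (i : Empty) (k : Empty) => Empty) (u a) (v a) [] []
  have s2 := run_clear (Γi := fun (i : Empty) (k : Empty) => Empty) (some false) (u a).reverse
    (regs (v a) (u a).reverse []) rfl
  simp only [update_regs_false, List.append_nil, List.length_reverse] at s1 s2
  refine (s1.seq s2).mono ?_
  simp only [Polynomial.eval_add, Polynomial.eval_mul, Polynomial.eval_X, Polynomial.eval_ofNat,
    length_pw]
  omega

theorem Trans.refl : Trans e e := by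
  refine Comp.of_run (Γi := fun (i : Empty) (k : Empty) => Empty) skip 1 ?_
  rintro _ _ ⟨a, rfl, rfl⟩
  simpa using run_skip _

theorem Trans.of_eq (h : ∀ a, e₁ a = e₂ a) (h' : Trans e e₁) : Trans e e₂ := by
  have : e₁ = e₂ := funext h
  rwa [← this]

theorem Trans.cons (b : Bool) : Trans e (fun a => b :: e a) := by
  refine Comp.of_run (Γi := fun (i : Empty) (k : Empty) => Empty) (push none b) 1 ?_
  rintro _ _ ⟨a, rfl, rfl⟩
  simpa [regs] using run_push (Γi := fun (i : Empty) (k : Empty) => Empty) none b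
    (regs (e a) [] [])

theorem Trans.tail : Trans e (fun a => (e a).tail) := by
  refine Comp.of_run (Γi := fun (i : Empty) (k : Empty) => Empty)
    (loop none (fun _ => skip) (fun _ => false)) 3 ?_
  rintro _ _ ⟨a, rfl, rfl⟩
  have : Run (loop (Γi := fun (i : Empty) (k : Empty) => Empty) none (fun _ => skip)
    (fun _ => false)) (1 + 2) (regs (e a) [] []) (regs (e a).tail [] []) := by
    refine Run.loop_exit ?_ rfl
    simpa [regs] using run_skip (Γi := fun (i : Empty) (k : Empty) => Empty)
      (regs (e a).tail [] [])
  simpa using this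

theorem Trans.const (w : List Bool) : Trans e (fun _ => w) := by
  induction w with
  | nil =>
    refine Comp.of_run (Γi := fun (i : Empty) (k : Empty) => Empty) (clear none)
      (2 * Polynomial.X + 3) ?_
    rintro _ _ ⟨a, rfl, rfl⟩
    simpa using run_clear (Γi := fun (i : Empty) (k : Empty) => Empty) none (e a)
      (regs (e a) [] []) rfl
  | cons b w ih => exact ih.comp (Trans.cons b)

/-- The flag in front of the pair tells whether `u a` is empty, and the next symbol is then its
first bit. Each branch only has to be correct on the inputs that reach it, hence the subtypes. -/
theorem Trans.cases (h : ∀ o : Option Bool, Trans (fun a : {a // (u a).head? = o} => v a)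
    (fun a : {a // (u a).head? = o} => out a)) : Trans (fun a => pw (u a) (v a)) out := by
  obtain ⟨Ki, _, _, Γi, F, p, hp⟩ := Comp.family h
  refine Comp.of_run (loop none (fun o => if o = some true then
    loop none (fun o => unpack.seq ((clear (some false)).seq (call F o none))) (fun _ => false)
    else call F none none) (fun _ => false))
    (p none + p (some false) + p (some true) + 6 * Polynomial.X + 40) ?_
  rintro _ _ ⟨a, rfl, rfl⟩
  rcases hu : u a with _ | ⟨b, l⟩ <;> simp only [hu]
  · have s1 := run_call (s := regs (v a) [] []) (r := none)
      (hp none (v a) (out a) ⟨⟨a, by simp [hu]⟩, rfl, rfl⟩)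
    simp only [update_regs_none] at s1
    refine (Run.loop_exit (t := (p none).eval (v a).length) ?_ rfl).mono ?_
    · simpa [regs] using s1
    · have := eval_mono (p none) (m := (v a).length) (n := (pw [] (v a)).length) (by simp)
      simp only [Polynomial.eval_add, Polynomial.eval_mul, Polynomial.eval_X,
        Polynomial.eval_ofNat]
      omega
  · have s1 := run_unpack (Γi := Γi) l (v a) [] []
    have s2 := run_clear (Γi := Γi) (some false) l.reverse (regs (v a) l.reverse []) rfl
    have s3 := run_call (s := regs (v a) [] []) (r := none)
      (hp (some b) (v a) (out a) ⟨⟨a, by simp [hu]⟩, rfl, rfl⟩)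
    simp only [update_regs_none, update_regs_false, List.append_nil,
      List.length_reverse] at s1 s2 s3
    have s4 := s1.seq (s2.seq s3)
    have s5 : Run (loop none (fun o => unpack.seq ((clear (some false)).seq (call F o none)))
        (fun _ => false)) _ (regs (b :: pw l (v a)) [] []) (regs (out a) [] []) :=
      Run.loop_exit (by simpa [regs] using s4) rfl
    refine (Run.loop_exit (by simpa [regs] using s5) rfl).mono ?_
    have := eval_mono (p (some b)) (m := (v a).length) (n := (pw (b :: l) (v a)).length)
      (by simp; omega)
    have hb : (p (some b)).eval (pw (b :: l) (v a)).length ≤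
        (p (some false)).eval (pw (b :: l) (v a)).length +
        (p (some true)).eval (pw (b :: l) (v a)).length := by cases b <;> simp
    have hl := length_pw (b :: l) (v a)
    simp only [List.length_cons] at hl
    simp only [Polynomial.eval_add, Polynomial.eval_mul, Polynomial.eval_X,
      Polynomial.eval_ofNat]
    omega

/-- Iterating a polynomial-time step may produce exponentially long words; the bound `hq` on all
intermediate states excludes this. The states are indexed by the position reached, so the step need
only be right on states that occur. -/
theorem Trans.fold {s : α → ℕ → List Bool}
    (h : Trans (fun p : Σ a, Fin (u a).length => pw [(u p.1)[p.2]] (s p.1 p.2))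
      (fun p => s p.1 (p.2 + 1)))
    (q : Polynomial ℕ)
    (hq : ∀ a, ∀ k ≤ (u a).length, (s a k).length ≤ q.eval (pw (u a) (s a 0)).length) :
    Trans (fun a => pw (u a) (s a 0)) (fun a => s a (u a).length) := by
  obtain ⟨Ki, _, _, Γi, F, p, hp⟩ := Comp.family (fun _ : Unit => h)
  let body (b : Bool) : Frag (Alph (ProgAlph Γi)) :=
    (push none false).seq ((push none b).seq ((push none true).seq (call F () none)))
  refine Comp.of_run (unpack.seq ((move (some false) (some true)).seq (forBits (some true) body)))
    (20 * Polynomial.X + Polynomial.X * (p ()).comp (q + 3) + 20) ?_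
  rintro _ _ ⟨a, rfl, rfl⟩
  have s1 := run_unpack (Γi := Γi) (u a) (s a 0) [] []
  have s2 := run_move (Γi := Γi) (r := some false) (r' := some true) (by simp) (u a).reverse
    (regs (s a 0) (u a).reverse []) rfl
  simp only [update_regs_false, update_regs_true, regs, List.append_nil,
    List.reverse_reverse, List.length_reverse] at s1 s2
  set T := (p ()).eval (q.eval (pw (u a) (s a 0)).length + 3) with hT
  -- One round costs at most `T` for the call and 13 for three pushes, the sequencing and the loop.
  -- The 3 inside `T` is the overhead of pairing the state with a single bit.
  have s3 : ∀ n k, n + k = (u a).length → Run (forBits (some true) body) (n * (T + 13) + 3)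
      (regs (s a k) [] ((u a).drop k)) (regs (s a (u a).length) [] []) := by
    intro n
    induction n with
    | zero =>
      intro k hk
      have : k = (u a).length := by omega
      subst this
      rw [List.drop_length, Nat.zero_mul, Nat.zero_add]
      exact Run.forBits_nil rfl
    | succ n ih =>
      intro k hk
      have hk' : k < (u a).length := by omega
      rw [List.drop_eq_getElem_cons hk']
      have t1 := run_push (Γi := Γi) none false (regs (s a k) [] ((u a).drop (k + 1)))
      have t2 := run_push (Γi := Γi) none (u a)[k]
        (regs (false :: s a k) [] ((u a).drop (k + 1)))
      have t3 := run_push (Γi := Γi) none true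
        (regs ((u a)[k] :: false :: s a k) [] ((u a).drop (k + 1)))
      have t4 := run_call (s := regs (true :: (u a)[k] :: false :: s a k) []
        ((u a).drop (k + 1))) (r := none) (hp () _ (s a (k + 1)) ⟨⟨a, ⟨k, hk'⟩⟩, rfl, rfl⟩)
      simp only [update_regs_none, regs] at t1 t2 t3 t4
      have t5 : Run (body (u a)[k]) _ _ _ := t1.seq (t2.seq (t3.seq t4))
      have t6 := ih (k + 1) (by omega)
      have t7 : Run (forBits (some true) body) _
          (regs (s a k) [] ((u a)[k] :: (u a).drop (k + 1))) _ :=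
        Run.forBits_cons rfl (by simpa using t5) t6
      refine t7.mono ?_
      have hle : (p ()).eval (pw [(u a)[k]] (s a k)).length ≤ T := by
        refine eval_mono _ ?_
        have := hq a k hk'.le
        rw [length_pw, List.length_singleton]
        omega
      simp only [pw_cons, pw_nil, List.length_cons] at hle
      rw [Nat.add_mul n 1]
      omega
  have s4 := s3 (u a).length 0 rfl
  rw [List.drop_zero] at s4
  refine (s1.seq (s2.seq s4)).mono ?_
  have hl := length_pw (u a) (s a 0)
  have h1 : (u a).length * (T + 13) ≤ (pw (u a) (s a 0)).length * T + 13 * (u a).length := by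
    rw [Nat.mul_add]
    have := Nat.mul_le_mul_right T (show (u a).length ≤ (pw (u a) (s a 0)).length by omega)
    omega
  simp only [Polynomial.eval_add, Polynomial.eval_mul, Polynomial.eval_X,
    Polynomial.eval_ofNat, Polynomial.eval_comp]
  rw [← hT]
  omega

end StackMachine
end

/-! ### Codes of data types and polynomial-time functions between them. -/

noncomputable section

namespace StackMachine

open Function Polynomial

/-- Types whose elements are coded as words. -/
class Code (α : Type) where
  enc : α → List Bool

open Code

/-- Bit strings, coded as they are. -/
def Word : Type := List Bool

instance : Code Word := ⟨fun w => w⟩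
instance : Code Bool := ⟨fun b => [b]⟩
instance : Code ℕ := ⟨fun n => List.replicate n true⟩

section

variable {α β γ δ σ : Type} [Code α] [Code β] [Code γ] [Code δ] [Code σ]

instance : Code (α × β) := ⟨fun p => pw (enc p.1) (enc p.2)⟩

/-- The code of a list. -/
def encList : List α → List Bool
  | [] => []
  | a :: l => pw (enc a) (encList l)

instance : Code (List α) := ⟨encList⟩

/-- The length of the code. -/
def size (a : α) : ℕ := (enc a).length

@[simp] theorem size_nat (n : ℕ) : size n = n := List.length_replicate ..
@[simp] theorem size_bool (b : Bool) : size b = 1 := rfl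
@[simp] theorem size_prod (p : α × β) : size p = 2 * size p.1 + size p.2 + 1 := length_pw ..
@[simp] theorem size_nil : size ([] : List α) = 0 := rfl
@[simp] theorem size_cons (a : α) (l : List α) : size (a :: l) = 2 * size a + size l + 1 :=
  length_pw ..

@[simp] theorem size_append (l l' : List α) : size (l ++ l') = size l + size l' := by
  induction l with
  | nil => simp
  | cons a l ih => simp [ih]; omega

@[simp] theorem size_reverse (l : List α) : size l.reverse = size l := by
  induction l with
  | nil => simp
  | cons a l ih => simp [ih]; omega

theorem length_le_size (l : List α) : l.length ≤ size l := by
  induction l with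
  | nil => simp
  | cons a l ih => simp; omega

theorem size_le_of_mem {a : α} {l : List α} (h : a ∈ l) : size a ≤ size l := by
  induction l with
  | nil => simp at h
  | cons b l ih =>
    rcases List.mem_cons.1 h with rfl | h
    · simp; omega
    · have := ih h; simp; omega

theorem size_le_of_prefix {l l' : List α} (h : l' <+: l) : size l' ≤ size l := by
  obtain ⟨t, rfl⟩ := h
  simp

theorem size_flatMap_le (l : List α) (f : α → List β) (B : ℕ) (h : ∀ a ∈ l, size (f a) ≤ B) :
    size (l.flatMap f) ≤ size l * B := by
  induction l with
  | nil => simp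
  | cons a l ih =>
    have h1 := h a (by simp)
    have h2 := ih fun b hb => h b (by simp [hb])
    simp only [List.flatMap_cons, size_append, size_cons, Nat.add_mul]
    omega

/-- Functions computable in polynomial time. -/
@[fun_prop] def PT (f : α → β) : Prop := Trans (fun a => enc a) (fun a => enc (f a))

theorem PT.size_le {f : α → β} (h : PT f) : ∃ q : Polynomial ℕ, ∀ a, size (f a) ≤ q.eval (size a) :=
  Trans.length_le h

@[fun_prop] theorem PT.id : PT (fun a : α => a) := Trans.refl

@[fun_prop] theorem PT.const (b : β) : PT (fun _ : α => b) := Trans.const _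

@[fun_prop] theorem PT.comp {g : β → γ} {f : α → β} (hg : PT g) (hf : PT f) :
    PT (fun a => g (f a)) :=
  Trans.comp hf (Trans.reindex hg f)

@[fun_prop] theorem PT.prodMk {f : α → β} {g : α → γ} (hf : PT f) (hg : PT g) :
    PT (fun a => (f a, g a)) :=
  Trans.pair hf hg

theorem PT.fst' : PT (fun p : α × β => p.1) := Trans.fst
theorem PT.snd' : PT (fun p : α × β => p.2) := Trans.snd

@[fun_prop] theorem PT.fst {f : α → β × γ} (hf : PT f) : PT (fun a => (f a).1) := PT.fst'.comp hf
@[fun_prop] theorem PT.snd {f : α → β × γ} (hf : PT f) : PT (fun a => (f a).2) := PT.snd'.comp hf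

theorem PT.congr {f g : α → β} (hf : PT f) (h : ∀ a, g a = f a) : PT g := by
  rwa [funext h]

/-- Functions with the same codes of values. -/
theorem PT.recode {f : α → β} {g : α → γ} (hf : PT f) (h : ∀ a, enc (f a) = enc (g a)) : PT g :=
  Trans.of_eq h hf

@[fun_prop] theorem PT.ite {c : α → Bool} {f g : α → β} (hc : PT c) (hf : PT f) (hg : PT g) :
    PT (fun a => if c a = true then f a else g a) := by
  refine (Trans.pair hc PT.id).comp (Trans.cases fun o => ?_)
  rcases o with _ | _ | _
  · refine Trans.of_eq ?_ (Trans.const [])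
    rintro ⟨a, ha⟩
    cases ha
  · refine Trans.of_eq ?_ (Trans.reindex hg Subtype.val)
    rintro ⟨a, ha⟩
    have : c a = false := by simpa [enc] using ha
    simp [this]
  · refine Trans.of_eq ?_ (Trans.reindex hf Subtype.val)
    rintro ⟨a, ha⟩
    have : c a = true := by simpa [enc] using ha
    simp [this]

@[fun_prop] theorem PT.cons {f : α → β} {g : α → List β} (hf : PT f) (hg : PT g) :
    PT (fun a => f a :: g a) :=
  (hf.prodMk hg).recode fun _ => rfl

/-- The empty list is the only one with an empty code, so the case is visible from the first symbol.
In the other case the code of `b :: t` is literally the code of the pair `(b, t)`. -/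
theorem PT.listCases {l : α → List β} {f : α → γ} {g : α → β → List β → γ} (hl : PT l)
    (hf : PT f) (hg : PT (fun p : α × β × List β => g p.1 p.2.1 p.2.2)) :
    PT (fun a => match l a with | [] => f a | b :: t => g a b t) := by
  refine (Trans.pair hl (PT.id.prodMk hl)).comp (Trans.cases fun o => ?_)
  rcases o with _ | o
  · refine Trans.of_eq ?_ (Trans.comp Trans.fst (Trans.reindex hf Subtype.val))
    rintro ⟨a, ha⟩
    have : l a = [] := by
      rcases hla : l a with _ | ⟨b, t⟩
      · rfl
      · rw [hla] at ha
        simp only [enc, encList, pw, List.head?_eq_none_iff] at ha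
        simp at ha
    simp [this]
  · have key : ∀ a : {a // (enc (l a)).head? = some o}, ∃ p : β × List β,
        l a.1 = p.1 :: p.2 := by
      rintro ⟨a, ha⟩
      rcases hla : l a with _ | ⟨b, t⟩
      · rw [hla] at ha
        simp [enc, encList] at ha
      · exact ⟨(b, t), rfl⟩
    choose φ hφ using key
    have h1 := Trans.reindex hg fun a : {a // (enc (l a)).head? = some o} => (a.1, φ a)
    refine Trans.of_eq ?_ (Trans.comp (Trans.of_eq ?_ Trans.refl) h1)
    · intro a
      simp only [hφ a]
    · intro a
      simp only [hφ a]
      rfl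

/-- The argument `a` is carried along in the state, because the step may depend on it; it is dropped
at the end. -/
theorem PT.foldBits {d : α → β} {i : α → σ} {h : α → Bool → σ → σ} (hd : PT d) (hi : PT i)
    (hh : PT (fun p : α × Bool × σ => h p.1 p.2.1 p.2.2)) (q : Polynomial ℕ)
    (hq : ∀ a u, u <+: enc (d a) → size (u.foldl (fun s b => h a b s) (i a)) ≤ q.eval (size a)) :
    PT (fun a => (enc (d a)).foldl (fun s b => h a b s) (i a)) := by
  let s (a : α) (k : ℕ) : σ := ((enc (d a)).take k).foldl (fun s b => h a b s) (i a)
  have h1 : Trans (fun a => enc a) (fun a => pw (enc (d a)) (enc (a, s a 0))) :=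
    Trans.pair hd (PT.id.prodMk hi)
  have h2 : Trans (fun a => pw (enc (d a)) (enc (a, s a 0)))
      (fun a => enc (a, s a (enc (d a)).length)) := by
    refine Trans.fold (s := fun a k => enc (a, s a k)) ?_ (2 * X + q + 1) ?_
    · have h3 : PT (fun p : Bool × α × σ => (p.2.1, h p.2.1 p.1 p.2.2)) :=
        PT.prodMk (by fun_prop) (PT.comp hh (f := fun p : Bool × α × σ => (p.2.1, p.1, p.2.2))
          (by fun_prop))
      have h4 := Trans.reindex h3 fun p : Σ a, Fin (enc (d a)).length =>
        ((enc (d p.1))[p.2], p.1, s p.1 p.2)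
      refine Trans.of_eq ?_ h4
      rintro ⟨a, k⟩
      simp only [s]
      rw [← List.take_concat_get' _ _ k.2, List.foldl_append]
      rfl
    · intro a k hk
      have h5 := hq a _ (List.take_prefix k (enc (d a)))
      have h6 : (enc (a, s a 0)).length = 2 * size a + size (s a 0) + 1 := length_pw ..
      have h7 : (enc (a, s a k)).length = 2 * size a + size (s a k) + 1 := length_pw ..
      rw [h7]
      simp only [length_pw, h6, eval_add, eval_mul, eval_X, eval_ofNat, eval_one]
      have h8 := eval_mono q (m := size a)
        (n := 2 * (enc (d a)).length + (2 * size a + size (s a 0) + 1) + 1) (by omega)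
      have h9 : size (s a k) ≤ q.eval (size a) := h5
      omega
  have h10 := (h1.comp h2).comp (Trans.snd)
  refine Trans.of_eq ?_ h10
  intro a
  simp [s]

/-- Numbers are coded in unary, so a fold over the bits of `n a` that ignores their values is an
iteration. -/
theorem PT.iterate {n : α → ℕ} {i : α → σ} {h : α → σ → σ} (hn : PT n) (hi : PT i)
    (hh : PT (fun p : α × σ => h p.1 p.2)) (q : Polynomial ℕ)
    (hq : ∀ a, ∀ k ≤ n a, size ((h a)^[k] (i a)) ≤ q.eval (size a)) :
    PT (fun a => (h a)^[n a] (i a)) := by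
  have key : ∀ a k, (List.replicate k true).foldl (fun s b => h a s) (i a) = (h a)^[k] (i a) := by
    intro a k
    induction k with
    | zero => rfl
    | succ k ih => rw [List.replicate_succ', List.foldl_append, ih, iterate_succ_apply']; rfl
  refine (PT.foldBits (h := fun a _ s => h a s) hn hi (hh.comp
    (f := fun p : α × Bool × σ => (p.1, p.2.2)) (by fun_prop)) q ?_).congr fun a => (key a _).symm
  intro a u hu
  obtain ⟨k, hk, rfl⟩ : ∃ k ≤ n a, u = List.replicate k true := by
    refine ⟨u.length, by simpa [enc] using hu.length_le, List.eq_replicate_iff.2 ⟨rfl, ?_⟩⟩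
    intro b hb
    exact List.eq_of_mem_replicate (hu.subset hb)
  rw [key]
  exact hq a k hk

/-- The bits of the code of the list serve as a clock only. There are at least as many of them as
elements, and the step is idle once the list is used up, so too many ticks do no harm. -/
theorem PT.foldl {l : α → List β} {i : α → σ} {f : α → σ → β → σ} (hl : PT l) (hi : PT i)
    (hf : PT (fun p : α × σ × β => f p.1 p.2.1 p.2.2)) (q : Polynomial ℕ)
    (hq : ∀ a l', l' <+: l a → size (l'.foldl (f a) (i a)) ≤ q.eval (size a)) :
    PT (fun a => (l a).foldl (f a) (i a)) := by
  let step (a : α) (s : List β × σ) : List β × σ :=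
    match s.1 with
    | [] => ([], s.2)
    | b :: t => (t, f a s.2 b)
  have key : ∀ a k, (step a)^[k] (l a, i a) = ((l a).drop k, ((l a).take k).foldl (f a) (i a)) := by
    intro a k
    induction k with
    | zero => rfl
    | succ k ih =>
      rw [iterate_succ_apply', ih]
      by_cases hk : k < (l a).length
      · rw [List.drop_eq_getElem_cons hk, ← List.take_concat_get' _ _ hk, List.foldl_append]
        rfl
      · rw [List.drop_eq_nil_of_le (by omega), List.drop_eq_nil_of_le (by omega),
          List.take_of_length_le (by omega), List.take_of_length_le (by omega)]
  obtain ⟨ql, hql⟩ := hl.size_le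
  have hs : PT (fun p : α × Bool × List β × σ => step p.1 p.2.2) := by
    refine PT.listCases (l := fun p : α × Bool × List β × σ => p.2.2.1)
      (f := fun p => ([], p.2.2.2)) (g := fun p b t => (t, f p.1 p.2.2.2 b)) (by fun_prop)
      (by fun_prop) ?_
    refine PT.prodMk (by fun_prop) (PT.comp hf
      (f := fun p : (α × Bool × List β × σ) × β × List β => (p.1.1, p.1.2.2.2, p.2.1))
      (by fun_prop))
  have h1 := PT.foldBits (d := l) (i := fun a => (l a, i a)) (h := fun a _ s => step a s) hl
    (by fun_prop) hs (2 * ql + q + 1) ?_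
  · refine (PT.snd h1).congr fun a => ?_
    have h2 : ∀ u : List Bool, u.foldl (fun s _ => step a s) (l a, i a) =
        (step a)^[u.length] (l a, i a) := by
      intro u
      induction u using List.reverseRecOn with
      | nil => rfl
      | append_singleton u b ih =>
        rw [List.foldl_append, ih, List.length_append, List.length_singleton,
          iterate_succ_apply']
        rfl
    rw [h2, key, List.take_of_length_le]
    exact length_le_size (l a)
  · intro a u hu
    have h2 : ∀ u : List Bool, u.foldl (fun s _ => step a s) (l a, i a) =
        (step a)^[u.length] (l a, i a) := by
      intro u
      induction u using List.reverseRecOn with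
      | nil => rfl
      | append_singleton u b ih =>
        rw [List.foldl_append, ih, List.length_append, List.length_singleton,
          iterate_succ_apply']
        rfl
    rw [h2, key, size_prod]
    have h3 := hq a _ (List.take_prefix u.length (l a))
    have h4 := hql a
    have h5 : size ((l a).drop u.length) ≤ size (l a) := by
      conv_rhs => rw [← List.take_append_drop u.length (l a), size_append]
      omega
    simp only [eval_add, eval_mul, eval_ofNat, eval_one]
    omega

end

end StackMachine
end

/-! ### Arithmetic and list operations in polynomial time. -/

noncomputable section

namespace StackMachine

open Function Polynomial Code

section

variable {α β γ δ σ : Type} [Code α] [Code β] [Code γ] [Code δ] [Code σ]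

@[fun_prop] theorem PT.not {c : α → Bool} (hc : PT c) : PT (fun a => !(c a)) :=
  (PT.ite hc (PT.const false) (PT.const true)).congr fun a => by cases c a <;> rfl

@[fun_prop] theorem PT.and {c d : α → Bool} (hc : PT c) (hd : PT d) : PT (fun a => c a && d a) :=
  (PT.ite hc hd (PT.const false)).congr fun a => by cases c a <;> rfl

/-! ### Natural numbers -/

@[fun_prop] theorem PT.succ {f : α → ℕ} (hf : PT f) : PT (fun a => f a + 1) :=
  Trans.comp hf (Trans.cons true)

theorem PT.pred {f : α → ℕ} (hf : PT f) : PT (fun a => f a - 1) :=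
  Trans.comp hf (Trans.of_eq (fun _ => List.tail_replicate) Trans.tail)

@[fun_prop] theorem PT.add {f g : α → ℕ} (hf : PT f) (hg : PT g) : PT (fun a => f a + g a) := by
  obtain ⟨p, hp⟩ := hf.size_le
  obtain ⟨q, hq⟩ := hg.size_le
  have key : ∀ k n : ℕ, (fun s => s + 1)^[k] n = n + k := by
    intro k n
    induction k with
    | zero => rfl
    | succ k ih => rw [iterate_succ_apply', ih]; rfl
  refine (PT.iterate (h := fun _ s => s + 1) hg hf (by fun_prop) (p + q) ?_).congr fun a =>
    (key _ _).symm
  intro a k hk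
  have := hp a
  have := hq a
  simp only [key, size_nat, eval_add] at *
  omega

@[fun_prop] theorem PT.sub {f g : α → ℕ} (hf : PT f) (hg : PT g) : PT (fun a => f a - g a) := by
  obtain ⟨p, hp⟩ := hf.size_le
  have key : ∀ k n : ℕ, (fun s => s - 1)^[k] n = n - k := by
    intro k n
    induction k with
    | zero => rfl
    | succ k ih => rw [iterate_succ_apply', ih]; rfl
  refine (PT.iterate (h := fun _ s => s - 1) hg hf (PT.pred (by fun_prop)) p ?_).congr fun a =>
    (key _ _).symm
  intro a k hk
  have := hp a
  simp only [key, size_nat] at *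
  omega

@[fun_prop] theorem PT.mul {f g : α → ℕ} (hf : PT f) (hg : PT g) : PT (fun a => f a * g a) := by
  obtain ⟨p, hp⟩ := hf.size_le
  obtain ⟨q, hq⟩ := hg.size_le
  have key : ∀ k n : ℕ, (fun s => s + n)^[k] 0 = k * n := by
    intro k n
    induction k with
    | zero => simp
    | succ k ih => rw [iterate_succ_apply', ih]; ring
  refine (PT.iterate (i := fun _ => 0) (h := fun a s => s + g a) hf (by fun_prop)
    (PT.add (by fun_prop) (hg.comp (by fun_prop))) (p * q) ?_).congr fun a => (key _ _).symm
  intro a k hk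
  have h1 := hp a
  have h2 := hq a
  simp only [key, size_nat, eval_mul] at *
  exact Nat.mul_le_mul (hk.trans h1) h2

/-- Zero is the number with the empty code, so the case distinction on the first symbol decides it.
The comparisons of numbers reduce to this test through truncated subtraction. -/
theorem PT.isZero {f : α → ℕ} (hf : PT f) : PT (fun a => decide (f a = 0)) := by
  refine (Trans.pair hf PT.id).comp (Trans.cases fun o => ?_)
  rcases o with _ | o
  · refine Trans.of_eq ?_ (Trans.const [true])
    rintro ⟨a, ha⟩
    have : f a = 0 := by simpa [enc] using ha
    simp [this, enc]
  · refine Trans.of_eq ?_ (Trans.const [false])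
    rintro ⟨a, ha⟩
    have : f a ≠ 0 := by rintro h; simp [enc, h] at ha
    simp [this, enc]

@[fun_prop] theorem PT.le {f g : α → ℕ} (hf : PT f) (hg : PT g) :
    PT (fun a => decide (f a ≤ g a)) :=
  (PT.isZero (hf.sub hg)).congr fun a => by simp [Nat.sub_eq_zero_iff_le]

@[fun_prop] theorem PT.lt {f g : α → ℕ} (hf : PT f) (hg : PT g) :
    PT (fun a => decide (f a < g a)) :=
  (PT.le hf.succ hg).congr fun _ => rfl

@[fun_prop] theorem PT.beq {f g : α → ℕ} (hf : PT f) (hg : PT g) :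
    PT (fun a => decide (f a = g a)) :=
  ((PT.le hf hg).and (PT.le hg hf)).congr fun a => by
    rw [← Bool.decide_and]; exact decide_eq_decide.2 le_antisymm_iff

@[fun_prop] theorem PT.min {f g : α → ℕ} (hf : PT f) (hg : PT g) :
    PT (fun a => Min.min (f a) (g a)) :=
  (hf.sub (hf.sub hg)).congr fun a => by omega

theorem PT.eval (p : Polynomial ℕ) {f : α → ℕ} (hf : PT f) : PT (fun a => p.eval (f a)) := by
  induction p using Polynomial.induction_on' with
  | add p q hp hq => exact (hp.add hq).congr fun a => by simp
  | monomial n c =>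
    have : PT (fun a => f a ^ n) := by
      induction n with
      | zero => exact (PT.const 1).congr fun a => by simp
      | succ n ih => exact (ih.mul hf).congr fun a => by rw [pow_succ]
    exact ((PT.const c).mul this).congr fun a => by simp

/-! ### Lists -/

@[fun_prop] theorem PT.reverse {l : α → List β} (hl : PT l) : PT (fun a => (l a).reverse) := by
  have key : ∀ l m : List β, l.foldl (fun s b => b :: s) m = l.reverse ++ m := by
    intro l
    induction l with
    | nil => simp
    | cons a l ih => intro m; simp [ih]
  obtain ⟨q, hq⟩ := hl.size_le
  refine (PT.foldl (i := fun _ => []) (f := fun _ s b => b :: s) hl (by fun_prop) (by fun_prop)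
    q ?_).congr fun a => by simp [key]
  intro a l' hl'
  rw [key]
  simpa using (size_le_of_prefix hl').trans (hq a)

@[fun_prop] theorem PT.append {l m : α → List β} (hl : PT l) (hm : PT m) :
    PT (fun a => l a ++ m a) := by
  have key : ∀ l m : List β, l.foldl (fun s b => b :: s) m = l.reverse ++ m := by
    intro l
    induction l with
    | nil => simp
    | cons a l ih => intro m; simp [ih]
  obtain ⟨q, hq⟩ := hl.size_le
  obtain ⟨r, hr⟩ := hm.size_le
  refine (PT.foldl (f := fun _ s b => b :: s) hl.reverse hm (by fun_prop)
    (q + r) ?_).congr fun a => by simp [key]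
  intro a l' hl'
  rw [key]
  have h1 := (size_le_of_prefix hl').trans_eq (size_reverse _)
  have h2 := hq a
  have h3 := hr a
  simp only [size_append, size_reverse, eval_add]
  omega

@[fun_prop] theorem PT.flatMap {l : α → List β} {f : α → β → List γ} (hl : PT l)
    (hf : PT (fun p : α × β => f p.1 p.2)) : PT (fun a => (l a).flatMap (f a)) := by
  have key : ∀ (g : β → List γ) (l : List β) (m : List γ),
      l.foldl (fun s b => s ++ g b) m = m ++ l.flatMap g := by
    intro g l
    induction l with
    | nil => simp
    | cons a l ih => intro m; simp [ih]
  obtain ⟨q, hq⟩ := hl.size_le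
  obtain ⟨r, hr⟩ := hf.size_le
  refine (PT.foldl (i := fun _ => []) (f := fun a s b => s ++ f a b) hl (by fun_prop)
    (PT.append (by fun_prop) (hf.comp (f := fun p : α × List γ × β => (p.1, p.2.2)) (by fun_prop)))
    (q * r.comp (2 * X + q + 1)) ?_).congr fun a => by simp [key]
  intro a l' hl'
  rw [key, List.nil_append]
  simp only [eval_mul, eval_comp, eval_add, eval_X, eval_ofNat, eval_one]
  refine (size_flatMap_le l' (f a) _ ?_).trans
    (Nat.mul_le_mul_right _ ((size_le_of_prefix hl').trans (hq a)))
  intro b hb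
  refine (hr (a, b)).trans (eval_mono r ?_)
  have h1 := size_le_of_mem (hl'.subset hb)
  have h2 := hq a
  simp only [size_prod]
  omega

@[fun_prop] theorem PT.map {l : α → List β} {f : α → β → γ} (hl : PT l)
    (hf : PT (fun p : α × β => f p.1 p.2)) : PT (fun a => (l a).map (f a)) :=
  (PT.flatMap (f := fun a b => [f a b]) hl (hf.cons (PT.const []))).congr fun _ =>
    List.map_eq_flatMap ..

@[fun_prop] theorem PT.filter {l : α → List β} {f : α → β → Bool} (hl : PT l)
    (hf : PT (fun p : α × β => f p.1 p.2)) : PT (fun a => (l a).filter (f a)) :=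
  (PT.flatMap (f := fun a b => if f a b = true then [b] else []) hl
    (hf.ite (by fun_prop) (by fun_prop))).congr fun a => by
      induction l a with
      | nil => rfl
      | cons b l ih => by_cases h : f a b <;> simp [h, ih]

@[fun_prop] theorem PT.length {l : α → List β} (hl : PT l) : PT (fun a => (l a).length) := by
  have key : ∀ (l : List β) (n : ℕ), l.foldl (fun s _ => s + 1) n = n + l.length := by
    intro l
    induction l with
    | nil => simp
    | cons a l ih => intro n; simp [ih]; omega
  obtain ⟨q, hq⟩ := hl.size_le
  refine (PT.foldl (i := fun _ => 0) (f := fun _ s _ => s + 1) hl (by fun_prop) (by fun_prop)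
    q ?_).congr fun a => by simp [key]
  intro a l' hl'
  rw [key]
  simpa using (length_le_size l').trans ((size_le_of_prefix hl').trans (hq a))

@[fun_prop] theorem PT.tail {l : α → List β} (hl : PT l) : PT (fun a => (l a).tail) :=
  (PT.listCases (g := fun _ _ t => t) hl (PT.const []) (by fun_prop)).congr fun a => by
    cases l a <;> rfl

@[fun_prop] theorem PT.headD {l : α → List β} {d : α → β} (hl : PT l) (hd : PT d) :
    PT (fun a => (l a).headD (d a)) :=
  (PT.listCases (g := fun _ b _ => b) hl hd (by fun_prop)).congr fun a => by
    cases l a <;> rfl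

@[fun_prop] theorem PT.drop {l : α → List β} {n : α → ℕ} (hn : PT n) (hl : PT l) :
    PT (fun a => (l a).drop (n a)) := by
  have key : ∀ (k : ℕ) (l : List β), List.tail^[k] l = l.drop k := by
    intro k
    induction k with
    | zero => simp
    | succ k ih => intro l; rw [iterate_succ_apply, ih, List.drop_tail]
  obtain ⟨q, hq⟩ := hl.size_le
  refine (PT.iterate (h := fun _ => List.tail) hn hl (by fun_prop) q ?_).congr fun a =>
    (key _ _).symm
  intro a k _
  rw [key]
  have h1 := hq a
  rw [← List.take_append_drop k (l a), size_append] at h1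
  omega

@[fun_prop] theorem PT.take {l : α → List β} {n : α → ℕ} (hn : PT n) (hl : PT l) :
    PT (fun a => (l a).take (n a)) :=
  (PT.reverse (PT.drop (hl.length.sub hn) hl.reverse)).congr fun a => by
    rw [List.drop_reverse, List.reverse_reverse]
    rcases le_total (n a) (l a).length with h | h
    · rw [Nat.sub_sub_self h]
    · rw [Nat.sub_eq_zero_of_le h, Nat.sub_zero, List.take_length, List.take_of_length_le h]

@[fun_prop] theorem PT.getD {l : α → List β} {n : α → ℕ} {d : α → β} (hl : PT l) (hn : PT n)
    (hd : PT d) : PT (fun a => (l a).getD (n a) (d a)) :=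
  ((PT.drop hn hl).headD hd).congr fun a => by
    rw [List.getD_eq_getElem?_getD, List.headD_eq_head?_getD, List.head?_drop]

-- The list is built by iteration with a counter; with unary entries its code has at most quadratic
-- size, which is the bound that the iteration needs.
@[fun_prop] theorem PT.range {n : α → ℕ} (hn : PT n) : PT (fun a => List.range (n a)) := by
  let step (s : ℕ × List ℕ) : ℕ × List ℕ := (s.1 + 1, s.2 ++ [s.1])
  have key : ∀ k : ℕ, step^[k] (0, []) = (k, List.range k) := by
    intro k
    induction k with
    | zero => rfl
    | succ k ih => rw [iterate_succ_apply', ih, List.range_succ]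
  have hs : ∀ k : ℕ, size (List.range k) ≤ k * (2 * k) := by
    intro k
    induction k with
    | zero => simp
    | succ k ih =>
      rw [List.range_succ, size_append]
      simp only [size_cons, size_nat, size_nil]
      nlinarith
  obtain ⟨q, hq⟩ := hn.size_le
  refine (PT.snd (PT.iterate (i := fun _ => (0, [])) (h := fun _ => step) hn (by fun_prop)
    (by fun_prop) (2 * q + q * (2 * q) + 1) ?_)).congr fun a => by rw [key]
  intro a k hk
  rw [key]
  have h1 := hq a
  have h2 := hs k
  rw [size_nat] at h1
  have h3 : k * (2 * k) ≤ q.eval (size a) * (2 * q.eval (size a)) := by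
    have := hk.trans h1
    gcongr
  simp only [size_prod, size_nat, eval_add, eval_mul, eval_ofNat, eval_one]
  omega

@[fun_prop] theorem PT.zipIdx {l : α → List β} (hl : PT l) : PT (fun a => (l a).zipIdx) := by
  refine (PT.flatMap (f := fun a i => ((((l a).drop i).take 1).map fun b => (b, i)))
    hl.length.range ?_).congr fun a => ?_
  · exact PT.map (PT.take (by fun_prop) (PT.drop (by fun_prop) (hl.comp (by fun_prop))))
      (by fun_prop)
  · refine List.ext_getElem? fun i => ?_
    have : ∀ l : List β, (List.range l.length).flatMap
        (fun i => (((l.drop i).take 1).map fun b => (b, i))) = l.zipIdx := by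
      intro l
      induction l using List.reverseRecOn with
      | nil => rfl
      | append_singleton l b ih =>
        rw [List.length_append, List.length_singleton, List.range_succ, List.flatMap_append,
          List.zipIdx_append, ← ih]
        congr 1
        · refine List.flatMap_congr fun i hi => ?_
          have : i < l.length := List.mem_range.1 hi
          rw [List.drop_append_of_le_length this.le, List.take_append_of_le_length]
          simp; omega
        · simp
    rw [this]

theorem PT.replicate {n : α → ℕ} {b : α → β} (hn : PT n) (hb : PT b) :
    PT (fun a => List.replicate (n a) (b a)) :=
  (PT.map (f := fun a _ => b a) hn.range (hb.comp (by fun_prop))).congr fun a => by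
    simp [List.map_const']

/-! ### Words -/

/-- The bits of a word. -/
def bits (w : Word) : List Bool := w

/-- The word with given bits. -/
def toWord (l : List Bool) : Word := l

@[simp] theorem enc_word (w : Word) : enc w = bits w := rfl
@[simp] theorem bits_toWord (l : List Bool) : bits (toWord l) = l := rfl

/-- A `Word` is coded by itself, while a `List Bool` spends three symbols on each bit. Machine
inputs and outputs have the first form, the list operations work on the second; this lemma and
`PT.toWord` convert between them. -/
theorem PT.bits {w : α → Word} (hw : PT w) : PT (fun a => StackMachine.bits (w a)) := by
  have key : ∀ l m : List Bool, l.foldl (fun s b => b :: s) m = l.reverse ++ m := by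
    intro l
    induction l with
    | nil => simp
    | cons a l ih => intro m; simp [ih]
  have hs : ∀ l : List Bool, size l = 3 * l.length := by
    intro l
    induction l with
    | nil => rfl
    | cons b l ih => simp [ih]; omega
  obtain ⟨q, hq⟩ := hw.size_le
  refine (PT.reverse (PT.foldBits (i := fun _ => []) (h := fun _ b s => b :: s) hw (by fun_prop)
    (by fun_prop) (3 * q) ?_)).congr fun a => by simp [key]
  intro a u hu
  rw [key, List.append_nil, size_reverse, hs]
  have := hq a
  have := hu.length_le
  simp only [size, eval_mul, eval_ofNat] at *
  omega

theorem PT.toWord {l : α → List Bool} (hl : PT l) : PT (fun a => StackMachine.toWord (l a)) := by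
  have hc : PT (fun p : α × Word × Bool =>
      if p.2.2 = true then StackMachine.toWord (true :: StackMachine.bits p.2.1)
      else StackMachine.toWord (false :: StackMachine.bits p.2.1)) :=
    PT.ite (by fun_prop)
      (Trans.comp (PT.fst (PT.snd PT.id)) (Trans.cons true))
      (Trans.comp (PT.fst (PT.snd PT.id)) (Trans.cons false))
  have key : ∀ l m : List Bool, l.foldl (fun s b => if b = true then StackMachine.toWord
      (true :: StackMachine.bits s) else StackMachine.toWord (false :: StackMachine.bits s))
      (StackMachine.toWord m) = StackMachine.toWord (l.reverse ++ m) := by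
    intro l
    induction l with
    | nil => simp
    | cons b l ih =>
      intro m
      have := ih (b :: m)
      cases b <;> simpa using this
  obtain ⟨q, hq⟩ := hl.size_le
  refine (PT.foldl (i := fun _ => StackMachine.toWord []) (f := fun _ s b => if b = true then
    StackMachine.toWord (true :: StackMachine.bits s) else
    StackMachine.toWord (false :: StackMachine.bits s)) hl.reverse (PT.const _) hc
    q ?_).congr fun a => by simp [key]
  intro a l' hl'
  rw [key]
  have h1 := hq a
  have h2 := length_le_size (l a)
  have h3 := hl'.length_le
  simp only [size, enc_word, bits_toWord, List.append_nil, List.length_reverse] at *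
  omega

end

end StackMachine
end

noncomputable section

/-! ### Registers of wires -/

section Split

variable {a b N : ℕ}

/-- The first `a` wires. -/
def splitL (h : a + b = N) (x : Bits N) : Bits a := fun i => x ⟨i, by omega⟩

/-- The last `b` wires. -/
def splitR (h : a + b = N) (x : Bits N) : Bits b := fun j => x ⟨a + j, by omega⟩

/-- Two registers side by side. -/
def joinBits (h : a + b = N) (u : Bits a) (v : Bits b) : Bits N :=
  fun i => if hi : (i : ℕ) < a then u ⟨i, hi⟩ else v ⟨i - a, by omega⟩

@[simp] theorem splitL_joinBits (h : a + b = N) (u : Bits a) (v : Bits b) :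
    splitL h (joinBits h u v) = u := by
  funext i; simp [splitL, joinBits]

@[simp] theorem splitR_joinBits (h : a + b = N) (u : Bits a) (v : Bits b) :
    splitR h (joinBits h u v) = v := by
  funext i; simp [splitR, joinBits]

@[simp] theorem joinBits_split (h : a + b = N) (x : Bits N) :
    joinBits h (splitL h x) (splitR h x) = x := by
  funext i
  by_cases hi : (i : ℕ) < a
  · simp [joinBits, splitL, hi]
  · simp only [joinBits, splitR, hi, dite_false]
    congr 1
    ext
    simp
    omega

/-- Splitting the wires. -/
def splitEquiv (h : a + b = N) : Bits N ≃ Bits a × Bits b where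
  toFun x := (splitL h x, splitR h x)
  invFun p := joinBits h p.1 p.2
  left_inv x := joinBits_split h x
  right_inv p := by simp

theorem split_ext (h : a + b = N) {x y : Bits N} :
    x = y ↔ splitL h x = splitL h y ∧ splitR h x = splitR h y := by
  rw [← (splitEquiv h).injective.eq_iff]
  exact Prod.ext_iff

theorem sum_split {M : Type*} [AddCommMonoid M] (h : a + b = N) (F : Bits N → M) :
    ∑ x, F x = ∑ u, ∑ v, F (joinBits h u v) := by
  rw [← (splitEquiv h).symm.sum_comp, Fintype.sum_prod_type]
  rfl

/-- The tensor product of operators. -/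
def tens (h : a + b = N) (A : QOp a) (B : QOp b) : QOp N :=
  fun x y => A (splitL h x) (splitL h y) * B (splitR h x) (splitR h y)

theorem tens_mul (h : a + b = N) (A A' : QOp a) (B B' : QOp b) :
    tens h A B * tens h A' B' = tens h (A * A') (B * B') := by
  ext x y
  simp only [Matrix.mul_apply, tens, sum_split h, splitL_joinBits, splitR_joinBits]
  rw [Finset.sum_mul_sum]
  exact Finset.sum_congr rfl fun u _ => Finset.sum_congr rfl fun v _ => by ring

@[simp] theorem tens_one (h : a + b = N) : tens h 1 1 = 1 := by
  ext x y
  by_cases hxy : x = y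
  · subst hxy; simp [tens]
  · rw [Matrix.one_apply_ne hxy, tens]
    rw [split_ext h, not_and_or] at hxy
    rcases hxy with h1 | h1 <;> simp [Matrix.one_apply_ne h1]

theorem splitL_update_left (h : a + b = N) (x : Bits N) (i : ℕ) (hi : i < a) (v : Bool) :
    splitL h (Function.update x ⟨i, by omega⟩ v) = Function.update (splitL h x) ⟨i, hi⟩ v := by
  funext j
  simp [splitL, Function.update_apply, Fin.ext_iff]

theorem splitR_update_left (h : a + b = N) (x : Bits N) (i : ℕ) (hi : i < a) (v : Bool) :
    splitR h (Function.update x ⟨i, by omega⟩ v) = splitR h x := by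
  funext j
  have : a + (j : ℕ) ≠ i := by omega
  simp [splitR, this]

theorem splitR_update_right (h : a + b = N) (x : Bits N) (i : ℕ) (hi : i < b) (v : Bool) :
    splitR h (Function.update x ⟨a + i, by omega⟩ v) = Function.update (splitR h x) ⟨i, hi⟩ v := by
  funext j
  simp [splitR, Function.update_apply, Fin.ext_iff]

theorem splitL_update_right (h : a + b = N) (x : Bits N) (i : ℕ) (hi : i < b) (v : Bool) :
    splitL h (Function.update x ⟨a + i, by omega⟩ v) = splitL h x := by
  funext j
  have : (j : ℕ) ≠ a + i := by omega
  simp [splitL, this]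

theorem onWire_left (h : a + b = N) (u : Matrix Bool Bool ℂ) (i : ℕ) (hi : i < a) :
    onWire u (⟨i, by omega⟩ : Fin N) = tens h (onWire u ⟨i, hi⟩) 1 := by
  ext x y
  simp only [onWire, tens]
  by_cases hR : splitR h x = splitR h y
  · rw [hR, Matrix.one_apply_eq, mul_one]
    have : (∀ l : Fin N, l ≠ ⟨i, by omega⟩ → x l = y l) ↔
        ∀ l : Fin a, l ≠ ⟨i, hi⟩ → splitL h x l = splitL h y l := by
      constructor
      · intro H l hl
        exact H _ (by simpa [Fin.ext_iff] using hl)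
      · intro H l hl
        by_cases hla : (l : ℕ) < a
        · exact H ⟨l, hla⟩ (by simpa [Fin.ext_iff] using hl)
        · have := congrFun hR ⟨l - a, by omega⟩
          simp only [splitR] at this
          have e : (⟨a + (l - a), by omega⟩ : Fin N) = l := by ext; simp; omega
          rwa [e] at this
    simp only [this]
    rfl
  · rw [Matrix.one_apply_ne hR, mul_zero, if_neg]
    intro H
    refine hR (funext fun j => H _ ?_)
    simp [Fin.ext_iff]; omega

theorem onWire_right (h : a + b = N) (u : Matrix Bool Bool ℂ) (i : ℕ) (hi : i < b) :
    onWire u (⟨a + i, by omega⟩ : Fin N) = tens h 1 (onWire u ⟨i, hi⟩) := by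
  ext x y
  simp only [onWire, tens]
  by_cases hR : splitL h x = splitL h y
  · rw [hR, Matrix.one_apply_eq, one_mul]
    have : (∀ l : Fin N, l ≠ ⟨a + i, by omega⟩ → x l = y l) ↔
        ∀ l : Fin b, l ≠ ⟨i, hi⟩ → splitR h x l = splitR h y l := by
      constructor
      · intro H l hl
        exact H _ (by simpa [Fin.ext_iff] using hl)
      · intro H l hl
        by_cases hla : (l : ℕ) < a
        · exact congrFun hR ⟨l, hla⟩
        · have e : (⟨a + (l - a), by omega⟩ : Fin N) = l := by ext; simp; omega
          have := H ⟨l - a, by omega⟩ (by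
            intro h'; apply hl; ext; simp only [Fin.mk.injEq] at h'; simp; omega)
          simp only [splitR] at this
          rwa [e] at this
    simp only [this]
    rfl
  · rw [Matrix.one_apply_ne hR, zero_mul, if_neg]
    intro H
    refine hR (funext fun j => H _ ?_)
    simp [Fin.ext_iff]; omega

theorem basisMap_left (h : a + b = N) {f : Bits N → Bits N} {f' : Bits a → Bits a}
    (hL : ∀ y, splitL h (f y) = f' (splitL h y)) (hR : ∀ y, splitR h (f y) = splitR h y) :
    basisMap f = tens h (basisMap f') 1 := by
  ext x y
  have : x = f y ↔ splitL h x = f' (splitL h y) ∧ splitR h x = splitR h y := by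
    rw [split_ext h, hL, hR]
  simp only [basisMap, tens, this, Matrix.one_apply]
  by_cases h1 : splitL h x = f' (splitL h y) <;> by_cases h2 : splitR h x = splitR h y <;>
    simp [h1, h2]

theorem basisMap_right (h : a + b = N) {f : Bits N → Bits N} {f' : Bits b → Bits b}
    (hR : ∀ y, splitR h (f y) = f' (splitR h y)) (hL : ∀ y, splitL h (f y) = splitL h y) :
    basisMap f = tens h 1 (basisMap f') := by
  ext x y
  have : x = f y ↔ splitL h x = splitL h y ∧ splitR h x = f' (splitR h y) := by
    rw [split_ext h, hL, hR]
  simp only [basisMap, tens, this, Matrix.one_apply]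
  by_cases h1 : splitL h x = splitL h y <;> by_cases h2 : splitR h x = f' (splitR h y) <;>
    simp [h1, h2]

end Split

namespace Gate

/-- Operation code and wires. -/
def quad : Gate → ℕ × ℕ × ℕ × ℕ
  | had i => (1, i, 0, 0)
  | tee i => (2, i, 0, 0)
  | teeInv i => (3, i, 0, 0)
  | flip i => (4, i, 0, 0)
  | cnot i j => (5, i, j, 0)
  | ccnot i j k => (6, i, j, k)

/-- All wires are less than `n`. -/
def fits (n : ℕ) (g : Gate) : Bool :=
  decide (g.quad.2.1 < n) && (decide (g.quad.2.2.1 < n) && decide (g.quad.2.2.2 < n))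

/-- The gate acts `s` wires further. -/
def shift (s : ℕ) : Gate → Gate
  | had i => had (s + i)
  | tee i => tee (s + i)
  | teeInv i => teeInv (s + i)
  | flip i => flip (s + i)
  | cnot i j => cnot (s + i) (s + j)
  | ccnot i j k => ccnot (s + i) (s + j) (s + k)

/-- The inverse gate. -/
def inv : Gate → Gate
  | tee i => teeInv i
  | teeInv i => tee i
  | g => g

theorem fits_iff {n : ℕ} {g : Gate} :
    g.fits n = true ↔ g.quad.2.1 < n ∧ g.quad.2.2.1 < n ∧ g.quad.2.2.2 < n := by
  simp [fits]

theorem mat_of_not_fits {n : ℕ} {g : Gate} (h : g.fits n = false) : g.mat n = 1 := by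
  rw [← Bool.not_eq_true, fits_iff] at h
  cases g <;> simp only [quad] at h <;> rw [mat, dif_neg] <;> omega

theorem mat_left {a b N : ℕ} (h : a + b = N) {g : Gate} (hg : g.fits a = true) :
    g.mat N = tens h (g.mat a) 1 := by
  rw [fits_iff] at hg
  cases g <;> simp only [quad] at hg
  case had i =>
    rw [mat, mat, dif_pos (by omega), dif_pos hg.1, ← onWire_left]
  case tee i =>
    rw [mat, mat, dif_pos (by omega), dif_pos hg.1, ← onWire_left]
  case teeInv i =>
    rw [mat, mat, dif_pos (by omega), dif_pos hg.1, ← onWire_left]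
  case flip i =>
    rw [mat, mat, dif_pos (by omega), dif_pos hg.1]
    refine basisMap_left h (fun y => ?_) fun y => ?_
    · rw [splitL_update_left h y i hg.1]; rfl
    · rw [splitR_update_left h y i hg.1]
  case cnot i j =>
    by_cases hij : i = j
    · rw [mat, mat, dif_neg (by omega), dif_neg (by omega), tens_one]
    · rw [mat, mat, dif_pos (by omega), dif_pos (by omega)]
      refine basisMap_left h (fun y => ?_) fun y => ?_
      · rw [splitL_update_left h y j hg.2.1]; rfl
      · rw [splitR_update_left h y j hg.2.1]
  case ccnot i j k =>
    by_cases hij : i ≠ j ∧ i ≠ k ∧ j ≠ k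
    · rw [mat, mat, dif_pos (by omega), dif_pos (by omega)]
      refine basisMap_left h (fun y => ?_) fun y => ?_
      · rw [splitL_update_left h y k hg.2.2]; rfl
      · rw [splitR_update_left h y k hg.2.2]
    · rw [mat, mat, dif_neg (by omega), dif_neg (by omega), tens_one]

theorem mat_right {a b N : ℕ} (h : a + b = N) {g : Gate} (hg : g.fits b = true) :
    (g.shift a).mat N = tens h 1 (g.mat b) := by
  rw [fits_iff] at hg
  cases g <;> simp only [quad] at hg
  case had i =>
    rw [shift, mat, mat, dif_pos (by omega), dif_pos hg.1, ← onWire_right]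
  case tee i =>
    rw [shift, mat, mat, dif_pos (by omega), dif_pos hg.1, ← onWire_right]
  case teeInv i =>
    rw [shift, mat, mat, dif_pos (by omega), dif_pos hg.1, ← onWire_right]
  case flip i =>
    rw [shift, mat, mat, dif_pos (by omega), dif_pos hg.1]
    refine basisMap_right h (fun y => ?_) fun y => ?_
    · rw [splitR_update_right h y i hg.1]; rfl
    · rw [splitL_update_right h y i hg.1]
  case cnot i j =>
    by_cases hij : i = j
    · rw [shift, mat, mat, dif_neg (by omega), dif_neg (by omega), tens_one]
    · rw [shift, mat, mat, dif_pos (by omega), dif_pos (by omega)]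
      refine basisMap_right h (fun y => ?_) fun y => ?_
      · rw [splitR_update_right h y j hg.2.1]; rfl
      · rw [splitL_update_right h y j hg.2.1]
  case ccnot i j k =>
    by_cases hij : i ≠ j ∧ i ≠ k ∧ j ≠ k
    · rw [shift, mat, mat, dif_pos (by omega), dif_pos (by omega)]
      refine basisMap_right h (fun y => ?_) fun y => ?_
      · rw [splitR_update_right h y k hg.2.2]; rfl
      · rw [splitL_update_right h y k hg.2.2]
    · rw [shift, mat, mat, dif_neg (by omega), dif_neg (by omega), tens_one]

end Gate

/-- The gates all of whose wires are less than `n`. -/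
def cleanGates (n : ℕ) (gs : List Gate) : List Gate := gs.filter (Gate.fits n)

/-- The gates of the inverse circuit. -/
def invGates (gs : List Gate) : List Gate := gs.reverse.map Gate.inv

theorem gatesMat_append (N : ℕ) (l l' : List Gate) :
    gatesMat N (l ++ l') = gatesMat N l' * gatesMat N l := by
  induction l with
  | nil => simp [gatesMat]
  | cons g l ih => simp [gatesMat, ih, Matrix.mul_assoc]

/-- On `n` wires a gate that names a wire out of range is the identity, but inside a larger register
it would act on a neighbour. Circuits are filtered before they are placed side by side; this does
not change their own unitary. -/
theorem gatesMat_clean (n : ℕ) (gs : List Gate) : gatesMat n (cleanGates n gs) = gatesMat n gs := by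
  induction gs with
  | nil => rfl
  | cons g gs ih =>
    by_cases h : g.fits n
    · rw [cleanGates, List.filter_cons_of_pos h, gatesMat, gatesMat, ← ih]; rfl
    · rw [cleanGates, List.filter_cons_of_neg h, gatesMat, Gate.mat_of_not_fits (by simpa using h),
        mul_one, ← ih]; rfl

theorem gatesMat_left {a b N : ℕ} (h : a + b = N) {gs : List Gate}
    (hg : ∀ g ∈ gs, Gate.fits a g = true) : gatesMat N gs = tens h (gatesMat a gs) 1 := by
  induction gs with
  | nil => simp [gatesMat]
  | cons g gs ih =>
    rw [gatesMat, gatesMat, ih fun g' h' => hg g' (by simp [h']), Gate.mat_left h (hg g (by simp)),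
      tens_mul, one_mul]

theorem gatesMat_right {a b N : ℕ} (h : a + b = N) {gs : List Gate}
    (hg : ∀ g ∈ gs, Gate.fits b g = true) :
    gatesMat N (gs.map (Gate.shift a)) = tens h 1 (gatesMat b gs) := by
  induction gs with
  | nil => simp [gatesMat]
  | cons g gs ih =>
    rw [List.map_cons, gatesMat, gatesMat, ih fun g' h' => hg g' (by simp [h']),
      Gate.mat_right h (hg g (by simp)), tens_mul, one_mul]

theorem fits_of_mem_clean {n : ℕ} {gs : List Gate} {g : Gate} (h : g ∈ cleanGates n gs) :
    g.fits n = true :=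
  (List.mem_filter.1 h).2

/-! ### Unitarity -/

theorem onWire_mul {N : ℕ} (u v : Matrix Bool Bool ℂ) (i : Fin N) :
    onWire u i * onWire v i = onWire (u * v) i := by
  ext x y
  rw [Matrix.mul_apply]
  have h1 : ∀ z, onWire u i x z * onWire v i z y =
      if z ∈ (Finset.univ : Finset Bool).image (Function.update x i) then
        (if ∀ l, l ≠ i → x l = y l then u (x i) (z i) * v (z i) (y i) else 0) else 0 := by
    intro z
    by_cases hz : ∀ l, l ≠ i → x l = z l
    · have hz' : z = Function.update x i (z i) := by
        funext l
        by_cases hl : l = i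
        · subst hl; simp
        · simp [Function.update_of_ne hl, hz l hl]
      rw [if_pos (Finset.mem_image.2 ⟨z i, Finset.mem_univ _, hz'.symm⟩)]
      have : (∀ l, l ≠ i → z l = y l) ↔ ∀ l, l ≠ i → x l = y l :=
        forall₂_congr fun l hl => by rw [hz l hl]
      simp only [onWire, if_pos hz, this]
      split_ifs <;> simp
    · rw [if_neg, onWire, if_neg hz, zero_mul]
      intro hmem
      obtain ⟨b, -, rfl⟩ := Finset.mem_image.1 hmem
      exact hz fun l hl => by simp [Function.update_of_ne hl]
  have hinj : Function.Injective (Function.update x i) := Function.update_injective x i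
  simp only [h1, Finset.sum_ite_mem, Finset.univ_inter]
  rw [Finset.sum_image fun _ _ _ _ h => hinj h]
  simp only [Function.update_self, onWire, Matrix.mul_apply]
  split_ifs <;> simp

theorem onWire_one {N : ℕ} (i : Fin N) : onWire (1 : Matrix Bool Bool ℂ) i = 1 := by
  ext x y
  by_cases h : x = y
  · subst h; simp [onWire]
  · rw [Matrix.one_apply_ne h, onWire]
    split_ifs with h1
    · rw [Matrix.one_apply_ne]
      intro h2
      exact h (funext fun l => by
        by_cases hl : l = i
        · rw [hl, h2]
        · exact h1 l hl)
    · rfl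

theorem onWire_conjTranspose {N : ℕ} (u : Matrix Bool Bool ℂ) (i : Fin N) :
    (onWire u i)ᴴ = onWire uᴴ i := by
  ext x y
  simp only [Matrix.conjTranspose_apply, onWire]
  have : (∀ l, l ≠ i → y l = x l) ↔ ∀ l, l ≠ i → x l = y l :=
    forall₂_congr fun l _ => eq_comm
  simp only [this]
  split_ifs <;> simp

theorem hadMat_mul : hadMat * hadMat = 1 := by
  have h2 : ((Real.sqrt 2 : ℝ) : ℂ) ^ 2 = 2 := by
    rw [← Complex.ofReal_pow, Real.sq_sqrt (by norm_num)]; norm_num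
  have h0 : ((Real.sqrt 2 : ℝ) : ℂ) ≠ 0 := by
    intro h; rw [h] at h2; norm_num at h2
  ext a b
  cases a <;> cases b <;> simp [Matrix.mul_apply, hadMat] <;> field_simp <;>
    (try rw [h2]) <;> norm_num

theorem hadMat_conjTranspose : hadMatᴴ = hadMat := by
  ext a b
  cases a <;> cases b <;> simp [hadMat]

theorem phaseMat_mul (θ θ' : ℝ) : phaseMat θ * phaseMat θ' = phaseMat (θ + θ') := by
  ext a b
  cases a <;> cases b <;> simp [Matrix.mul_apply, phaseMat, ← Complex.exp_add, add_mul]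

theorem phaseMat_zero : phaseMat 0 = 1 := by
  ext a b
  cases a <;> cases b <;> simp [phaseMat]

theorem phaseMat_conjTranspose (θ : ℝ) : (phaseMat θ)ᴴ = phaseMat (-θ) := by
  ext a b
  cases a <;> cases b <;> simp [phaseMat, ← Complex.exp_conj]

theorem basisMap_mul {N : ℕ} (f g : Bits N → Bits N) :
    basisMap f * basisMap g = basisMap (f ∘ g) := by
  ext x y
  simp [Matrix.mul_apply, basisMap]

theorem basisMap_id {N : ℕ} : basisMap (id : Bits N → Bits N) = 1 := by
  ext x y
  simp [basisMap, Matrix.one_apply]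

theorem basisMap_conjTranspose {N : ℕ} {f : Bits N → Bits N} (h : f ∘ f = id) :
    (basisMap f)ᴴ = basisMap f := by
  ext x y
  have : y = f x ↔ x = f y :=
    ⟨fun e => by rw [e]; exact (congrFun h x).symm, fun e => by rw [e]; exact (congrFun h y).symm⟩
  simp only [Matrix.conjTranspose_apply, basisMap, this]
  split_ifs <;> simp

namespace Gate

theorem flip_invol {N : ℕ} (i : Fin N) :
    (fun y : Bits N => Function.update y i (!(y i))) ∘
      (fun y : Bits N => Function.update y i (!(y i))) = id := by
  funext y; simp

theorem cnot_invol {N : ℕ} {i j : Fin N} (h : i ≠ j) :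
    (fun y : Bits N => Function.update y j (xor (y j) (y i))) ∘
      (fun y : Bits N => Function.update y j (xor (y j) (y i))) = id := by
  funext y
  simp [Function.update_of_ne h]

theorem ccnot_invol {N : ℕ} {i j k : Fin N} (h : i ≠ k) (h' : j ≠ k) :
    (fun y : Bits N => Function.update y k (xor (y k) (y i && y j))) ∘
      (fun y : Bits N => Function.update y k (xor (y k) (y i && y j))) = id := by
  funext y
  simp [Function.update_of_ne h, Function.update_of_ne h']

theorem mat_inv (N : ℕ) (g : Gate) : g.inv.mat N = (g.mat N)ᴴ := by
  cases g <;> simp only [inv, mat]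
  case had i =>
    split_ifs
    · rw [onWire_conjTranspose, hadMat_conjTranspose]
    · simp
  case tee i =>
    split_ifs
    · rw [onWire_conjTranspose, phaseMat_conjTranspose]
    · simp
  case teeInv i =>
    split_ifs
    · rw [onWire_conjTranspose, phaseMat_conjTranspose, neg_neg]
    · simp
  case flip i =>
    split_ifs
    · rw [basisMap_conjTranspose (flip_invol _)]
    · simp
  case cnot i j =>
    split_ifs with h
    · rw [basisMap_conjTranspose (cnot_invol (by simpa [Fin.ext_iff] using h.2.2))]
    · simp
  case ccnot i j k =>
    split_ifs with h
    · rw [basisMap_conjTranspose (ccnot_invol (by simpa [Fin.ext_iff] using h.2.2.2.2.1)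
        (by simpa [Fin.ext_iff] using h.2.2.2.2.2))]
    · simp

/-- The adjoint is again a gate, so the claim becomes a computation: H² = 1, opposite phases cancel,
and the classical gates are involutions. -/
theorem mat_unitary (N : ℕ) (g : Gate) : (g.mat N)ᴴ * g.mat N = 1 := by
  rw [← mat_inv]
  cases g <;> simp only [inv, mat]
  case had i =>
    split_ifs
    · rw [onWire_mul, hadMat_mul, onWire_one]
    · simp
  case tee i =>
    split_ifs
    · rw [onWire_mul, phaseMat_mul, neg_add_cancel, phaseMat_zero, onWire_one]
    · simp
  case teeInv i =>
    split_ifs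
    · rw [onWire_mul, phaseMat_mul, add_neg_cancel, phaseMat_zero, onWire_one]
    · simp
  case flip i =>
    split_ifs
    · rw [basisMap_mul, flip_invol, basisMap_id]
    · simp
  case cnot i j =>
    split_ifs with h
    · rw [basisMap_mul, cnot_invol (by simpa [Fin.ext_iff] using h.2.2), basisMap_id]
    · simp
  case ccnot i j k =>
    split_ifs with h
    · rw [basisMap_mul, ccnot_invol (by simpa [Fin.ext_iff] using h.2.2.2.2.1)
        (by simpa [Fin.ext_iff] using h.2.2.2.2.2), basisMap_id]
    · simp

end Gate

theorem gatesMat_inv (N : ℕ) (gs : List Gate) :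
    gatesMat N (invGates gs) = (gatesMat N gs)ᴴ := by
  induction gs with
  | nil => simp [invGates, gatesMat]
  | cons g gs ih =>
    have : invGates (g :: gs) = invGates gs ++ [g.inv] := by simp [invGates]
    rw [this, gatesMat_append, ih, gatesMat, gatesMat, gatesMat, one_mul, Gate.mat_inv,
      Matrix.conjTranspose_mul]

theorem gatesMat_unitary (N : ℕ) (gs : List Gate) : (gatesMat N gs)ᴴ * gatesMat N gs = 1 := by
  induction gs with
  | nil => simp [gatesMat]
  | cons g gs ih =>
    rw [gatesMat, Matrix.conjTranspose_mul, Matrix.mul_assoc, ← Matrix.mul_assoc _ _ (g.mat N), ih,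
      Matrix.one_mul, Gate.mat_unitary]

end

noncomputable section

/-! ### Classical circuits -/

namespace Gate

/-- The action of a classical gate on the values of the wires. -/
def act : Gate → (ℕ → Bool) → ℕ → Bool
  | flip i, x => Function.update x i (!(x i))
  | cnot i j, x => if i ≠ j then Function.update x j (xor (x j) (x i)) else x
  | ccnot i j k, x =>
      if i ≠ j ∧ i ≠ k ∧ j ≠ k then Function.update x k (xor (x k) (x i && x j)) else x
  | _, x => x

/-- Gates that permute the computational basis. -/
def IsClassical : Gate → Prop
  | flip _ => True
  | cnot _ _ => True
  | ccnot _ _ _ => True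
  | _ => False

theorem act_act (g : Gate) (x : ℕ → Bool) : g.act (g.act x) = x := by
  cases g <;> simp only [act]
  case flip i => simp
  case cnot i j =>
    by_cases h : i = j
    · simp [h]
    · simp [h]
  case ccnot i j k =>
    by_cases h : i ≠ j ∧ i ≠ k ∧ j ≠ k
    · simp only [h, ne_eq, not_false_eq_true, and_self, ite_true, Function.update_self,
        Function.update_of_ne h.2.1, Function.update_of_ne h.2.2, Function.update_idem]
      simp
    · simp only [h, ite_false]

end Gate

/-- The action of a classical circuit. -/
def actAll (gs : List Gate) (x : ℕ → Bool) : ℕ → Bool := gs.foldl (fun x g => g.act x) x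

@[simp] theorem actAll_nil (x : ℕ → Bool) : actAll [] x = x := rfl

@[simp] theorem actAll_cons (g : Gate) (gs : List Gate) (x : ℕ → Bool) :
    actAll (g :: gs) x = actAll gs (g.act x) := rfl

theorem actAll_append (l l' : List Gate) (x : ℕ → Bool) :
    actAll (l ++ l') x = actAll l' (actAll l x) := List.foldl_append

theorem actAll_injective (gs : List Gate) : Function.Injective (actAll gs) := by
  induction gs with
  | nil => exact fun _ _ h => h
  | cons g gs ih =>
    intro x y h
    have := congrArg g.act (ih h)
    rwa [Gate.act_act, Gate.act_act] at this

/-- Wires that do not exist are read as `false`. -/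
def extendBits {N : ℕ} (y : Bits N) : ℕ → Bool := fun i => if h : i < N then y ⟨i, h⟩ else false

/-- The first `N` wires. -/
def restrictBits (N : ℕ) (x : ℕ → Bool) : Bits N := fun i => x i

@[simp] theorem restrict_extend {N : ℕ} (y : Bits N) : restrictBits N (extendBits y) = y := by
  funext i; simp [restrictBits, extendBits]

theorem extend_restrict {N : ℕ} {x : ℕ → Bool} (h : ∀ i, N ≤ i → x i = false) :
    extendBits (restrictBits N x) = x := by
  funext i
  by_cases hi : i < N
  · simp [restrictBits, extendBits, hi]
  · simp [extendBits, hi, h i (by omega)]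

theorem extendBits_of_le {N : ℕ} (y : Bits N) {i : ℕ} (h : N ≤ i) : extendBits y i = false := by
  simp [extendBits, h]

theorem Gate.act_of_le {N : ℕ} {g : Gate} (hg : g.fits N = true) {x : ℕ → Bool} {i : ℕ}
    (hi : N ≤ i) : g.act x i = x i := by
  rw [fits_iff] at hg
  cases g <;> simp only [quad] at hg <;> simp only [act]
  case flip j => rw [Function.update_of_ne (by omega)]
  case cnot j k => split_ifs; · rw [Function.update_of_ne (by omega)]
                   · rfl
  case ccnot j k l => split_ifs; · rw [Function.update_of_ne (by omega)]
                      · rfl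

theorem actAll_of_le {N : ℕ} {gs : List Gate} (hg : ∀ g ∈ gs, Gate.fits N g = true) {i : ℕ}
    (hi : N ≤ i) : ∀ x : ℕ → Bool, actAll gs x i = x i := by
  induction gs with
  | nil => exact fun _ => rfl
  | cons g gs ih =>
    intro x
    rw [actAll_cons, ih fun g' h' => hg g' (by simp [h']), Gate.act_of_le (hg g (by simp)) hi]

theorem Gate.mat_classical {N : ℕ} {g : Gate} (hc : g.IsClassical) (hg : g.fits N = true) :
    g.mat N = basisMap fun y => restrictBits N (g.act (extendBits y)) := by
  rw [fits_iff] at hg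
  have key : ∀ (y : Bits N) (i : ℕ) (hi : i < N) (b : Bool),
      restrictBits N (Function.update (extendBits y) i b) = Function.update y ⟨i, hi⟩ b := by
    intro y i hi b
    funext l
    by_cases hl : (l : ℕ) = i
    · subst hl; simp [restrictBits]
    · rw [restrictBits, Function.update_of_ne hl, Function.update_of_ne (by
        intro h; exact hl (congrArg Fin.val h))]
      simp [extendBits]
  cases g <;> simp only [quad] at hg <;> simp only [IsClassical] at hc <;> simp only [act, mat]
  case flip i =>
    rw [dif_pos hg.1]
    congr 1
    funext y
    rw [key y i hg.1]
    simp [extendBits, hg.1]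
  case cnot i j =>
    by_cases h : i = j
    · rw [dif_neg (by omega)]
      simp only [h, ne_eq, not_true_eq_false, ite_false, restrict_extend]
      exact basisMap_id.symm
    · rw [dif_pos (by omega)]
      congr 1
      funext y
      rw [if_pos h, key y j hg.2.1]
      simp [extendBits, hg.1, hg.2.1]
  case ccnot i j k =>
    by_cases h : i ≠ j ∧ i ≠ k ∧ j ≠ k
    · rw [dif_pos (by omega)]
      congr 1
      funext y
      rw [if_pos h, key y k hg.2.2]
      simp [extendBits, hg.1, hg.2.1, hg.2.2]
    · rw [dif_neg (by omega)]
      simp only [if_neg h, restrict_extend]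
      exact basisMap_id.symm

theorem gatesMat_classical {N : ℕ} {gs : List Gate}
    (hg : ∀ g ∈ gs, g.IsClassical ∧ g.fits N = true) :
    gatesMat N gs = basisMap fun y => restrictBits N (actAll gs (extendBits y)) := by
  induction gs with
  | nil =>
    simp only [gatesMat, actAll_nil, restrict_extend]
    exact basisMap_id.symm
  | cons g gs ih =>
    have h1 := hg g (by simp)
    rw [gatesMat, ih fun g' h' => hg g' (by simp [h']), Gate.mat_classical h1.1 h1.2, basisMap_mul]
    congr 1
    funext y
    simp only [Function.comp, actAll_cons]
    rw [extend_restrict]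
    intro i hi
    rw [Gate.act_of_le h1.2 hi, extendBits_of_le y hi]

theorem classical_injective {N : ℕ} {gs : List Gate} (hg : ∀ g ∈ gs, Gate.fits N g = true) :
    Function.Injective fun y : Bits N => restrictBits N (actAll gs (extendBits y)) := by
  intro y y' h
  have h1 : ∀ y : Bits N,
      extendBits (restrictBits N (actAll gs (extendBits y))) = actAll gs (extendBits y) := by
    intro y
    refine extend_restrict fun i hi => ?_
    rw [actAll_of_le hg hi, extendBits_of_le y hi]
  have h2 := congrArg extendBits h
  simp only [h1] at h2
  have h3 := congrArg (restrictBits N) (actAll_injective gs h2)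
  simpa using h3

theorem basisMap_mulVec {N : ℕ} {f : Bits N → Bits N} (hf : Function.Injective f) (ψ : Ket N)
    (y : Bits N) : (basisMap f *ᵥ ψ) (f y) = ψ y := by
  simp only [Matrix.mulVec, dotProduct, basisMap, hf.eq_iff, ite_mul, one_mul, zero_mul]
  simp

theorem ofFn_eq_map_range {N : ℕ} (y : Bits N) : List.ofFn y = (List.range N).map (extendBits y) := by
  refine List.ext_getElem (by simp) fun i h1 h2 => ?_
  have : i < N := by simpa using h1
  simp [extendBits, this]

theorem ofFn_restrict (N : ℕ) (x : ℕ → Bool) :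
    List.ofFn (restrictBits N x) = (List.range N).map x := by
  refine List.ext_getElem (by simp) fun i h1 h2 => ?_
  simp [restrictBits]

theorem take_map_range (k N : ℕ) (x : ℕ → Bool) :
    ((List.range N).map x).take k = (List.range (min k N)).map x := by
  rw [← List.map_take, List.take_range]

/-! ### Pure states -/

/-- `|ψ⟩ ⊗ |0…0⟩`. -/
def addAncKet {m : ℕ} (a : ℕ) (ψ : Ket m) : Ket (m + a) :=
  fun x => if ∀ j : Fin a, x (Fin.natAdd m j) = false then ψ (fun i => x (Fin.castAdd a i)) else 0

theorem addAncillas_pureState {m : ℕ} (a : ℕ) (ψ : Ket m) :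
    addAncillas a (pureState ψ) = pureState (addAncKet a ψ) := by
  ext x y
  simp only [addAncillas, pureState, Matrix.vecMulVec_apply, addAncKet, Pi.star_apply]
  by_cases h1 : ∀ j : Fin a, x (Fin.natAdd m j) = false <;>
    by_cases h2 : ∀ j : Fin a, y (Fin.natAdd m j) = false <;> simp [h1, h2]

theorem mul_pureState_mul {n : ℕ} (U : QOp n) (ψ : Ket n) :
    U * pureState ψ * Uᴴ = pureState (U *ᵥ ψ) := by
  simp only [pureState]
  rw [Matrix.mul_vecMulVec, Matrix.vecMulVec_mul, Matrix.star_mulVec]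

theorem pureState_re {n : ℕ} (ψ : Ket n) (x : Bits n) : (pureState ψ x x).re = ‖ψ x‖ ^ 2 := by
  rw [pureState, Matrix.vecMulVec_apply, Pi.star_apply, Complex.star_def, Complex.mul_conj,
    Complex.normSq_eq_norm_sq]
  exact Complex.ofReal_re _

/-- The final state of a circuit on a pure input. -/
def QCircuit.ket (C : QCircuit) {m : ℕ} (ψ : Ket m) : Ket (m + C.anc) :=
  gatesMat (m + C.anc) C.gates *ᵥ addAncKet C.anc ψ

theorem QCircuit.final_pureState (C : QCircuit) {m : ℕ} (ψ : Ket m) :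
    C.final (pureState ψ) = pureState (C.ket ψ) := by
  rw [QCircuit.final, addAncillas_pureState, mul_pureState_mul]
  rfl

/-- The ket of no qubits. -/
def noKet : Ket 0 := fun _ => 1

theorem noInput_eq : noInput = pureState noKet := by
  ext x y
  rw [Subsingleton.elim x y]
  simp [noInput, pureState, noKet, Matrix.vecMulVec_apply]

theorem QCircuit.expect_pureState (C : QCircuit) {m : ℕ} (ψ : Ket m) (f : List Bool → ℝ) :
    C.expect (pureState ψ) f = ∑ x, ‖C.ket ψ x‖ ^ 2 * f ((List.ofFn x).take C.out) := by
  simp only [QCircuit.expect, QCircuit.final_pureState, pureState_re]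

/-- A classical circuit permutes the basis states, so reindexing the sum by that permutation turns
it into a function applied to the measurement result of the earlier part. This is the principle of
deferred measurement used for the verification and for the reduction. -/
theorem QCircuit.expect_classical (C : QCircuit) {m : ℕ} (ψ : Ket m) (f : List Bool → ℝ)
    {gs gs' : List Gate} (hC : C.gates = gs ++ gs')
    (hg : ∀ g ∈ gs', g.IsClassical ∧ g.fits (m + C.anc) = true) :
    C.expect (pureState ψ) f =
      ∑ x, ‖(gatesMat (m + C.anc) gs *ᵥ addAncKet C.anc ψ) x‖ ^ 2 *
        f ((List.range (min C.out (m + C.anc))).map (actAll gs' (extendBits x))) := by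
  have hinj := classical_injective fun g h => (hg g h).2
  rw [QCircuit.expect_pureState,
    ← (Equiv.ofBijective _ (Finite.injective_iff_bijective.1 hinj)).sum_comp]
  refine Finset.sum_congr rfl fun x _ => ?_
  rw [Equiv.ofBijective_apply, QCircuit.ket, hC, gatesMat_append, ← Matrix.mulVec_mulVec,
    gatesMat_classical hg, basisMap_mulVec hinj, ofFn_restrict, take_map_range]

theorem braket_self {n : ℕ} (ψ : Ket n) : braket ψ ψ = ((∑ x, ‖ψ x‖ ^ 2 : ℝ) : ℂ) := by
  simp only [braket, dotProduct, Pi.star_apply, Complex.star_def]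
  push_cast
  exact Finset.sum_congr rfl fun x _ => by rw [mul_comm, Complex.mul_conj, Complex.normSq_eq_norm_sq]; push_cast; rfl

theorem braket_mulVec {n : ℕ} (U : QOp n) (φ ψ : Ket n) :
    braket φ (U *ᵥ ψ) = braket (Uᴴ *ᵥ φ) ψ := by
  simp only [braket]
  rw [Matrix.star_mulVec, Matrix.conjTranspose_conjTranspose, Matrix.dotProduct_mulVec]

theorem braket_gatesMat {n : ℕ} (gs : List Gate) (ψ : Ket n) :
    braket (gatesMat n gs *ᵥ ψ) (gatesMat n gs *ᵥ ψ) = braket ψ ψ := by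
  rw [braket_mulVec, Matrix.mulVec_mulVec, gatesMat_unitary, Matrix.one_mulVec]

theorem addAncKet_norm {m : ℕ} (a : ℕ) (ψ : Ket m) :
    braket (addAncKet a ψ) (addAncKet a ψ) = braket ψ ψ := by
  rw [braket_self, braket_self, sum_split (rfl : m + a = m + a)]
  congr 1
  refine Finset.sum_congr rfl fun u _ => ?_
  rw [Finset.sum_eq_single fun _ => false]
  · simp only [addAncKet]
    rw [if_pos]
    · congr 3
      funext i
      simp [joinBits]
    · intro j; simp [joinBits]
  · intro v _ hv
    rw [addAncKet, if_neg]
    · simp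
    · intro H
      refine hv (funext fun j => ?_)
      have := H j
      simpa [joinBits] using this
  · simp

/-- The outcome probabilities sum to 1 because ancillas and gates preserve the norm. -/
theorem QCircuit.expect_const (C : QCircuit) {m : ℕ} {ψ : Ket m} (hψ : braket ψ ψ = 1) (r : ℝ) :
    C.expect (pureState ψ) (fun _ => r) = r := by
  rw [QCircuit.expect_pureState, ← Finset.sum_mul]
  have h1 : braket (C.ket ψ) (C.ket ψ) = 1 := by
    rw [QCircuit.ket, braket_gatesMat, addAncKet_norm, hψ]
  rw [braket_self] at h1
  rw [Complex.ofReal_eq_one.1 h1, one_mul]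

end

noncomputable section

/-! ### Polynomial-time operations on circuits -/

namespace StackMachine

open Function Polynomial Code

section

variable {α β : Type} [Code α] [Code β]

instance : Code Gate := ⟨fun g => enc g.quad⟩
instance : Code QCircuit := ⟨QCircuit.encode⟩

@[fun_prop] theorem PT.had {i : α → ℕ} (hi : PT i) : PT (fun a => Gate.had (i a)) :=
  PT.recode (f := fun a => (1, i a, 0, 0)) (by fun_prop) fun _ => rfl

@[fun_prop] theorem PT.tee {i : α → ℕ} (hi : PT i) : PT (fun a => Gate.tee (i a)) :=
  PT.recode (f := fun a => (2, i a, 0, 0)) (by fun_prop) fun _ => rfl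

@[fun_prop] theorem PT.teeInv {i : α → ℕ} (hi : PT i) : PT (fun a => Gate.teeInv (i a)) :=
  PT.recode (f := fun a => (3, i a, 0, 0)) (by fun_prop) fun _ => rfl

@[fun_prop] theorem PT.flip {i : α → ℕ} (hi : PT i) : PT (fun a => Gate.flip (i a)) :=
  PT.recode (f := fun a => (4, i a, 0, 0)) (by fun_prop) fun _ => rfl

@[fun_prop] theorem PT.cnot {i j : α → ℕ} (hi : PT i) (hj : PT j) :
    PT (fun a => Gate.cnot (i a) (j a)) :=
  PT.recode (f := fun a => (5, i a, j a, 0)) (by fun_prop) fun _ => rfl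

@[fun_prop] theorem PT.ccnot {i j k : α → ℕ} (hi : PT i) (hj : PT j) (hk : PT k) :
    PT (fun a => Gate.ccnot (i a) (j a) (k a)) :=
  PT.recode (f := fun a => (6, i a, j a, k a)) (by fun_prop) fun _ => rfl

@[fun_prop] theorem PT.quad {g : α → Gate} (hg : PT g) : PT (fun a => (g a).quad) :=
  hg.recode fun _ => rfl

end

end StackMachine

/-- The gate with a given operation code and wires. -/
def Gate.ofQuad (q : ℕ × ℕ × ℕ × ℕ) : Gate :=
  if decide (q.1 = 1) then had q.2.1 else
  if decide (q.1 = 2) then tee q.2.1 else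
  if decide (q.1 = 3) then teeInv q.2.1 else
  if decide (q.1 = 4) then flip q.2.1 else
  if decide (q.1 = 5) then cnot q.2.1 q.2.2.1 else ccnot q.2.1 q.2.2.1 q.2.2.2

theorem decNatsFrom_replicate (a c : ℕ) (w : List Bool) :
    decNatsFrom c (List.replicate a true ++ false :: w) = (c + a) :: decNatsFrom 0 w := by
  induction a generalizing c with
  | zero => simp [decNatsFrom]
  | succ a ih => simp [List.replicate_succ, decNatsFrom, ih]; omega

theorem encNats_cons (a : ℕ) (l : List ℕ) :
    encNats (a :: l) = List.replicate a true ++ false :: encNats l := by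
  simp [encNats]

theorem encNats_append (l l' : List ℕ) : encNats (l ++ l') = encNats l ++ encNats l' := by
  simp [encNats]

theorem decNatsFrom_encNats_append (l : List ℕ) (w : List Bool) :
    decNatsFrom 0 (encNats l ++ w) = l ++ decNatsFrom 0 w := by
  induction l with
  | nil => simp [encNats]
  | cons a l ih => simp [encNats_cons, decNatsFrom_replicate, ih]

theorem decNatsFrom_encNats (l : List ℕ) : decNatsFrom 0 (encNats l) = l := by
  simpa [decNatsFrom] using decNatsFrom_encNats_append l []

theorem decGates_toNats_append (g : Gate) (l : List ℕ) :
    decGates (g.toNats ++ l) = g :: decGates l := by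
  cases g <;> simp [Gate.toNats, decGates]

theorem decGates_flatMap (gs : List Gate) : decGates (gs.flatMap Gate.toNats) = gs := by
  induction gs with
  | nil => simp [decGates]
  | cons g gs ih => rw [List.flatMap_cons, decGates_toNats_append, ih]

theorem decGates_short {l : List ℕ} (h : l.length < 4) : decGates l = [] := by
  match l, h with
  | [], _ => simp [decGates]
  | [a], _ => simp [decGates]
  | [a, b], _ => simp [decGates]
  | [a, b, c], _ => simp [decGates]
  | a :: b :: c :: d :: l, h => simp at h; omega

/-- The gate denoted by four numbers. -/
def quadGates (q : ℕ × ℕ × ℕ × ℕ) : List Gate :=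
  if decide (1 ≤ q.1) && decide (q.1 ≤ 6) then [Gate.ofQuad q] else []

theorem decGates_cons (a b c d : ℕ) (l : List ℕ) :
    decGates (a :: b :: c :: d :: l) = quadGates (a, b, c, d) ++ decGates l := by
  rcases Nat.lt_or_ge a 7 with h | h
  · interval_cases a <;> simp [decGates, quadGates, Gate.ofQuad]
  · rw [decGates] <;> first | omega | simp [quadGates]
    omega

/-- The gate denoted by the first four numbers of a list. -/
def headGates (l : List ℕ) : List Gate :=
  if decide (4 ≤ l.length) then
    quadGates (l.getD 0 0, l.getD 1 0, l.getD 2 0, l.getD 3 0) else []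

/-- Indexing groups by `4 * i` replaces the recursion by a `flatMap` over a range, to which the
closure rules of `PT` apply. Surplus indices contribute nothing, as fewer than four numbers denote
no gate. -/
theorem decGates_eq_flatMap (K : ℕ) (l : List ℕ) (h : l.length ≤ K) :
    decGates l = (List.range K).flatMap fun i => headGates (l.drop (4 * i)) := by
  induction K generalizing l with
  | zero => rw [decGates_short (by omega)]; simp
  | succ K ih =>
    match l with
    | a :: b :: c :: d :: l =>
      rw [decGates_cons, List.range_succ_eq_map, List.flatMap_cons, List.flatMap_map,
        ih l (by simp at h; omega)]
      rfl
    | [] => simp [decGates_short, headGates]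
    | [a] =>
      rw [decGates_short (by simp), eq_comm, List.flatMap_eq_nil_iff]
      intro i _
      rw [headGates, if_neg (by simp; omega)]
    | [a, b] =>
      rw [decGates_short (by simp), eq_comm, List.flatMap_eq_nil_iff]
      intro i _
      rw [headGates, if_neg (by simp; omega)]
    | [a, b, c] =>
      rw [decGates_short (by simp), eq_comm, List.flatMap_eq_nil_iff]
      intro i _
      rw [headGates, if_neg (by simp; omega)]

namespace StackMachine

open Function Polynomial Code

section

variable {α β : Type} [Code α] [Code β]

@[fun_prop] theorem PT.ofQuad {q : α → ℕ × ℕ × ℕ × ℕ} (hq : PT q) :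
    PT (fun a => Gate.ofQuad (q a)) := by
  unfold Gate.ofQuad
  fun_prop

@[fun_prop] theorem PT.quadGates {q : α → ℕ × ℕ × ℕ × ℕ} (hq : PT q) :
    PT (fun a => _root_.quadGates (q a)) := by
  unfold _root_.quadGates
  fun_prop

@[fun_prop] theorem PT.headGates {l : α → List ℕ} (hl : PT l) :
    PT (fun a => _root_.headGates (l a)) := by
  unfold _root_.headGates
  fun_prop

@[fun_prop] theorem PT.decGates {l : α → List ℕ} (hl : PT l) :
    PT (fun a => _root_.decGates (l a)) := by
  refine PT.congr (f := fun a => (List.range (l a).length).flatMap fun i =>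
    _root_.headGates ((l a).drop (4 * i))) (by fun_prop) fun a => ?_
  exact decGates_eq_flatMap _ _ le_rfl

@[fun_prop] theorem PT.decNats {w : α → List Bool} (hw : PT w) :
    PT (fun a => decNatsFrom 0 (w a)) := by
  -- The state holds the counter of the current number and the finished numbers. Each symbol
  -- increases its size by at most 2, which bounds the fold linearly.
  let step (s : ℕ × List ℕ) (b : Bool) : ℕ × List ℕ :=
    if b = true then (s.1 + 1, s.2) else (0, s.2 ++ [s.1])
  have key : ∀ (w : List Bool) (s : ℕ × List ℕ),
      (w.foldl step s).2 = s.2 ++ decNatsFrom s.1 w := by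
    intro w
    induction w with
    | nil => simp [decNatsFrom]
    | cons b w ih => intro s; cases b <;> simp [ih, step, decNatsFrom]
  have hsz : ∀ (w : List Bool) (s : ℕ × List ℕ),
      size (w.foldl step s) ≤ size s + 2 * w.length := by
    intro w
    induction w with
    | nil => simp
    | cons b w ih =>
      intro s
      refine (ih _).trans ?_
      cases b <;> simp [step] <;> omega
  obtain ⟨q, hq⟩ := hw.size_le
  refine (PT.snd (PT.foldl (i := fun _ => (0, [])) (f := fun _ => step) hw (by fun_prop)
    (by fun_prop) (1 + 2 * q) ?_)).congr fun a => by rw [key]; rfl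
  intro a l' hl'
  refine (hsz _ _).trans ?_
  have h1 := (length_le_size l').trans ((size_le_of_prefix hl').trans (hq a))
  simp
  omega

theorem toNats_eq (g : Gate) : g.toNats = [g.quad.1, g.quad.2.1, g.quad.2.2.1, g.quad.2.2.2] := by
  cases g <;> rfl

@[fun_prop] theorem PT.toNats {g : α → Gate} (hg : PT g) : PT (fun a => (g a).toNats) :=
  PT.congr (f := fun a => [(g a).quad.1, (g a).quad.2.1, (g a).quad.2.2.1, (g a).quad.2.2.2])
    (by fun_prop) fun a => toNats_eq _

@[fun_prop] theorem PT.shift {s : α → ℕ} {g : α → Gate} (hs : PT s) (hg : PT g) :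
    PT (fun a => (g a).shift (s a)) :=
  PT.congr (f := fun a => Gate.ofQuad ((g a).quad.1, s a + (g a).quad.2.1,
    s a + (g a).quad.2.2.1, s a + (g a).quad.2.2.2)) (by fun_prop) fun a => by
      cases g a <;> simp [Gate.ofQuad, Gate.quad, Gate.shift]

@[fun_prop] theorem PT.inv {g : α → Gate} (hg : PT g) : PT (fun a => (g a).inv) :=
  PT.congr (f := fun a => if decide ((g a).quad.1 = 2) then Gate.teeInv (g a).quad.2.1 else
    if decide ((g a).quad.1 = 3) then Gate.tee (g a).quad.2.1 else g a)
    (by fun_prop) fun a => by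
      cases g a <;> simp [Gate.quad, Gate.inv]

@[fun_prop] theorem PT.cleanGates {n : α → ℕ} {gs : α → List Gate} (hn : PT n) (hg : PT gs) :
    PT (fun a => _root_.cleanGates (n a) (gs a)) := by
  unfold _root_.cleanGates Gate.fits
  fun_prop

@[fun_prop] theorem PT.invGates {gs : α → List Gate} (hg : PT gs) :
    PT (fun a => _root_.invGates (gs a)) := by
  unfold _root_.invGates
  fun_prop

@[fun_prop] theorem PT.encNats {l : α → List ℕ} (hl : PT l) :
    PT (fun a => _root_.encNats (l a)) := by
  have := @PT.replicate
  unfold _root_.encNats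
  exact PT.flatMap hl (PT.append (PT.replicate (by fun_prop) (by fun_prop)) (by fun_prop))

/-- The numbers that describe a circuit. -/
theorem PT.circuitNats {C : α → QCircuit} (hC : PT C) :
    PT (fun a => (C a).anc :: (C a).out :: (C a).gates.flatMap Gate.toNats) := by
  have h : PT (fun a => StackMachine.toWord (C a).encode) := hC.recode fun _ => rfl
  exact (PT.decNats h.bits).congr fun a => (decNatsFrom_encNats _).symm

@[fun_prop] theorem PT.anc {C : α → QCircuit} (hC : PT C) : PT (fun a => (C a).anc) :=
  hC.circuitNats.headD (PT.const 0)

@[fun_prop] theorem PT.out {C : α → QCircuit} (hC : PT C) : PT (fun a => (C a).out) :=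
  hC.circuitNats.tail.headD (PT.const 0)

@[fun_prop] theorem PT.gates {C : α → QCircuit} (hC : PT C) : PT (fun a => (C a).gates) :=
  hC.circuitNats.tail.tail.decGates.congr fun _ => (decGates_flatMap _).symm

@[fun_prop] theorem PT.circuit {n m : α → ℕ} {gs : α → List Gate} (hn : PT n) (hm : PT m)
    (hg : PT gs) : PT (fun a => QCircuit.mk (n a) (m a) (gs a)) :=
  PT.recode (f := fun a => StackMachine.toWord
    (_root_.encNats (n a :: m a :: (gs a).flatMap Gate.toNats))) (PT.toWord (by fun_prop))
    fun _ => rfl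

end

/-! ### Classical inputs of algorithms -/

theorem encSec_eq : encSec = fun l : ℕ => enc l := by
  funext l
  induction l with
  | zero => rfl
  | succ l ih =>
    change true :: encSec l = _
    rw [ih]
    rfl

theorem isQPT_iff_pt {F : ℕ → QCircuit} : IsQPT encSec F ↔ PT F := by
  rw [IsQPT, encSec_eq]
  exact ⟨fun ⟨h⟩ => Trans.of_polyTime h, fun h => Trans.polyTime h⟩

theorem pt_of_polyTime {f : ℕ → ℕ} (h : Nonempty (Turing.TM2ComputableInPolyTime encSec encSec f)) :
    PT f := by
  rw [encSec_eq] at h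
  exact Trans.of_polyTime h.some

/-- The word `1^l 0 k` is self-delimiting: its first unary number is `l`, and deleting `l + 1`
symbols leaves `k`. So the pair is recovered in polynomial time from the raw input. -/
theorem isQPT_of_pt {F : ℕ × List Bool → QCircuit}
    (h : PT fun p : ℕ × List Bool => F p) : IsQPT encSecKey F := by
  have h1 : PT fun w : Word => F ((decNatsFrom 0 (bits w)).headD 0,
      (bits w).drop ((decNatsFrom 0 (bits w)).headD 0 + 1)) :=
    h.comp (PT.prodMk (PT.headD (PT.decNats (PT.bits PT.id)) (PT.const 0))
      (PT.drop (PT.succ (PT.headD (PT.decNats (PT.bits PT.id)) (PT.const 0))) (PT.bits PT.id)))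
  refine Trans.polyTime ((h1.reindex fun p => toWord (encSecKey p)).of_eq ?_)
  rintro ⟨l, k⟩
  have h2 : bits (toWord (encSecKey (l, k))) = List.replicate l true ++ false :: k := by
    rw [bits_toWord, encSecKey, encSec_eq]
    rfl
  have h3 : (decNatsFrom 0 (List.replicate l true ++ false :: k)).headD 0 = l := by
    rw [decNatsFrom_replicate]
    simp
  beta_reduce
  have h4 : (List.replicate l true ++ false :: k).drop (l + 1) = k := by
    rw [List.drop_append]; simp
  rw [h2, h3, h4]
  rfl

end StackMachine
end

noncomputable section

/-! ### Building blocks of classical circuits -/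

/-- A classical circuit on `N` wires. -/
def ClassicalOn (N : ℕ) (gs : List Gate) : Prop := ∀ g ∈ gs, g.IsClassical ∧ g.fits N = true

namespace ClassicalOn

variable {N : ℕ} {gs gs' : List Gate}

theorem nil : ClassicalOn N [] := by simp [ClassicalOn]

theorem cons {g : Gate} (hg : g.IsClassical) (h : g.fits N = true) (h' : ClassicalOn N gs) :
    ClassicalOn N (g :: gs) := by
  intro g' hg'
  rcases List.mem_cons.1 hg' with rfl | hg'
  · exact ⟨hg, h⟩
  · exact h' _ hg'

theorem append (h : ClassicalOn N gs) (h' : ClassicalOn N gs') : ClassicalOn N (gs ++ gs') := by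
  intro g hg
  rcases List.mem_append.1 hg with hg | hg
  · exact h _ hg
  · exact h' _ hg

theorem flatMap {α : Type} {l : List α} {f : α → List Gate} (h : ∀ a ∈ l, ClassicalOn N (f a)) :
    ClassicalOn N (l.flatMap f) := by
  intro g hg
  obtain ⟨a, ha, hg⟩ := List.mem_flatMap.1 hg
  exact h a ha g hg

theorem flip {i : ℕ} (hi : i < N) (h : ClassicalOn N gs) : ClassicalOn N (.flip i :: gs) :=
  cons trivial (by rw [Gate.fits_iff]; simp only [Gate.quad]; omega) h

theorem cnot {i j : ℕ} (hi : i < N) (hj : j < N) (h : ClassicalOn N gs) :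
    ClassicalOn N (.cnot i j :: gs) :=
  cons trivial (by rw [Gate.fits_iff]; simp only [Gate.quad]; omega) h

theorem ccnot {i j k : ℕ} (hi : i < N) (hj : j < N) (hk : k < N) (h : ClassicalOn N gs) :
    ClassicalOn N (.ccnot i j k :: gs) :=
  cons trivial (by rw [Gate.fits_iff]; simp only [Gate.quad]; omega) h

end ClassicalOn

/-- The value of a literal: a wire and the value that it should have. -/
def litVal (x : ℕ → Bool) (p : ℕ × Bool) : Bool := x p.1 == p.2

/-- Adds the conjunction of wire `t` and a literal to wire `t + 1`. -/
def andGates (t : ℕ) (p : ℕ × Bool) : List Gate :=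
  if p.2 = true then [.ccnot t p.1 (t + 1)] else [.flip p.1, .ccnot t p.1 (t + 1), .flip p.1]

/-- A literal that asks for `false` is handled by flipping its wire before the Toffoli gate and
restoring it afterwards. -/
theorem actAll_andGates {t : ℕ} {p : ℕ × Bool} (hp : p.1 < t) (x : ℕ → Bool) :
    actAll (andGates t p) x =
      Function.update x (t + 1) (xor (x (t + 1)) (x t && litVal x p)) := by
  obtain ⟨w, s⟩ := p
  simp only at hp
  funext i
  have h1 : t ≠ w := by omega
  have h2 : w ≠ t + 1 := by omega
  rcases s with _ | _
  · by_cases hi : i = t + 1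
    · subst hi
      simp [andGates, Gate.act, litVal, h1, h2, h2.symm]
    · by_cases hw : i = w
      · subst hw
        simp [andGates, Gate.act, litVal, Function.update_apply, h1, h2]
      · simp [andGates, Gate.act, litVal, Function.update_apply, h1, h2, hi, hw]
  · simp [andGates, Gate.act, litVal, h1, h2]

theorem classicalOn_andGates {N t : ℕ} {p : ℕ × Bool} (hp : p.1 < t) (ht : t + 1 < N) :
    ClassicalOn N (andGates t p) := by
  unfold andGates
  split_ifs
  · exact .ccnot (by omega) (by omega) (by omega) .nil
  · exact .flip (by omega) (.ccnot (by omega) (by omega) (by omega) (.flip (by omega) .nil))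

/-- The conjunction of literals is computed on wire `t + ls.length`, using the wires
from `t` on. -/
def conjGates (ls : List (ℕ × Bool)) (t : ℕ) : List Gate :=
  .flip t :: ls.zipIdx.flatMap fun q => andGates (t + q.2) q.1

theorem zipIdx_cons_flatMap {α β : Type} (a : α) (l : List α) (t : ℕ) (f : ℕ → α → List β) :
    ((a :: l).zipIdx.flatMap fun q => f (t + q.2) q.1) =
      f t a ++ l.zipIdx.flatMap fun q => f (t + 1 + q.2) q.1 := by
  rw [List.zipIdx_cons, List.flatMap_cons, Nat.zero_add, List.zipIdx_eq_map_add, List.flatMap_map]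
  congr 1
  refine List.flatMap_congr fun q _ => ?_
  simp only
  congr 1
  omega

/-- Wire `t + i` holds the conjunction of the first `i` literals with the initial value of wire `t`,
and each Toffoli gate passes it on to the next clean wire. The wires of the literals lie below `t`
and keep their values. -/
theorem actAll_andGates_flatMap (ls : List (ℕ × Bool)) (t : ℕ) (x : ℕ → Bool)
    (hl : ∀ p ∈ ls, p.1 < t) (hx : ∀ i, t < i → x i = false) :
    let y := actAll (ls.zipIdx.flatMap fun q => andGates (t + q.2) q.1) x
    (∀ i ≤ t, i < t + ls.length → y i = x i) ∧ (∀ i, t + ls.length < i → y i = false) ∧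
      y (t + ls.length) = (x t && ls.all (litVal x)) := by
  induction ls generalizing t x with
  | nil => simpa using hx
  | cons p ls ih =>
    intro y
    have hp : p.1 < t := hl p (by simp)
    let x' := actAll (andGates t p) x
    have hx' : x' = Function.update x (t + 1) (x t && litVal x p) := by
      change actAll (andGates t p) x = _
      rw [actAll_andGates hp, hx (t + 1) (by omega), Bool.false_xor]
    have hy : y = actAll (ls.zipIdx.flatMap fun q => andGates (t + 1 + q.2) q.1) x' := by
      change actAll _ x = _
      rw [zipIdx_cons_flatMap p ls t andGates, actAll_append]
    have hlit : ∀ q ∈ ls, litVal x' q = litVal x q := by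
      intro q hq
      have := hl q (by simp [hq])
      rw [litVal, hx', Function.update_of_ne (by omega)]
      rfl
    obtain ⟨h1, h2, h3⟩ := ih (t + 1) x' (fun q hq => by have := hl q (by simp [hq]); omega)
      (fun i hi => by rw [hx', Function.update_of_ne (by omega), hx i (by omega)])
    rw [← hy] at h1 h2 h3
    refine ⟨fun i hi hi' => ?_, fun i hi => h2 i (by simp at hi; omega), ?_⟩
    · have : i < t + 1 + ls.length := by simp at hi'; omega
      rw [h1 i (by omega) this, hx', Function.update_of_ne (by omega)]
    · rw [List.length_cons, show t + (ls.length + 1) = t + 1 + ls.length by omega, h3]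
      rw [hx', Function.update_self, ← hx', List.all_cons, ← Bool.and_assoc]
      congr 1
      rw [Bool.eq_iff_iff, List.all_eq_true, List.all_eq_true]
      exact forall₂_congr fun q hq => by rw [hlit q hq]

theorem actAll_conjGates (ls : List (ℕ × Bool)) (t : ℕ) (x : ℕ → Bool)
    (hl : ∀ p ∈ ls, p.1 < t) (hx : ∀ i, t ≤ i → x i = false) :
    (∀ i < t, actAll (conjGates ls t) x i = x i) ∧
      (∀ i, t + ls.length < i → actAll (conjGates ls t) x i = false) ∧
      actAll (conjGates ls t) x (t + ls.length) = ls.all (litVal x) := by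
  have hx0 : x t = false := hx t le_rfl
  obtain ⟨h1, h2, h3⟩ := actAll_andGates_flatMap ls t (Function.update x t true) hl
    (fun i hi => by rw [Function.update_of_ne (by omega), hx i (by omega)])
  have hy : actAll (conjGates ls t) x =
      actAll (ls.zipIdx.flatMap fun q => andGates (t + q.2) q.1) (Function.update x t true) := by
    rw [conjGates, actAll_cons, Gate.act, hx0]
    rfl
  rw [hy]
  refine ⟨fun i hi => ?_, h2, ?_⟩
  · rw [h1 i (by omega) (by omega), Function.update_of_ne (by omega)]
  · rw [h3, Function.update_self, Bool.true_and, Bool.eq_iff_iff, List.all_eq_true,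
      List.all_eq_true]
    refine forall₂_congr fun q hq => ?_
    have := hl q hq
    rw [litVal, litVal, Function.update_of_ne (by omega)]

theorem classicalOn_conjGates {N t : ℕ} {ls : List (ℕ × Bool)} (hl : ∀ p ∈ ls, p.1 < t)
    (ht : t + ls.length < N) : ClassicalOn N (conjGates ls t) := by
  refine .flip (by omega) (.flatMap fun q hq => ?_)
  have h1 := hl q.1 (List.fst_mem_of_mem_zipIdx hq)
  have h2 := List.snd_lt_of_mem_zipIdx hq
  exact classicalOn_andGates (by omega) (by omega)

/-- Moves the value of wire `r` to wire `d`. -/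
def moveGates (r d : ℕ) : List Gate := [.cnot d r, .cnot r d]

/-- Two controlled NOTs suffice instead of a swap because the source may be left spoiled. If both
wires coincide, the gates are the identity. -/
theorem actAll_moveGates (r d : ℕ) (x : ℕ → Bool) :
    actAll (moveGates r d) x d = x r ∧ ∀ i, i ≠ r → i ≠ d → actAll (moveGates r d) x i = x i := by
  by_cases h : r = d
  · subst h; simp [moveGates, Gate.act]
  · refine ⟨?_, fun i h1 h2 => ?_⟩
    · simp only [moveGates, actAll_cons, actAll_nil, Gate.act, h, Ne.symm h, ne_eq,
        not_false_eq_true, if_true, Function.update_self, Function.update_of_ne]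
      cases x d <;> cases x r <;> rfl
    · simp [moveGates, Gate.act, h, Ne.symm h, h1, h2]

theorem classicalOn_moveGates {N r d : ℕ} (hr : r < N) (hd : d < N) :
    ClassicalOn N (moveGates r d) := .cnot hd hr (.cnot hr hd .nil)

/-- The conjunctions of several lists of literals, in blocks of length `T` from wire `b` on. -/
def conjsGates (L : List (List (ℕ × Bool))) (T b : ℕ) : List Gate :=
  L.zipIdx.flatMap fun q => conjGates q.1 (b + q.2 * T)

/-- Each conjunction stays within its own block, so every block is still clean when its turn comes
and earlier results are never overwritten. -/
theorem actAll_conjsGates (L : List (List (ℕ × Bool))) (T b : ℕ) (x : ℕ → Bool)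
    (hl : ∀ ls ∈ L, ls.length < T ∧ ∀ p ∈ ls, p.1 < b) (hx : ∀ i, b ≤ i → x i = false) :
    (∀ i < b, actAll (conjsGates L T b) x i = x i) ∧
      (∀ i, b + L.length * T ≤ i → actAll (conjsGates L T b) x i = false) ∧
      ∀ q ∈ L.zipIdx, actAll (conjsGates L T b) x (b + q.2 * T + q.1.length) =
        q.1.all (litVal x) := by
  induction L using List.reverseRecOn with
  | nil => simpa [conjsGates] using hx
  | append_singleton L ls ih =>
    obtain ⟨h1, h2, h3⟩ := ih fun l h => hl l (by simp [h])
    obtain ⟨hT, hls⟩ := hl ls (by simp)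
    set y := actAll (conjsGates L T b) x with hy
    obtain ⟨k1, k2, k3⟩ := actAll_conjGates ls (b + L.length * T) y
      (fun p hp => by have := hls p hp; omega) h2
    have hz : actAll (conjsGates (L ++ [ls]) T b) x =
        actAll (conjGates ls (b + L.length * T)) y := by
      rw [conjsGates, List.zipIdx_append, List.flatMap_append, actAll_append, hy, conjsGates]
      simp
    rw [hz]
    refine ⟨fun i hi => ?_, fun i hi => ?_, fun q hq => ?_⟩
    · rw [k1 i (by omega), h1 i hi]
    · refine k2 i ?_
      rw [List.length_append, List.length_singleton, Nat.add_mul] at hi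
      omega
    · rw [List.zipIdx_append, List.mem_append] at hq
      rcases hq with hq | hq
      · have hq2 := List.snd_lt_of_mem_zipIdx hq
        have hq1 := (hl q.1 (by simp [List.fst_mem_of_mem_zipIdx hq])).1
        rw [k1, h3 q hq]
        have : (q.2 + 1) * T ≤ L.length * T := Nat.mul_le_mul_right _ (by omega)
        rw [Nat.add_mul] at this
        omega
      · simp only [Nat.zero_add, List.zipIdx_cons, List.zipIdx_nil, List.mem_singleton] at hq
        subst hq
        rw [k3, Bool.eq_iff_iff, List.all_eq_true, List.all_eq_true]
        exact forall₂_congr fun p hp => by rw [litVal, litVal, h1 _ (hls p hp)]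

theorem classicalOn_conjsGates {N T b : ℕ} {L : List (List (ℕ × Bool))}
    (hl : ∀ ls ∈ L, ls.length < T ∧ ∀ p ∈ ls, p.1 < b) (hN : b + L.length * T ≤ N) :
    ClassicalOn N (conjsGates L T b) := by
  refine .flatMap fun q hq => ?_
  have h1 := hl q.1 (List.fst_mem_of_mem_zipIdx hq)
  have h2 := List.snd_lt_of_mem_zipIdx hq
  refine classicalOn_conjGates (fun p hp => by have := h1.2 p hp; omega) ?_
  have : (q.2 + 1) * T ≤ L.length * T := Nat.mul_le_mul_right _ (by omega)
  rw [Nat.add_mul] at this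
  omega

/-- A bit that depends on at most one wire: `(b, c, w)` stands for `b + c * x w`. -/
def affVal (x : ℕ → Bool) (o : Bool × Bool × ℕ) : Bool := xor o.1 (o.2.1 && x o.2.2)

/-- Adds a bit to wire `t`. -/
def affGates (t : ℕ) (o : Bool × Bool × ℕ) : List Gate :=
  (if o.1 = true then [.flip t] else []) ++ (if o.2.1 = true then [.cnot o.2.2 t] else [])

theorem actAll_affGates {t : ℕ} {o : Bool × Bool × ℕ} (ho : o.2.2 < t) (x : ℕ → Bool) :
    actAll (affGates t o) x = Function.update x t (xor (x t) (affVal x o)) := by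
  obtain ⟨b, c, w⟩ := o
  simp only at ho
  have h : w ≠ t := by omega
  cases b <;> cases c <;> simp [affGates, Gate.act, affVal, h]

/-- Writes bits on the wires from `F` on. -/
def writeGates (O : List (Bool × Bool × ℕ)) (F : ℕ) : List Gate :=
  O.zipIdx.flatMap fun q => affGates (F + q.2) q.1

theorem actAll_writeGates (O : List (Bool × Bool × ℕ)) (F : ℕ) (x : ℕ → Bool)
    (ho : ∀ o ∈ O, o.2.2 < F) (hx : ∀ i, F ≤ i → x i = false) :
    (∀ i < F, actAll (writeGates O F) x i = x i) ∧
      (∀ i, F + O.length ≤ i → actAll (writeGates O F) x i = false) ∧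
      (List.range O.length).map (fun r => actAll (writeGates O F) x (F + r)) =
        O.map (affVal x) := by
  induction O using List.reverseRecOn with
  | nil => simpa [writeGates] using hx
  | append_singleton O o ih =>
    obtain ⟨h1, h2, h3⟩ := ih fun o h => ho o (by simp [h])
    set y := actAll (writeGates O F) x with hy
    have ho' : o.2.2 < F := ho o (by simp)
    have hz : actAll (writeGates (O ++ [o]) F) x =
        Function.update y (F + O.length) (affVal x o) := by
      rw [writeGates, List.zipIdx_append, List.flatMap_append, actAll_append, ← writeGates, ← hy]
      simp only [Nat.zero_add, List.zipIdx_cons, List.zipIdx_nil, List.flatMap_cons,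
        List.flatMap_nil, List.append_nil]
      rw [actAll_affGates (by omega), h2 _ le_rfl, Bool.false_xor, affVal, affVal, h1 _ ho']
    rw [hz]
    refine ⟨fun i hi => ?_, fun i hi => ?_, ?_⟩
    · rw [Function.update_of_ne (by omega), h1 i hi]
    · rw [List.length_append, List.length_singleton] at hi
      rw [Function.update_of_ne (by omega), h2 i (by omega)]
    · rw [List.length_append, List.length_singleton, List.range_succ, List.map_append,
        List.map_append, ← h3]
      congr 1
      · refine List.map_congr_left fun r hr => ?_
        rw [Function.update_of_ne]
        have := List.mem_range.1 hr
        omega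
      · simp

theorem classicalOn_writeGates {N F : ℕ} {O : List (Bool × Bool × ℕ)} (ho : ∀ o ∈ O, o.2.2 < F)
    (hN : F + O.length ≤ N) : ClassicalOn N (writeGates O F) := by
  refine .flatMap fun q hq => ?_
  have h1 := ho q.1 (List.fst_mem_of_mem_zipIdx hq)
  have h2 := List.snd_lt_of_mem_zipIdx hq
  unfold affGates
  refine .append ?_ ?_
  · split_ifs
    · exact .flip (by omega) .nil
    · exact .nil
  · split_ifs
    · exact .cnot (by omega) (by omega) .nil
    · exact .nil

/-- Moves the wires `F, …, F + D - 1` to the front. -/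
def frontGates (D F : ℕ) : List Gate := (List.range D).flatMap fun r => moveGates (F + r) r

theorem actAll_frontGates {D F : ℕ} (h : D ≤ F) (x : ℕ → Bool) :
    ∀ r < D, actAll (frontGates D F) x r = x (F + r) := by
  -- The moves made so far touch only the wires below `d` and the sources `F, …, F + d - 1`. Since
  -- `d ≤ F`, the sources still to be moved are intact, and this is carried as the second half of
  -- the induction.
  suffices H : ∀ d ≤ F, (∀ r < d, actAll (frontGates d F) x r = x (F + r)) ∧
      ∀ i, F + d ≤ i → actAll (frontGates d F) x i = x i from (H D h).1
  intro d
  induction d with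
  | zero => simp [frontGates]
  | succ d ih =>
    intro hd
    obtain ⟨h1, h2⟩ := ih (by omega)
    have hz : actAll (frontGates (d + 1) F) x =
        actAll (moveGates (F + d) d) (actAll (frontGates d F) x) := by
      rw [frontGates, List.range_succ, List.flatMap_append, actAll_append, ← frontGates]
      simp
    obtain ⟨k1, k2⟩ := actAll_moveGates (F + d) d (actAll (frontGates d F) x)
    rw [hz]
    refine ⟨fun r hr => ?_, fun i hi => ?_⟩
    · rcases Nat.lt_succ_iff_lt_or_eq.1 hr with hr | rfl
      · rw [k2 r (by omega) (by omega), h1 r hr]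
      · rw [k1, h2 _ le_rfl]
    · rw [k2 i (by omega) (by omega), h2 i (by omega)]

theorem classicalOn_frontGates {N D F : ℕ} (hN : F + D ≤ N) : ClassicalOn N (frontGates D F) := by
  refine .flatMap fun r hr => ?_
  have := List.mem_range.1 hr
  exact classicalOn_moveGates (by omega) (by omega)

namespace StackMachine

section

variable {α : Type} [Code α]

@[fun_prop] theorem PT.conjGates {ls : α → List (ℕ × Bool)} {t : α → ℕ} (hl : PT ls) (ht : PT t) :
    PT (fun a => _root_.conjGates (ls a) (t a)) := by
  unfold _root_.conjGates andGates
  fun_prop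

@[fun_prop] theorem PT.moveGates {r d : α → ℕ} (hr : PT r) (hd : PT d) :
    PT (fun a => _root_.moveGates (r a) (d a)) := by
  unfold _root_.moveGates
  fun_prop

@[fun_prop] theorem PT.conjsGates {L : α → List (List (ℕ × Bool))} {T b : α → ℕ} (hL : PT L)
    (hT : PT T) (hb : PT b) : PT (fun a => _root_.conjsGates (L a) (T a) (b a)) := by
  unfold _root_.conjsGates
  fun_prop

@[fun_prop] theorem PT.writeGates {O : α → List (Bool × Bool × ℕ)} {F : α → ℕ} (hO : PT O)
    (hF : PT F) : PT (fun a => _root_.writeGates (O a) (F a)) := by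
  unfold _root_.writeGates affGates
  fun_prop

@[fun_prop] theorem PT.frontGates {D F : α → ℕ} (hD : PT D) (hF : PT F) :
    PT (fun a => _root_.frontGates (D a) (F a)) := by
  unfold _root_.frontGates
  fun_prop

end

end StackMachine
end

noncomputable section

/-! ### Reading a description position by position -/

/-- Two-bit counter of the `false`s that have been read. -/
def countStep (s : Bool × Bool) (b : Bool) : Bool × Bool :=
  (xor s.1 (!b), xor s.2 (s.1 && !b))

/-- A group of four numbers starts here. -/
def atGroup (s : Bool × Bool) (prev : Bool) : Bool := !s.1 && (!s.2 && !prev)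

/-- The gates that start at the positions of a word. -/
def scanGates : Bool × Bool → Bool → List Bool → List Gate
  | _, _, [] => []
  | s, prev, b :: w =>
      (if atGroup s prev = true then headGates (decNatsFrom 0 (b :: w)) else []) ++
        scanGates (countStep s b) b w

/-- The same for a list of numbers. -/
def scanNats : Bool × Bool → List ℕ → List Gate
  | _, [] => []
  | s, a :: l =>
      (if atGroup s false = true then headGates (a :: l) else []) ++ scanNats (countStep s false) l

/-- A group can start only where a number starts, that is, where the preceding symbol is not `true`.
So within a run of `true` at most the first position contributes. -/
theorem scanGates_replicate (a : ℕ) (s : Bool × Bool) (prev : Bool) (w : List Bool) :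
    scanGates s prev (List.replicate a true ++ false :: w) =
      (if atGroup s prev = true then
        headGates (decNatsFrom 0 (List.replicate a true ++ false :: w)) else []) ++
      scanGates (countStep s false) false w := by
  induction a generalizing prev with
  | zero => simp [scanGates]
  | succ a ih =>
    have h1 : countStep s true = s := by simp [countStep]
    have h2 : atGroup s true = false := by simp [atGroup]
    rw [List.replicate_succ, List.cons_append, scanGates, h1, ih true, h2]
    simp

theorem decNatsFrom_replicate_true (a c : ℕ) : decNatsFrom c (List.replicate a true) = [] := by
  induction a generalizing c with
  | zero => rfl
  | succ a ih => rw [List.replicate_succ, decNatsFrom, ih]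

theorem scanGates_replicate_true (a : ℕ) (s : Bool × Bool) (prev : Bool) :
    scanGates s prev (List.replicate a true) = [] := by
  induction a generalizing s prev with
  | zero => rfl
  | succ a ih =>
    rw [List.replicate_succ, scanGates, ih, ← List.replicate_succ, decNatsFrom_replicate_true]
    simp [headGates]

theorem scanGates_eq_scanNats (l : List ℕ) (a : ℕ) (s : Bool × Bool) :
    scanGates s false (encNats l ++ List.replicate a true) = scanNats s l := by
  induction l generalizing s with
  | nil => simpa [encNats, scanNats] using scanGates_replicate_true a s false
  | cons b l ih =>
    rw [encNats_cons, List.append_assoc, List.cons_append, scanGates_replicate, ih, scanNats,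
      decNatsFrom_replicate, decNatsFrom_encNats_append, decNatsFrom_replicate_true, Nat.zero_add,
      List.append_nil]

theorem exists_eq_encNats (w : List Bool) (c : ℕ) :
    ∃ a, List.replicate c true ++ w = encNats (decNatsFrom c w) ++ List.replicate a true := by
  induction w generalizing c with
  | nil => exact ⟨c, by simp [decNatsFrom, encNats]⟩
  | cons b w ih =>
    rcases b with _ | _
    · obtain ⟨a, ha⟩ := ih 0
      refine ⟨a, ?_⟩
      rw [decNatsFrom, encNats_cons, List.append_assoc, List.cons_append, ← ha]
      simp
    · obtain ⟨a, ha⟩ := ih (c + 1)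
      refine ⟨a, ?_⟩
      rw [decNatsFrom, ← ha, List.replicate_succ']
      simp

/-- The two-bit counter counts modulo 4, so it returns to zero exactly after each group of four
numbers; an incomplete last group denotes no gate. -/
theorem scanNats_eq (l : List ℕ) : scanNats (false, false) l = decGates l := by
  match l with
  | a :: b :: c :: d :: l =>
    rw [decGates_cons, ← scanNats_eq l]
    simp [scanNats, atGroup, countStep, headGates]
  | [] => simp [scanNats, decGates]
  | [a] => simp [scanNats, decGates, headGates]
  | [a, b] => simp [scanNats, decGates, headGates, atGroup, countStep]
  | [a, b, c] => simp [scanNats, decGates, headGates, atGroup, countStep]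

/-- Decoding thereby becomes local: what a position contributes depends on the count of `false`s
before it, the preceding symbol and the word from there on. A circuit can test this for all
positions separately. -/
theorem scanGates_eq (w : List Bool) :
    scanGates (false, false) false w = decGates (decNatsFrom 0 w) := by
  obtain ⟨a, ha⟩ := exists_eq_encNats w 0
  rw [List.replicate_zero, List.nil_append] at ha
  conv_lhs => rw [ha]
  rw [scanGates_eq_scanNats, scanNats_eq]

theorem scanGates_flatMap (w : List Bool) (s : Bool × Bool) (prev : Bool) :
    scanGates s prev w = (List.range w.length).flatMap fun p =>
      if atGroup ((w.take p).foldl countStep s) ((prev :: w).getD p false) = true then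
        headGates (decNatsFrom 0 (w.drop p)) else [] := by
  induction w generalizing s prev with
  | nil => rfl
  | cons b w ih =>
    rw [scanGates, ih, List.length_cons, List.range_succ_eq_map, List.flatMap_cons,
      List.flatMap_map]
    rfl

/-- Every word is the code of the numbers read from it, followed by an unfinished run of `true`; the
terminated unary code makes prefixes of words and of number lists correspond. -/
theorem encNats_prefix_iff (l : List ℕ) (w : List Bool) :
    encNats l <+: w ↔ l <+: decNatsFrom 0 w := by
  constructor
  · rintro ⟨t, rfl⟩
    rw [decNatsFrom_encNats_append]
    exact List.prefix_append _ _
  · rintro ⟨t, ht⟩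
    obtain ⟨a, ha⟩ := exists_eq_encNats w 0
    rw [List.replicate_zero, List.nil_append, ← ht, encNats_append, List.append_assoc] at ha
    rw [ha]
    exact List.prefix_append _ _

theorem length_encNats (l : List ℕ) : (encNats l).length = l.sum + l.length := by
  induction l with
  | nil => rfl
  | cons a l ih => simp [encNats_cons, ih]; omega

/-- The four numbers of a gate. -/
def quadList (q : ℕ × ℕ × ℕ × ℕ) : List ℕ := [q.1, q.2.1, q.2.2.1, q.2.2.2]

/-- The descriptions of gates of length at most `L`. -/
def quadsUpTo (L : ℕ) : List (ℕ × ℕ × ℕ × ℕ) :=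
  [1, 2, 3, 4, 5, 6].flatMap fun o => (List.range L).flatMap fun i =>
    (List.range L).flatMap fun j => (List.range L).map fun k => (o, i, j, k)

theorem flatMap_ite_eq {α β : Type} [DecidableEq α] {l : List α} (h : l.Nodup) (a : α)
    (f : List β) : (l.flatMap fun b => if b = a then f else []) = if a ∈ l then f else [] := by
  induction l with
  | nil => simp
  | cons b l ih =>
    rw [List.flatMap_cons, ih h.of_cons]
    by_cases hb : b = a
    · subst hb
      rw [if_pos rfl, if_neg (List.nodup_cons.1 h).1, if_pos (by simp), List.append_nil]
    · rw [if_neg hb, List.nil_append]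
      simp [Ne.symm hb]

theorem mem_quadsUpTo {L : ℕ} {q : ℕ × ℕ × ℕ × ℕ} : q ∈ quadsUpTo L ↔
    (1 ≤ q.1 ∧ q.1 ≤ 6) ∧ q.2.1 < L ∧ q.2.2.1 < L ∧ q.2.2.2 < L := by
  obtain ⟨o, i, j, k⟩ := q
  have : o ∈ [1, 2, 3, 4, 5, 6] ↔ 1 ≤ o ∧ o ≤ 6 := by simp; omega
  rw [← this]
  simp only [quadsUpTo, List.mem_flatMap, List.mem_map, List.mem_range, Prod.mk.injEq]
  constructor
  · rintro ⟨o', ho, i', hi, j', hj, k', hk, rfl, rfl, rfl, rfl⟩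
    exact ⟨ho, hi, hj, hk⟩
  · rintro ⟨ho, hi, hj, hk⟩
    exact ⟨o, ho, i, hi, j, hj, k, hk, rfl, rfl, rfl, rfl⟩

theorem nodup_quadsUpTo (L : ℕ) : (quadsUpTo L).Nodup := by
  have h : quadsUpTo L = [1, 2, 3, 4, 5, 6] ×ˢ (List.range L ×ˢ (List.range L ×ˢ List.range L)) := by
    simp [quadsUpTo, SProd.sprod, List.product, List.map_flatMap, Function.comp_def]
  rw [h]
  refine .product (by decide) (.product List.nodup_range (.product List.nodup_range
    List.nodup_range))

/-- At most one quadruple has its code as a prefix of the word, and its entries are below `L` since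
the code is in unary with terminators. So the search over the polynomially many candidates yields
the head gate, and only once. -/
theorem headGates_eq_flatMap (w : List Bool) (L : ℕ) (h : w.length ≤ L) :
    headGates (decNatsFrom 0 w) = (quadsUpTo L).flatMap fun q =>
      if (encNats (quadList q)).isPrefixOf w = true then [Gate.ofQuad q] else [] := by
  simp only [List.isPrefixOf_iff_prefix, encNats_prefix_iff]
  have hL : ∀ q : ℕ × ℕ × ℕ × ℕ, quadList q <+: decNatsFrom 0 w →
      q.2.1 < L ∧ q.2.2.1 < L ∧ q.2.2.2 < L := by
    intro q hq
    have h1 := ((encNats_prefix_iff _ _).2 hq).length_le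
    rw [length_encNats] at h1
    simp [quadList] at h1
    omega
  generalize decNatsFrom 0 w = l at hL
  match l, hL with
  | a :: b :: c :: d :: l, hL =>
    have h1 : ∀ q : ℕ × ℕ × ℕ × ℕ, quadList q <+: a :: b :: c :: d :: l ↔ q = (a, b, c, d) := by
      rintro ⟨o, i, j, k⟩
      simp [quadList, List.cons_prefix_cons]
    have h2 : (quadsUpTo L).flatMap (fun q =>
          if quadList q <+: a :: b :: c :: d :: l then [Gate.ofQuad q] else []) =
        (quadsUpTo L).flatMap fun q => if q = (a, b, c, d) then [Gate.ofQuad (a, b, c, d)] else [] := by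
      refine List.flatMap_congr fun q _ => ?_
      simp only [h1]
      by_cases hq : q = (a, b, c, d)
      · rw [if_pos hq, if_pos hq, hq]
      · rw [if_neg hq, if_neg hq]
    rw [h2, flatMap_ite_eq (nodup_quadsUpTo L)]
    have h3 := hL (a, b, c, d) ((h1 _).2 rfl)
    have h4 : (a, b, c, d) ∈ quadsUpTo L ↔ 1 ≤ a ∧ a ≤ 6 := by
      rw [mem_quadsUpTo]
      exact and_iff_left h3
    simp [headGates, quadGates, h4]
  | [], _ => simp [headGates, quadList]
  | [a], _ => simp [headGates, quadList, List.cons_prefix_cons]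
  | [a, b], _ => simp [headGates, quadList, List.cons_prefix_cons]
  | [a, b, c], _ => simp [headGates, quadList, List.cons_prefix_cons]

/-! ### A classical circuit that reads a description -/

/-- The counter: wires `b + 2 * p` and `b + 2 * p + 1` count what is read before position `p`. -/
def countGates (c w : ℕ) : List Gate :=
  [.cnot c (c + 2), .cnot (c + 1) (c + 3), .flip w, .ccnot c w (c + 3), .cnot w (c + 2), .flip w]

/-- The old counter is copied to two clean wires, which are then incremented when wire `w` is
`false`. The carry is controlled by the old low bit on wire `c`, which remains available. -/
theorem actAll_countGates {c w : ℕ} (hw : w < c) (x : ℕ → Bool) (h2 : x (c + 2) = false)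
    (h3 : x (c + 3) = false) :
    actAll (countGates c w) x = Function.update (Function.update x (c + 2)
      (countStep (x c, x (c + 1)) (x w)).1) (c + 3) (countStep (x c, x (c + 1)) (x w)).2 := by
  have e2 : w ≠ c + 2 := by omega
  have e3 : w ≠ c + 3 := by omega
  have e4 : c ≠ w := by omega
  funext i
  by_cases hi : i = c + 3
  · subst hi
    simp [countGates, Gate.act, Function.update_apply, countStep, h3, e2, e3, e4, e3.symm]
  · by_cases hi' : i = c + 2
    · subst hi'
      simp [countGates, Gate.act, Function.update_apply, countStep, h2, e2, e3, e4, e2.symm]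
    · by_cases hi'' : i = w
      · subst hi''
        simp [countGates, Gate.act, Function.update_apply, e2, e3, e4]
      · simp [countGates, Gate.act, Function.update_apply, e2, e3, e4, hi, hi', hi'']

/-- The counters of all positions. -/
def countersGates (W : List ℕ) (b : ℕ) : List Gate :=
  W.zipIdx.flatMap fun q => countGates (b + 2 * q.2) q.1

theorem actAll_countersGates (W : List ℕ) (b : ℕ) (x : ℕ → Bool) (hW : ∀ w ∈ W, w < b)
    (hx : ∀ i, b ≤ i → x i = false) :
    (∀ i < b, actAll (countersGates W b) x i = x i) ∧
      (∀ i, b + 2 * W.length + 2 ≤ i → actAll (countersGates W b) x i = false) ∧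
      ∀ p ≤ W.length, (actAll (countersGates W b) x (b + 2 * p),
          actAll (countersGates W b) x (b + 2 * p + 1)) =
        ((W.map x).take p).foldl countStep (false, false) := by
  induction W using List.reverseRecOn with
  | nil =>
    refine ⟨fun i _ => rfl, fun i hi => hx i (by simp at hi; omega), fun p hp => ?_⟩
    simp [countersGates, hx (b + 2 * p) (by omega), hx (b + 2 * p + 1) (by omega)]
  | append_singleton W w ih =>
    obtain ⟨h1, h2, h3⟩ := ih fun w h => hW w (by simp [h])
    have hw : w < b := hW w (by simp)
    set y := actAll (countersGates W b) x with hy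
    have hz : actAll (countersGates (W ++ [w]) b) x =
        actAll (countGates (b + 2 * W.length) w) y := by
      rw [countersGates, List.zipIdx_append, List.flatMap_append, actAll_append, hy, countersGates]
      simp
    rw [hz, actAll_countGates (by omega) y (h2 _ (by omega)) (h2 _ (by omega))]
    refine ⟨fun i hi => ?_, fun i hi => ?_, fun p hp => ?_⟩
    · rw [Function.update_of_ne (by omega), Function.update_of_ne (by omega), h1 i hi]
    · rw [List.length_append, List.length_singleton] at hi
      rw [Function.update_of_ne (by omega), Function.update_of_ne (by omega), h2 i (by omega)]
    · rw [List.length_append, List.length_singleton] at hp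
      rcases Nat.lt_or_ge W.length p with hp' | hp'
      · obtain rfl : p = W.length + 1 := by omega
        rw [show b + 2 * (W.length + 1) = b + 2 * W.length + 2 by omega,
          show b + 2 * W.length + 2 + 1 = b + 2 * W.length + 3 by omega,
          Function.update_of_ne (by omega), Function.update_self, Function.update_self,
          List.take_of_length_le (by simp), List.map_append, List.foldl_append]
        have h4 := h3 W.length le_rfl
        rw [List.take_of_length_le (by simp)] at h4
        rw [← h4, h1 w hw]
        rfl
      · rw [Function.update_of_ne (by omega), Function.update_of_ne (by omega),
          Function.update_of_ne (by omega), Function.update_of_ne (by omega), h3 p hp',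
          List.map_append, List.take_append_of_le_length (by simpa using hp')]

theorem classicalOn_countersGates {N b : ℕ} {W : List ℕ} (hW : ∀ w ∈ W, w < b)
    (hN : b + 2 * W.length + 2 ≤ N) : ClassicalOn N (countersGates W b) := by
  refine .flatMap fun q hq => ?_
  have h1 := hW q.1 (List.fst_mem_of_mem_zipIdx hq)
  have h2 := List.snd_lt_of_mem_zipIdx hq
  exact .cnot (by omega) (by omega) (.cnot (by omega) (by omega) (.flip (by omega)
    (.ccnot (by omega) (by omega) (by omega) (.cnot (by omega) (by omega) (.flip (by omega) .nil)))))

/-- The literals that say that the gate `q` starts at position `p`. -/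
def startLits (W : List ℕ) (b p : ℕ) (q : ℕ × ℕ × ℕ × ℕ) : List (ℕ × Bool) :=
  (b + 2 * p, false) :: (b + 2 * p + 1, false) :: (((W.take p).drop (p - 1)).map fun w => (w, false)) ++
    (encNats (quadList q)).zipIdx.map fun r => (W.getD (p + r.2) 0, r.1)

/-- The gates that can start at the positions of a word, with the conditions. -/
def startItems (W : List ℕ) (b : ℕ) : List (List (ℕ × Bool) × Gate) :=
  (List.range W.length).flatMap fun p => (quadsUpTo W.length).flatMap fun q =>
    if decide (p + (encNats (quadList q)).length ≤ W.length) then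
      [(startLits W b p q, Gate.ofQuad q)] else []

theorem isPrefixOf_map (W : List ℕ) (x : ℕ → Bool) (u : List Bool) (h : u.length ≤ W.length) :
    (u.zipIdx.map fun r => (W.getD r.2 0, r.1)).all (litVal x) = u.isPrefixOf (W.map x) := by
  induction u generalizing W with
  | nil => simp
  | cons b u ih =>
    match W, h with
    | w :: W, h =>
      rw [List.map_cons, List.isPrefixOf_cons_cons, ← ih W (by simpa using h), List.zipIdx_cons,
        List.map_cons, List.all_cons, Nat.zero_add, List.zipIdx_eq_map_add]
      simp [litVal, Function.comp_def, Nat.add_comm 1]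
      rw [Bool.beq_comm]

/-- For a position and a candidate gate, the literals say that the counter is zero, that the
preceding symbol is `false`, and that the code of the gate follows. Their conjunction is the
condition under which `scanGates` emits that gate there. -/
theorem startItems_spec (W : List ℕ) (b : ℕ) (x : ℕ → Bool)
    (hc : ∀ p ≤ W.length, (x (b + 2 * p), x (b + 2 * p + 1)) =
      ((W.map x).take p).foldl countStep (false, false)) :
    ((startItems W b).flatMap fun it => if it.1.all (litVal x) = true then [it.2] else []) =
      decGates (decNatsFrom 0 (W.map x)) := by
  rw [← scanGates_eq, scanGates_flatMap, startItems, List.flatMap_assoc, List.length_map]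
  refine List.flatMap_congr fun p hp => ?_
  have hp' := List.mem_range.1 hp
  rw [headGates_eq_flatMap _ W.length (by simp), List.flatMap_assoc]
  have h1 : ∀ q, p + (encNats (quadList q)).length ≤ W.length →
      (startLits W b p q).all (litVal x) =
        (atGroup (((W.map x).take p).foldl countStep (false, false))
          ((false :: W.map x).getD p false) && (encNats (quadList q)).isPrefixOf ((W.map x).drop p)) := by
    intro q hq
    rw [← hc p hp'.le, startLits, List.all_append, List.all_cons, List.all_cons, ← List.map_drop,
      ← isPrefixOf_map _ _ _ (by simp; omega)]
    -- At position 0 there is no preceding wire and no literal, in agreement with the convention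
    -- that the preceding symbol is `false`; elsewhere the slice is the single wire before `p`.
    have e1 : ((((W.take p).drop (p - 1)).map fun w => (w, false)).all (litVal x)) =
        !((false :: W.map x).getD p false) := by
      rcases p with _ | p
      · simp
      · have e2 : (W.take (p + 1)).drop (p + 1 - 1) = [W[p]] := by
          rw [show p + 1 - 1 = p by omega, List.drop_take, show p + 1 - p = 1 by omega,
            List.drop_eq_getElem_cons (by omega : p < W.length)]
          rfl
        rw [e2]
        simp [litVal, (by omega : p < W.length)]
    rw [e1]
    simp [litVal, atGroup, Bool.and_assoc]
  by_cases ha : atGroup (((W.map x).take p).foldl countStep (false, false))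
      ((false :: W.map x).getD p false) = true
  · rw [if_pos ha]
    refine List.flatMap_congr fun q _ => ?_
    by_cases hq : p + (encNats (quadList q)).length ≤ W.length
    · rw [if_pos (by simpa using hq), List.flatMap_cons, h1 q hq, ha]
      simp
    · rw [if_neg (by simpa using hq), if_neg]
      -- A candidate whose code would run past the end of the word is not listed, and it cannot be a
      -- prefix of the remaining word either.
      · rfl
      · rw [List.isPrefixOf_iff_prefix]
        intro h
        have := h.length_le
        simp at this
        omega
  · rw [if_neg ha, List.flatMap_eq_nil_iff]
    intro q _
    by_cases hq : p + (encNats (quadList q)).length ≤ W.length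
    · rw [if_pos (by simpa using hq), List.flatMap_cons, h1 q hq]
      simp only [Bool.not_eq_true] at ha
      rw [ha]
      simp
    · rw [if_neg (by simpa using hq)]
      rfl

end

/-! ### The reader and the writer of descriptions as classical circuits. -/

noncomputable section

/-- The length of the blocks of a reader. -/
def readBlock (W : List ℕ) : ℕ := W.length + 4

/-- The first wire after the counters of a reader. -/
def readBase (W : List ℕ) (b : ℕ) : ℕ := b + 2 * W.length + 2

/-- The circuit that reads a description from the wires `W`, using the wires from `b` on. -/
def readGates (W : List ℕ) (b : ℕ) : List Gate :=
  countersGates W b ++ conjsGates ((startItems W b).map fun it => it.1) (readBlock W) (readBase W b)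

/-- The gates that can occur, with the wires that say whether they do. -/
def readItems (W : List ℕ) (b : ℕ) : List (ℕ × Gate) :=
  (startItems W b).zipIdx.map fun q =>
    (readBase W b + q.2 * readBlock W + q.1.1.length, q.1.2)

/-- The first wire after a reader. -/
def readEnd (W : List ℕ) (b : ℕ) : ℕ := readBase W b + (startItems W b).length * readBlock W

/-- The gates that are switched on. -/
def onGates (x : ℕ → Bool) (items : List (ℕ × Gate)) : List Gate :=
  items.flatMap fun it => if x it.1 = true then [it.2] else []

/-- Two literals for the counter, at most one for the preceding symbol, and a code that fits into
the word: at most `W.length + 3` literals, whose conjunction needs one wire more. -/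
theorem startItems_bounds (W : List ℕ) (b : ℕ) (hW : ∀ w ∈ W, w < b) :
    ∀ ls ∈ (startItems W b).map (fun it => it.1),
      ls.length < readBlock W ∧ ∀ p ∈ ls, p.1 < readBase W b := by
  intro ls hls
  simp only [startItems, List.mem_map, List.mem_flatMap] at hls
  obtain ⟨it, ⟨p, hp, q, hq, hit⟩, rfl⟩ := hls
  have hp' := List.mem_range.1 hp
  by_cases h : p + (encNats (quadList q)).length ≤ W.length
  · rw [if_pos (by simpa using h), List.mem_singleton] at hit
    subst hit
    constructor
    · simp only [startLits, readBlock, List.length_append, List.length_cons, List.length_map,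
        List.length_drop, List.length_take, List.length_zipIdx]
      omega
    · intro r hr
      simp only [startLits, List.cons_append, List.mem_cons, List.mem_append, List.mem_map] at hr
      rcases hr with rfl | rfl | ⟨w, hw, rfl⟩ | ⟨s, hs, rfl⟩
      · simp only [readBase]; omega
      · simp only [readBase]; omega
      · have := hW w (List.mem_of_mem_take (List.mem_of_mem_drop hw))
        simp only [readBase]; omega
      · have h2 := List.snd_lt_of_mem_zipIdx hs
        have h3 : p + s.2 < W.length := by omega
        have := hW _ (List.getElem_mem h3)
        simp only [readBase, List.getD_eq_getElem?_getD, List.getElem?_eq_getElem h3,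
          Option.getD_some]
        omega
  · rw [if_neg (by simpa using h)] at hit
    simp at hit

theorem readBase_le (W : List ℕ) (b : ℕ) : b ≤ readBase W b := by
  unfold readBase; omega

theorem readEnd_le (W : List ℕ) (b : ℕ) : b ≤ readEnd W b :=
  (readBase_le W b).trans (Nat.le_add_right _ _)

/-- The item list is fixed in advance, and only the control wires depend on the description. The
inputs are preserved and all wires from `readEnd W b` on stay clean, so a second reader can follow.
-/
theorem actAll_readGates (W : List ℕ) (b : ℕ) (x : ℕ → Bool) (hW : ∀ w ∈ W, w < b)
    (hx : ∀ i, b ≤ i → x i = false) :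
    (∀ i < b, actAll (readGates W b) x i = x i) ∧
      (∀ i, readEnd W b ≤ i → actAll (readGates W b) x i = false) ∧
      onGates (actAll (readGates W b) x) (readItems W b) =
        decGates (decNatsFrom 0 (W.map x)) := by
  obtain ⟨h1, h2, h3⟩ := actAll_countersGates W b x hW hx
  set y := actAll (countersGates W b) x with hy
  obtain ⟨k1, k2, k3⟩ := actAll_conjsGates ((startItems W b).map fun it => it.1) (readBlock W)
    (readBase W b) y (startItems_bounds W b hW) h2
  have hz : actAll (readGates W b) x = actAll (conjsGates ((startItems W b).map fun it => it.1)
      (readBlock W) (readBase W b)) y := by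
    rw [readGates, actAll_append]
  rw [← hz] at k1 k2 k3
  refine ⟨fun i hi => ?_, fun i hi => ?_, ?_⟩
  · rw [k1 i (hi.trans_le (readBase_le W b)), h1 i hi]
  · refine k2 i ?_
    rw [List.length_map]
    exact hi
  · have hWy : W.map x = W.map y := List.map_congr_left fun w hw => (h1 w (hW w hw)).symm
    rw [hWy] at h3 ⊢
    rw [← startItems_spec W b y h3, onGates, readItems, List.flatMap_map]
    have e : startItems W b = (startItems W b).zipIdx.map fun q => q.1 := by simp
    conv_rhs => rw [e, List.flatMap_map]
    refine List.flatMap_congr fun q hq => ?_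
    have h4 : (q.1.1, q.2) ∈ ((startItems W b).map fun it => it.1).zipIdx := by
      rw [List.zipIdx_map]
      exact List.mem_map.2 ⟨q, hq, rfl⟩
    simp only [k3 _ h4]

theorem classicalOn_readGates {N b : ℕ} {W : List ℕ} (hW : ∀ w ∈ W, w < b)
    (hN : readEnd W b ≤ N) : ClassicalOn N (readGates W b) := by
  have : readBase W b ≤ readEnd W b := Nat.le_add_right _ _
  refine .append (classicalOn_countersGates hW (this.trans hN)) (classicalOn_conjsGates
    (startItems_bounds W b hW) ?_)
  rwa [List.length_map]

theorem mem_readItems_lt {W : List ℕ} {b : ℕ} (hW : ∀ w ∈ W, w < b) {it : ℕ × Gate}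
    (h : it ∈ readItems W b) : it.1 < readEnd W b := by
  obtain ⟨q, hq, rfl⟩ := List.mem_map.1 h
  have h1 := (startItems_bounds W b hW q.1.1
    (List.mem_map.2 ⟨q.1, List.fst_mem_of_mem_zipIdx hq, rfl⟩)).1
  have h2 := List.snd_lt_of_mem_zipIdx hq
  have : (q.2 + 1) * readBlock W ≤ (startItems W b).length * readBlock W :=
    Nat.mul_le_mul_right _ (by omega)
  rw [Nat.add_mul] at this
  simp only [readEnd]
  omega

/-! ### Writing a description -/

/-- A description of no gate, as long as the description of `g`. -/
def noGateBits (g : Gate) : List Bool := encNats [0, g.toNats.sum, 0, 0]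

/-- The description of the gate `it.2`, or of no gate, according to wire `it.1`. -/
def itemBits (it : ℕ × Gate) : List (Bool × Bool × ℕ) :=
  (noGateBits it.2).zipIdx.map fun q =>
    (q.1, !(decide (q.1.toNat = ((encNats it.2.toNats).getD q.2 false).toNat)), it.1)

/-- The descriptions of the gate and of no gate have the same length, so each output bit is constant
or differs from a constant by the control wire. This is what lets a fixed circuit write a list of
gates that varies. -/
theorem itemBits_affVal (x : ℕ → Bool) (it : ℕ × Gate) :
    (itemBits it).map (affVal x) =
      encNats (if x it.1 = true then it.2.toNats else [0, it.2.toNats.sum, 0, 0]) := by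
  have hlen : (encNats it.2.toNats).length = (noGateBits it.2).length := by
    rw [noGateBits, length_encNats, length_encNats]
    cases it.2 <;> simp [Gate.toNats]
  have key : ∀ (i : ℕ) (h3 : i < (noGateBits it.2).length) (h4 : i < (encNats it.2.toNats).length)
      (h1 : i < ((itemBits it).map (affVal x)).length),
      ((itemBits it).map (affVal x))[i] =
        if x it.1 = true then (encNats it.2.toNats)[i] else (noGateBits it.2)[i] := by
    intro i h3 h4 h1
    rw [List.getElem_map]
    have e : (itemBits it)[i]'(by simpa using h1) = ((noGateBits it.2)[i],
        !(decide ((noGateBits it.2)[i].toNat = (encNats it.2.toNats)[i].toNat)), it.1) := by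
      simp [itemBits, List.getElem?_eq_getElem h4]
    rw [e]
    cases (noGateBits it.2)[i] <;> cases (encNats it.2.toNats)[i] <;> cases h : x it.1 <;>
      simp [affVal, h]
  by_cases hx : x it.1 = true
  · simp only [hx, if_true] at key ⊢
    exact List.ext_getElem (by rw [hlen]; simp [itemBits]) fun i h1 h2 =>
      key i (by omega) h2 h1
  · simp only [hx] at key ⊢
    exact List.ext_getElem (by simp [itemBits, noGateBits]) fun i h1 h2 =>
      key i h2 (by rw [hlen]; exact h2) h1

theorem encNats_flatMap {α : Type} (l : List α) (f : α → List ℕ) :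
    encNats (l.flatMap f) = l.flatMap fun a => encNats (f a) := by
  simp [encNats, List.flatMap_assoc]

theorem decGates_itemBits (x : ℕ → Bool) (items : List (ℕ × Gate)) :
    decGates (decNatsFrom 0 ((items.flatMap itemBits).map (affVal x))) = onGates x items := by
  simp only [List.map_flatMap, itemBits_affVal, ← encNats_flatMap, decNatsFrom_encNats]
  induction items with
  | nil => simp [decGates, onGates]
  | cons it items ih =>
    rw [onGates, List.flatMap_cons, List.flatMap_cons, ← onGates, ← ih]
    split_ifs
    · exact decGates_toNats_append _ _
    -- The operation code 0 is not in use, so the four numbers are skipped.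
    · rw [List.cons_append, List.cons_append, List.cons_append, List.cons_append, decGates_cons]
      rfl

theorem mem_itemBits {items : List (ℕ × Gate)} {F : ℕ} (h : ∀ it ∈ items, it.1 < F) :
    ∀ o ∈ items.flatMap itemBits, o.2.2 < F := by
  intro o ho
  obtain ⟨it, hit, ho⟩ := List.mem_flatMap.1 ho
  obtain ⟨q, _, rfl⟩ := List.mem_map.1 ho
  exact h it hit

theorem onGates_append (x : ℕ → Bool) (l l' : List (ℕ × Gate)) :
    onGates x (l ++ l') = onGates x l ++ onGates x l' := List.flatMap_append ..

/-- Selection commutes with reversing the list and inverting its entries, because the control wires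
stay attached. The inverse circuit is obtained without knowing which gates are present. -/
theorem onGates_inv (x : ℕ → Bool) (l : List (ℕ × Gate)) :
    onGates x (l.reverse.map fun it => (it.1, it.2.inv)) = invGates (onGates x l) := by
  induction l with
  | nil => rfl
  | cons it l ih =>
    rw [List.reverse_cons, List.map_append, onGates_append, ih, onGates, onGates]
    by_cases h : x it.1 = true <;> simp [h, invGates, onGates]

theorem onGates_congr {x y : ℕ → Bool} {l : List (ℕ × Gate)} (h : ∀ it ∈ l, x it.1 = y it.1) :
    onGates x l = onGates y l :=
  List.flatMap_congr fun it hit => by rw [h it hit]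

namespace StackMachine

section

variable {α : Type} [Code α]

@[fun_prop] theorem PT.quadsUpTo {L : α → ℕ} (hL : PT L) :
    PT (fun a => _root_.quadsUpTo (L a)) := by
  unfold _root_.quadsUpTo
  fun_prop

@[fun_prop] theorem PT.countersGates {W : α → List ℕ} {b : α → ℕ} (hW : PT W) (hb : PT b) :
    PT (fun a => _root_.countersGates (W a) (b a)) := by
  unfold _root_.countersGates countGates
  fun_prop

@[fun_prop] theorem PT.startItems {W : α → List ℕ} {b : α → ℕ} (hW : PT W) (hb : PT b) :
    PT (fun a => _root_.startItems (W a) (b a)) := by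
  unfold _root_.startItems startLits quadList
  fun_prop

@[fun_prop] theorem PT.readBase {W : α → List ℕ} {b : α → ℕ} (hW : PT W) (hb : PT b) :
    PT (fun a => _root_.readBase (W a) (b a)) := by
  unfold _root_.readBase
  fun_prop

@[fun_prop] theorem PT.readBlock {W : α → List ℕ} (hW : PT W) :
    PT (fun a => _root_.readBlock (W a)) := by
  unfold _root_.readBlock
  fun_prop

@[fun_prop] theorem PT.readGates {W : α → List ℕ} {b : α → ℕ} (hW : PT W) (hb : PT b) :
    PT (fun a => _root_.readGates (W a) (b a)) := by
  unfold _root_.readGates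
  fun_prop

@[fun_prop] theorem PT.readItems {W : α → List ℕ} {b : α → ℕ} (hW : PT W) (hb : PT b) :
    PT (fun a => _root_.readItems (W a) (b a)) := by
  unfold _root_.readItems
  fun_prop

@[fun_prop] theorem PT.readEnd {W : α → List ℕ} {b : α → ℕ} (hW : PT W) (hb : PT b) :
    PT (fun a => _root_.readEnd (W a) (b a)) := by
  unfold _root_.readEnd
  fun_prop

@[fun_prop] theorem PT.toNat {b : α → Bool} (hb : PT b) : PT (fun a => (b a).toNat) :=
  PT.congr (f := fun a => if b a = true then 1 else 0) (by fun_prop) fun a => by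
    cases b a <;> rfl

@[fun_prop] theorem PT.itemBits {it : α → ℕ × Gate} (hi : PT it) :
    PT (fun a => _root_.itemBits (it a)) := by
  have h : PT (fun a => (it a).2.toNats.sum) :=
    PT.congr (f := fun a => (it a).2.quad.1 + ((it a).2.quad.2.1 + ((it a).2.quad.2.2.1 +
      (it a).2.quad.2.2.2))) (by fun_prop) fun a => by simp [toNats_eq]
  unfold _root_.itemBits noGateBits
  fun_prop

end

end StackMachine
end

noncomputable section

/-! ### The circuits of the state generator and of the reduction -/

/-- The part of a key that describes the state. -/
def stateKey (S : QCircuit) {α : Type} (k : List α) : List α := k.take (min S.anc S.out)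

/-- The part of a key that describes the unitary. -/
def unitaryKey (S G : QCircuit) {α : Type} (k : List α) : List α := (k.drop S.anc).take G.out

/-- The gates described by a word. -/
def descGates (d : List Bool) : List Gate := decGates (decNatsFrom 0 d)

/-- Runs two circuits without input side by side and outputs all the wires. -/
def keyCircuit (S G : QCircuit) : QCircuit where
  anc := S.anc + G.anc
  out := S.anc + G.anc
  gates := cleanGates S.anc S.gates ++ (cleanGates G.anc G.gates).map (Gate.shift S.anc)

/-- The gates that prepare `C|0⟩ ⊗ gC|0⟩`. -/
def prepGates (n : ℕ) (C g : List Gate) : List Gate :=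
  cleanGates n C ++ (cleanGates n C ++ cleanGates n g).map (Gate.shift n)

/-- The preparation of the state of a key. -/
def keyGates (S G : QCircuit) (n : ℕ) (k : List Bool) : List Gate :=
  prepGates n (descGates (stateKey S k)) (descGates (unitaryKey S G k))

/-- The circuit that generates the state of a key. -/
def stateCircuit (S G : QCircuit) (n : ℕ) (k : List Bool) : QCircuit where
  anc := n + n
  out := n + n
  gates := keyGates S G n k

/-- The test that the wires `0, …, N - 1` are all zero, with the result on wire `0`. -/
def zeroTest (N : ℕ) : List Gate :=
  conjGates ((List.range N).map fun i => (i, false)) N ++ moveGates (N + N) 0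

/-- The circuit that projects on the state of a key. -/
def verCircuit (S G : QCircuit) (n : ℕ) (k : List Bool) : QCircuit where
  anc := n + n + 1
  out := 1
  gates := invGates (keyGates S G n k) ++ zeroTest (n + n)

/-- The items of the random phases, on the wires from `b` on. -/
def phaseItems (n b : ℕ) : List (ℕ × Gate) :=
  (List.range n).flatMap fun q =>
    [(b + q, .tee q), (b + q, .tee q), (b + q, .tee q), (b + q, .tee q)]

/-- The items of the description of `g C Z C⁻¹`, where the descriptions of `C` and `g` are on the
wires `W` and `W'`, and the phases `Z` are chosen by the `n` wires before wire `b`. -/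
def twirlItems (n b : ℕ) (W W' : List ℕ) : List (ℕ × Gate) :=
  (readItems W b).reverse.map (fun it => (it.1, it.2.inv)) ++
    (phaseItems n (b - n) ++ (readItems W b ++ readItems W' (readEnd W b)))

/-- The description of `g C Z C⁻¹`. -/
def twirlBits (n b : ℕ) (W W' : List ℕ) : List (Bool × Bool × ℕ) :=
  (twirlItems n b W W').flatMap itemBits

/-- The first wire of the description. -/
def twirlBase (n b : ℕ) (W W' : List ℕ) : ℕ :=
  readEnd W' (readEnd W b) + (twirlBits n b W W').length

/-- The circuit that writes the description of `g C Z C⁻¹` on the first wires. -/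
def twirlGates (n b : ℕ) (W W' : List ℕ) : List Gate :=
  readGates W b ++ (readGates W' (readEnd W b) ++
    (writeGates (twirlBits n b W W') (twirlBase n b W W') ++
      frontGates (twirlBits n b W W').length (twirlBase n b W W')))

/-- The wires of the key that `A` outputs, when it has `N` wires. -/
def outWires (A : QCircuit) (N : ℕ) : List ℕ := List.range (min A.out N)

/-- The adversary against the group action made from an adversary `A` against the state
generator, for `t` copies. -/
def twirlCircuit (S G : QCircuit) (n t : ℕ) (A : QCircuit) : QCircuit where
  anc := twirlBase n (t * (n + n) + A.anc + n)
      (stateKey S (outWires A (t * (n + n) + A.anc)))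
      (unitaryKey S G (outWires A (t * (n + n) + A.anc))) +
    (twirlBits n (t * (n + n) + A.anc + n)
      (stateKey S (outWires A (t * (n + n) + A.anc)))
      (unitaryKey S G (outWires A (t * (n + n) + A.anc)))).length
  out := (twirlBits n (t * (n + n) + A.anc + n)
      (stateKey S (outWires A (t * (n + n) + A.anc)))
      (unitaryKey S G (outWires A (t * (n + n) + A.anc)))).length
  gates := (cleanGates (t * (n + n) + A.anc) A.gates ++
      (List.range n).map fun q => .had (t * (n + n) + A.anc + q)) ++
    twirlGates n (t * (n + n) + A.anc + n)
      (stateKey S (outWires A (t * (n + n) + A.anc)))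
      (unitaryKey S G (outWires A (t * (n + n) + A.anc)))

/-- The phases selected by the bits `z`. -/
def phaseGates (n : ℕ) (z : ℕ → Bool) : List Gate :=
  (List.range n).flatMap fun q => if z q = true then [.tee q, .tee q, .tee q, .tee q] else []

theorem onGates_phaseItems (n b : ℕ) (x : ℕ → Bool) :
    onGates x (phaseItems n b) = phaseGates n fun q => x (b + q) := by
  rw [onGates, phaseItems, phaseGates, List.flatMap_assoc]
  refine List.flatMap_congr fun q _ => ?_
  cases h : x (b + q) <;> simp [h]

theorem mem_twirlItems_lt {n b : ℕ} {W W' : List ℕ} (hn : n ≤ b) (hW : ∀ w ∈ W, w < b)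
    (hW' : ∀ w ∈ W', w < b) : ∀ it ∈ twirlItems n b W W', it.1 < readEnd W' (readEnd W b) := by
  have h1 := readEnd_le W b
  have h2 := readEnd_le W' (readEnd W b)
  intro it hit
  simp only [twirlItems, List.mem_append, List.mem_map, List.mem_reverse] at hit
  rcases hit with ⟨it, hit, rfl⟩ | hit | hit | hit
  · have := mem_readItems_lt hW hit
    simp only
    omega
  · simp only [phaseItems, List.mem_flatMap, List.mem_range] at hit
    obtain ⟨q, hq, hit⟩ := hit
    simp only [List.mem_cons, List.not_mem_nil, or_false, or_self] at hit
    subst hit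
    simp only
    omega
  · have := mem_readItems_lt hW hit
    omega
  · exact mem_readItems_lt (fun w hw => by have := hW' w hw; omega) hit

theorem classicalOn_twirlGates {n b N : ℕ} {W W' : List ℕ} (hn : n ≤ b) (hW : ∀ w ∈ W, w < b)
    (hW' : ∀ w ∈ W', w < b) (hN : twirlBase n b W W' + (twirlBits n b W W').length ≤ N) :
    ClassicalOn N (twirlGates n b W W') := by
  have h1 := readEnd_le W b
  have h2 := readEnd_le W' (readEnd W b)
  have h3 : readEnd W' (readEnd W b) ≤ twirlBase n b W W' := Nat.le_add_right _ _
  refine .append (classicalOn_readGates hW (by omega)) (.append (classicalOn_readGates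
    (fun w hw => by have := hW' w hw; omega) (by omega)) (.append (classicalOn_writeGates
    (mem_itemBits fun it hit => ?_) hN) (classicalOn_frontGates hN)))
  have := mem_twirlItems_lt hn hW hW' it hit
  omega

/-- The head of the list acts first, so the order is C⁻¹, Z, C, g. The readers and the writer leave
their inputs intact; only the final moves to the front overwrite wires, and by then the description
is complete. -/
theorem descGates_twirl {n b : ℕ} {W W' : List ℕ} (hn : n ≤ b) (hW : ∀ w ∈ W, w < b)
    (hW' : ∀ w ∈ W', w < b) (x : ℕ → Bool) (hx : ∀ i, b ≤ i → x i = false) :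
    descGates ((List.range (twirlBits n b W W').length).map (actAll (twirlGates n b W W') x)) =
      invGates (descGates (W.map x)) ++ (phaseGates n (fun q => x (b - n + q)) ++
        (descGates (W.map x) ++ descGates (W'.map x))) := by
  have e1 := readEnd_le W b
  have e2 := readEnd_le W' (readEnd W b)
  have e3 : readEnd W' (readEnd W b) ≤ twirlBase n b W W' := Nat.le_add_right _ _
  have e4 : (twirlBits n b W W').length ≤ twirlBase n b W W' := Nat.le_add_left _ _
  have hI := mem_twirlItems_lt hn hW hW'
  obtain ⟨h1, h2, h3⟩ := actAll_readGates W b x hW hx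
  set y := actAll (readGates W b) x with hy
  obtain ⟨k1, k2, k3⟩ := actAll_readGates W' (readEnd W b) y
    (fun w hw => by have := hW' w hw; omega) h2
  set z := actAll (readGates W' (readEnd W b)) y with hz
  obtain ⟨l1, l2, l3⟩ := actAll_writeGates (twirlBits n b W W') (twirlBase n b W W') z
    (mem_itemBits fun it hit => by have := hI it hit; omega) (fun i hi => k2 i (by omega))
  have e : (List.range (twirlBits n b W W').length).map (actAll (twirlGates n b W W') x) =
      (twirlBits n b W W').map (affVal z) := by
    rw [← l3]
    refine List.map_congr_left fun r hr => ?_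
    rw [twirlGates, actAll_append, actAll_append, actAll_append, ← hy, ← hz,
      actAll_frontGates e4 _ r (List.mem_range.1 hr)]
  have hzb : ∀ i < b, z i = x i := fun i hi => by rw [k1 i (by omega), h1 i hi]
  have hW1 : onGates z (readItems W b) = descGates (W.map x) := by
    rw [descGates, ← h3]
    exact onGates_congr fun it hit => k1 _ (mem_readItems_lt hW hit)
  have hW2 : W'.map y = W'.map x := List.map_congr_left fun w hw => h1 w (hW' w hw)
  rw [e, twirlBits, descGates, decGates_itemBits, twirlItems, onGates_append, onGates_append,
    onGates_append, onGates_inv, hW1, onGates_phaseItems, k3, hW2, ← descGates]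
  congr 2
  rw [phaseGates, phaseGates]
  refine List.flatMap_congr fun q hq => ?_
  rw [hzb]
  have := List.mem_range.1 hq
  omega

namespace StackMachine

section

variable {α β : Type} [Code α] [Code β]

@[fun_prop] theorem PT.stateKey {S : α → QCircuit} {k : α → List β} (hS : PT S) (hk : PT k) :
    PT (fun a => _root_.stateKey (S a) (k a)) := by
  unfold _root_.stateKey
  fun_prop

@[fun_prop] theorem PT.unitaryKey {S G : α → QCircuit} {k : α → List β} (hS : PT S) (hG : PT G)
    (hk : PT k) : PT (fun a => _root_.unitaryKey (S a) (G a) (k a)) := by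
  unfold _root_.unitaryKey
  fun_prop

@[fun_prop] theorem PT.keyCircuit {S G : α → QCircuit} (hS : PT S) (hG : PT G) :
    PT (fun a => _root_.keyCircuit (S a) (G a)) := by
  unfold _root_.keyCircuit
  fun_prop

@[fun_prop] theorem PT.keyGates {S G : α → QCircuit} {n : α → ℕ} {k : α → List Bool} (hS : PT S)
    (hG : PT G) (hn : PT n) (hk : PT k) :
    PT (fun a => _root_.keyGates (S a) (G a) (n a) (k a)) := by
  unfold _root_.keyGates prepGates descGates
  fun_prop

@[fun_prop] theorem PT.stateCircuit {S G : α → QCircuit} {n : α → ℕ} {k : α → List Bool}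
    (hS : PT S) (hG : PT G) (hn : PT n) (hk : PT k) :
    PT (fun a => _root_.stateCircuit (S a) (G a) (n a) (k a)) := by
  unfold _root_.stateCircuit
  fun_prop

@[fun_prop] theorem PT.verCircuit {S G : α → QCircuit} {n : α → ℕ} {k : α → List Bool}
    (hS : PT S) (hG : PT G) (hn : PT n) (hk : PT k) :
    PT (fun a => _root_.verCircuit (S a) (G a) (n a) (k a)) := by
  unfold _root_.verCircuit zeroTest
  fun_prop

@[fun_prop] theorem PT.twirlBits {n b : α → ℕ} {W W' : α → List ℕ} (hn : PT n) (hb : PT b)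
    (hW : PT W) (hW' : PT W') : PT (fun a => _root_.twirlBits (n a) (b a) (W a) (W' a)) := by
  unfold _root_.twirlBits twirlItems phaseItems
  fun_prop

@[fun_prop] theorem PT.twirlBase {n b : α → ℕ} {W W' : α → List ℕ} (hn : PT n) (hb : PT b)
    (hW : PT W) (hW' : PT W') : PT (fun a => _root_.twirlBase (n a) (b a) (W a) (W' a)) := by
  unfold _root_.twirlBase
  fun_prop

@[fun_prop] theorem PT.twirlGates {n b : α → ℕ} {W W' : α → List ℕ} (hn : PT n) (hb : PT b)
    (hW : PT W) (hW' : PT W') : PT (fun a => _root_.twirlGates (n a) (b a) (W a) (W' a)) := by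
  unfold _root_.twirlGates
  fun_prop

@[fun_prop] theorem PT.outWires {A : α → QCircuit} {N : α → ℕ} (hA : PT A) (hN : PT N) :
    PT (fun a => _root_.outWires (A a) (N a)) := by
  unfold _root_.outWires
  fun_prop

@[fun_prop] theorem PT.twirlCircuit {S G A : α → QCircuit} {n t : α → ℕ} (hS : PT S) (hG : PT G)
    (hn : PT n) (ht : PT t) (hA : PT A) :
    PT (fun a => _root_.twirlCircuit (S a) (G a) (n a) (t a) (A a)) := by
  unfold _root_.twirlCircuit
  fun_prop

end

end StackMachine
end

noncomputable section

/-! ### Product states -/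

section

variable {a b N : ℕ}

/-- The state of two registers. -/
def ketTens (h : a + b = N) (φ : Ket a) (χ : Ket b) : Ket N :=
  fun x => φ (splitL h x) * χ (splitR h x)

/-- The state `|0…0⟩`. -/
def zeroKet (n : ℕ) : Ket n := fun x => if x = fun _ => false then 1 else 0

theorem tens_mulVec (h : a + b = N) (A : QOp a) (B : QOp b) (φ : Ket a) (χ : Ket b) :
    tens h A B *ᵥ ketTens h φ χ = ketTens h (A *ᵥ φ) (B *ᵥ χ) := by
  funext x
  simp only [Matrix.mulVec, dotProduct, tens, ketTens, sum_split h, splitL_joinBits,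
    splitR_joinBits]
  rw [Finset.sum_mul_sum]
  exact Finset.sum_congr rfl fun u _ => Finset.sum_congr rfl fun v _ => by ring

theorem zeroKet_tens (h : a + b = N) : zeroKet N = ketTens h (zeroKet a) (zeroKet b) := by
  funext x
  have : x = (fun _ => false) ↔ splitL h x = (fun _ => false) ∧ splitR h x = fun _ => false := by
    rw [split_ext h]; rfl
  simp only [zeroKet, ketTens, this]
  by_cases h1 : splitL h x = fun _ => false <;> simp [h1]

theorem addAncKet_eq (ψ : Ket a) : addAncKet b ψ = ketTens rfl ψ (zeroKet b) := by
  funext x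
  have : (∀ j : Fin b, x (Fin.natAdd a j) = false) ↔ splitR rfl x = fun _ => false :=
    funext_iff.symm
  simp only [addAncKet, ketTens, zeroKet, this]
  split_ifs
  · rw [mul_one]; rfl
  · rw [mul_zero]

theorem ketTens_assoc {c d M : ℕ} (h : a + b = N) (h' : N + c = M) (k : b + c = d)
    (k' : a + d = M) (φ : Ket a) (χ : Ket b) (ξ : Ket c) :
    ketTens h' (ketTens h φ χ) ξ = ketTens k' φ (ketTens k χ ξ) := by
  subst h k
  funext x
  simp only [ketTens, mul_assoc]
  have e1 : splitL rfl (splitL h' x) = splitL k' x := rfl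
  have e2 : splitR rfl (splitL h' x) = splitL rfl (splitR k' x) := rfl
  have e3 : splitR h' x = splitR rfl (splitR k' x) := by
    funext i
    simp [splitR, Nat.add_assoc]
  rw [e1, e2, e3]

theorem sum_ketTens (h : a + b = N) (φ : Ket a) (χ : Ket b) (F : Bits N → ℝ) :
    ∑ x, ‖ketTens h φ χ x‖ ^ 2 * F x =
      ∑ u, ‖φ u‖ ^ 2 * ∑ v, ‖χ v‖ ^ 2 * F (joinBits h u v) := by
  rw [sum_split h]
  refine Finset.sum_congr rfl fun u _ => ?_
  rw [Finset.mul_sum]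
  refine Finset.sum_congr rfl fun v _ => ?_
  rw [ketTens, splitL_joinBits, splitR_joinBits, norm_mul, mul_pow, mul_assoc]

theorem sum_zeroKet (n : ℕ) (F : Bits n → ℝ) :
    ∑ x, ‖zeroKet n x‖ ^ 2 * F x = F fun _ => false := by
  rw [Finset.sum_eq_single fun _ => false]
  · simp [zeroKet]
  · intro x _ hx
    simp [zeroKet, hx]
  · simp

theorem ofFn_joinBits (h : a + b = N) (u : Bits a) (v : Bits b) :
    List.ofFn (joinBits h u v) = List.ofFn u ++ List.ofFn v := by
  subst h
  rw [← List.ofFn_fin_append]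
  congr 1
  funext i
  refine Fin.addCases (fun i => ?_) (fun i => ?_) i <;> simp [joinBits]

theorem extendBits_joinBits_left (h : a + b = N) (u : Bits a) (v : Bits b) {i : ℕ} (hi : i < a) :
    extendBits (joinBits h u v) i = extendBits u i := by
  simp [extendBits, joinBits, hi, (by omega : i < N)]

theorem extendBits_joinBits_right (h : a + b = N) (u : Bits a) (v : Bits b) (i : ℕ) :
    extendBits (joinBits h u v) (a + i) = extendBits v i := by
  by_cases hi : i < b
  · simp [extendBits, joinBits, hi, (by omega : a + i < N)]
  · rw [extendBits, dif_neg (by omega), extendBits, dif_neg hi]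

theorem extendBits_false (n i : ℕ) : extendBits (fun _ : Fin n => false) i = false := by
  simp [extendBits]

theorem braket_ketTens (h : a + b = N) (φ φ' : Ket a) (χ χ' : Ket b) :
    braket (ketTens h φ χ) (ketTens h φ' χ') = braket φ φ' * braket χ χ' := by
  simp only [braket, dotProduct, Pi.star_apply, sum_split h, ketTens, splitL_joinBits,
    splitR_joinBits]
  rw [Finset.sum_mul_sum]
  refine Finset.sum_congr rfl fun u _ => Finset.sum_congr rfl fun v _ => ?_
  rw [star_mul']
  ring

end

theorem tensorKet_eq {m n : ℕ} (ψ : Ket m) (φ : Ket n) : tensorKet ψ φ = ketTens rfl ψ φ := rfl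

theorem noKet_eq : noKet = zeroKet 0 := by
  funext x
  rw [noKet, zeroKet, if_pos (Subsingleton.elim _ _)]

theorem descKet_eq (n : ℕ) (d : List Bool) : descKet n d = gatesMat n (descGates d) *ᵥ zeroKet n := by
  funext x
  simp [descKet, descUnitary, Matrix.mulVec, dotProduct, zeroKet, descGates]

/-! ### The states and the verification -/

theorem gatesMat_prepGates (n : ℕ) (C g : List Gate) :
    gatesMat (n + n) (prepGates n C g) *ᵥ zeroKet (n + n) =
      tensorKet (gatesMat n C *ᵥ zeroKet n) (gatesMat n g *ᵥ (gatesMat n C *ᵥ zeroKet n)) := by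
  have h1 : gatesMat (n + n) ((cleanGates n C ++ cleanGates n g).map (Gate.shift n)) =
      tens rfl 1 (gatesMat n g * gatesMat n C) := by
    rw [gatesMat_right rfl, gatesMat_append, gatesMat_clean, gatesMat_clean]
    intro g' hg'
    rcases List.mem_append.1 hg' with h | h <;> exact fits_of_mem_clean h
  rw [prepGates, gatesMat_append, h1, gatesMat_left rfl fun g' hg' => fits_of_mem_clean hg',
    gatesMat_clean, tens_mul, zeroKet_tens rfl, tens_mulVec, tensorKet_eq]
  simp [Matrix.mulVec_mulVec]

/-- The state of a key. -/
def keyKet (S G : QCircuit) (n : ℕ) (k : List Bool) : Ket (n + n) :=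
  tensorKet (descKet n (stateKey S k))
    (descUnitary n (unitaryKey S G k) *ᵥ descKet n (stateKey S k))

theorem keyKet_eq (S G : QCircuit) (n : ℕ) (k : List Bool) :
    keyKet S G n k = gatesMat (n + n) (keyGates S G n k) *ᵥ zeroKet (n + n) := by
  rw [keyGates, gatesMat_prepGates, keyKet, descKet_eq]
  rfl

/-- When no wire is discarded the partial trace is trivial, which keeps the output pure. The cast
accounts for `0 + k` and `k` being different expressions. -/
theorem outState_all (C : QCircuit) {m k : ℕ} (ψ : Ket m) (h : m + C.anc = k) :
    C.outState (pureState ψ) k = pureState fun a => C.ket ψ fun i => a (Fin.cast h i) := by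
  subst h
  have hf : ∀ x : Bits (m + C.anc), firstWires (m + C.anc) x = x := by
    intro x; funext i; simp [firstWires]
  ext a b
  have : ∀ x y : Bits (m + C.anc), ∀ i : Fin (m + C.anc), m + C.anc ≤ (i : ℕ) → x i = y i :=
    fun x y i hi => absurd i.2 (by omega)
  simp only [QCircuit.outState, hf, QCircuit.final_pureState]
  rw [Finset.sum_eq_single a, Finset.sum_eq_single b]
  · rw [if_pos ⟨rfl, rfl, this a b⟩]; rfl
  · intro y _ hy; rw [if_neg fun H => hy H.2.1]
  · simp
  · intro x _ hx
    exact Finset.sum_eq_zero fun y _ => if_neg fun H => hx H.1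
  · simp

theorem gatesMat_zeroKet_cast {N k : ℕ} (h : N = k) (gs : List Gate) (a : Bits k) :
    (gatesMat N gs *ᵥ zeroKet N) (fun i => a (Fin.cast h i)) = (gatesMat k gs *ᵥ zeroKet k) a := by
  subst h; rfl

theorem addAncKet_noKet (n : ℕ) : addAncKet n noKet = zeroKet (0 + n) := by
  rw [addAncKet_eq, noKet_eq, ← zeroKet_tens]

theorem stateCircuit_outState (S G : QCircuit) (n : ℕ) (k : List Bool) :
    (stateCircuit S G n k).outState noInput (n + n) = pureState (keyKet S G n k) := by
  rw [noInput_eq, outState_all _ _ (Nat.zero_add (n + n)), keyKet_eq]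
  congr 1
  funext a
  rw [QCircuit.ket, addAncKet_noKet]
  exact gatesMat_zeroKet_cast (Nat.zero_add (n + n)) _ a

theorem actAll_zeroTest (N : ℕ) (x : ℕ → Bool) (hx : ∀ i, N ≤ i → x i = false) :
    actAll (zeroTest N) x 0 = true ↔ ∀ i < N, x i = false := by
  obtain ⟨-, -, h3⟩ := actAll_conjGates ((List.range N).map fun i => (i, false)) N x
    (by simp) hx
  rw [zeroTest, actAll_append, (actAll_moveGates _ _ _).1]
  rw [List.length_map, List.length_range] at h3
  rw [h3]
  simp [litVal]

theorem classicalOn_zeroTest (N : ℕ) : ClassicalOn (N + (N + 1)) (zeroTest N) :=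
  .append (classicalOn_conjGates (by simp) (by simp))
    (classicalOn_moveGates (by omega) (by omega))

theorem fits_prepGates {n : ℕ} {C g : List Gate} :
    ∀ g' ∈ prepGates n C g, Gate.fits (n + n) g' = true := by
  intro g' hg'
  rcases List.mem_append.1 hg' with h | h
  · have := fits_of_mem_clean h
    rw [Gate.fits_iff] at this ⊢
    omega
  · obtain ⟨g'', h'', rfl⟩ := List.mem_map.1 h
    have : Gate.fits n g'' = true := by
      rcases List.mem_append.1 h'' with h | h <;> exact fits_of_mem_clean h
    rw [Gate.fits_iff] at this ⊢
    cases g'' <;> simp only [Gate.shift, Gate.quad] at this ⊢ <;> omega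

theorem fits_invGates {n : ℕ} {gs : List Gate} (h : ∀ g ∈ gs, Gate.fits n g = true) :
    ∀ g ∈ invGates gs, Gate.fits n g = true := by
  intro g hg
  obtain ⟨g', hg', rfl⟩ := List.mem_map.1 hg
  have := h g' (List.mem_reverse.1 hg')
  rw [Gate.fits_iff] at this ⊢
  cases g' <;> exact this

theorem fits_keyGates (S G : QCircuit) (n : ℕ) (k : List Bool) :
    ∀ g ∈ keyGates S G n k, Gate.fits (n + n) g = true := fits_prepGates

/-- Undoing a preparation turns the overlap with the prepared state into the amplitude at `|0…0⟩`.
-/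
theorem conjTranspose_mulVec_zero {n : ℕ} (U : QOp n) (ψ : Ket n) :
    (Uᴴ *ᵥ ψ) (fun _ => false) = braket (U *ᵥ zeroKet n) ψ := by
  rw [← Matrix.conjTranspose_conjTranspose U, ← braket_mulVec, Matrix.conjTranspose_conjTranspose]
  simp [braket, dotProduct, zeroKet, apply_ite]

/-- With U the preparation of the key state, the zero test after U⁻¹ succeeds with probability
|⟨0|U⁻¹ψ⟩|² = |⟨U0|ψ⟩|². The conjunction of `n + n` literals uses exactly the `n + n + 1` ancillas.
-/
theorem verCircuit_acceptProb (S G : QCircuit) (n : ℕ) (k : List Bool) (ψ : Ket (n + n)) :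
    (verCircuit S G n k).acceptProb (pureState ψ) = ‖braket (keyKet S G n k) ψ‖ ^ 2 := by
  rw [QCircuit.acceptProb, QCircuit.expect_classical (verCircuit S G n k) ψ _
      (gs := invGates (keyGates S G n k)) (gs' := zeroTest (n + n)) rfl
      (classicalOn_zeroTest (n + n)),
    gatesMat_left rfl (fits_invGates (fits_keyGates S G n k)), addAncKet_eq, tens_mulVec, sum_ketTens]
  have hmin : min (verCircuit S G n k).out (n + n + (verCircuit S G n k).anc) = 1 := by
    simp [verCircuit]
    omega
  rw [hmin]
  have hval : ∀ u : Bits (n + n), ∑ v, ‖((1 : QOp (verCircuit S G n k).anc) *ᵥ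
        zeroKet (verCircuit S G n k).anc) v‖ ^ 2 *
      (if (List.range 1).map (actAll (zeroTest (n + n)) (extendBits (joinBits rfl u v))) = [true]
        then (1 : ℝ) else 0) = if u = fun _ => false then 1 else 0 := by
    intro u
    rw [Matrix.one_mulVec, sum_zeroKet]
    congr 1
    rw [List.range_one, List.map_singleton, List.singleton_inj, actAll_zeroTest, eq_iff_iff]
    · constructor
      · intro H
        funext i
        have := H i i.2
        rw [extendBits_joinBits_left _ _ _ i.2] at this
        simpa [extendBits] using this
      · rintro rfl i hi
        rw [extendBits_joinBits_left _ _ _ hi, extendBits_false]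
    · intro i hi
      obtain ⟨j, rfl⟩ := Nat.exists_eq_add_of_le hi
      rw [extendBits_joinBits_right, extendBits_false]
  simp only [hval]
  rw [Finset.sum_eq_single fun _ => false]
  · rw [if_pos rfl, mul_one, keyKet_eq, gatesMat_inv, conjTranspose_mulVec_zero]
  · intro u _ hu
    rw [if_neg hu, mul_zero]
  · simp

/-! ### The distribution of the keys -/

/-- The two circuits act on separate registers, so the final state is a product and the results are
independent. All wires are output, which keeps the second description at a fixed offset; the
superfluous bits do not enter the state. -/
theorem keyCircuit_expect (S G : QCircuit) (f : List Bool → List Bool → ℝ) :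
    (keyCircuit S G).expect noInput (fun k => f (stateKey S k) (unitaryKey S G k)) =
      S.expect noInput fun ds => G.expect noInput fun dg => f ds dg := by
  have hN : (0 + S.anc) + (0 + G.anc) = 0 + (S.anc + G.anc) := by omega
  have h1 : (keyCircuit S G).ket noKet = ketTens hN (S.ket noKet) (G.ket noKet) := by
    have e1 : (keyCircuit S G).gates = cleanGates (0 + S.anc) S.gates ++
        (cleanGates (0 + G.anc) G.gates).map (Gate.shift (0 + S.anc)) := by
      simp only [Nat.zero_add]; rfl
    rw [QCircuit.ket, e1, addAncKet_noKet, gatesMat_append]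
    change (gatesMat (0 + (S.anc + G.anc)) _ * gatesMat (0 + (S.anc + G.anc)) _) *ᵥ
      zeroKet (0 + (S.anc + G.anc)) = _
    rw [gatesMat_left hN fun g hg => fits_of_mem_clean hg,
      gatesMat_right hN fun g hg => fits_of_mem_clean hg, gatesMat_clean, gatesMat_clean, tens_mul,
      zeroKet_tens hN, tens_mulVec, Matrix.one_mul, Matrix.mul_one, QCircuit.ket, QCircuit.ket,
      addAncKet_noKet, addAncKet_noKet]
  rw [noInput_eq, QCircuit.expect_pureState, h1]
  change ∑ x : Bits (0 + (S.anc + G.anc)), _ = _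
  rw [sum_ketTens hN, QCircuit.expect_pureState]
  refine Finset.sum_congr rfl fun u _ => ?_
  rw [QCircuit.expect_pureState]
  congr 1
  refine Finset.sum_congr rfl fun v _ => ?_
  congr 1
  have h2 : (List.ofFn (joinBits hN u v)).take (S.anc + G.anc) = List.ofFn u ++ List.ofFn v := by
    rw [ofFn_joinBits, List.take_of_length_le]
    simp
  change f (stateKey S ((List.ofFn (joinBits hN u v)).take (S.anc + G.anc)))
    (unitaryKey S G ((List.ofFn (joinBits hN u v)).take (S.anc + G.anc))) = _
  rw [h2, stateKey, unitaryKey]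
  congr 1
  · rw [List.take_append_of_le_length (by simp), List.take_eq_take_iff]
    simp [min_comm]
  · rw [List.drop_append_of_le_length (by simp), List.drop_of_length_le (by simp), List.nil_append]

/-! ### Copies -/

/-- Several copies of a pure state. -/
def copiesKet (t : ℕ) {m : ℕ} (ψ : Ket m) : Ket (t * m) :=
  fun x => ∏ i : Fin t, ψ fun j => x (finProdFinEquiv (i, j))

theorem copies_pureState (t : ℕ) {m : ℕ} (ψ : Ket m) :
    copies t (pureState ψ) = pureState (copiesKet t ψ) := by
  ext x y
  simp [copies, pureState, Matrix.vecMulVec_apply, copiesKet, Finset.prod_mul_distrib]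

end

noncomputable section

/-! ### Random phases -/

theorem onWire_mulVec {n : ℕ} (u : Matrix Bool Bool ℂ) (i : Fin n) (ψ : Ket n) (x : Bits n) :
    (onWire u i *ᵥ ψ) x = ∑ b, u (x i) b * ψ (Function.update x i b) := by
  have hinj : Function.Injective (Function.update x i) := Function.update_injective x i
  have h : ∀ y : Bits n, onWire u i x y * ψ y =
      if y ∈ (Finset.univ : Finset Bool).image (Function.update x i) then
        u (x i) (y i) * ψ y else 0 := by
    intro y
    have : (∀ l, l ≠ i → x l = y l) ↔ y ∈ (Finset.univ : Finset Bool).image (Function.update x i) := by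
      simp only [Finset.mem_image, Finset.mem_univ, true_and]
      constructor
      · intro H
        refine ⟨y i, funext fun l => ?_⟩
        by_cases hl : l = i
        · subst hl; simp
        · rw [Function.update_of_ne hl, H l hl]
      · rintro ⟨b, rfl⟩ l hl
        rw [Function.update_of_ne hl]
    rw [onWire, ite_mul, zero_mul]
    simp only [this]
  rw [Matrix.mulVec, dotProduct, Finset.sum_congr rfl fun y _ => h y, Finset.sum_ite_mem,
    Finset.univ_inter, Finset.sum_image hinj.injOn]
  simp

/-- The sign `(-1) ^ (z · y)`. -/
def bitSign {n : ℕ} (z y : Bits n) : ℝ := ∏ q, if (z q && y q) = true then -1 else 1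

/-- Four T gates make the phase π, that is, a Z gate. -/
theorem gatesMat_tees {n : ℕ} (i : Fin n) (ψ : Ket n) (y : Bits n) :
    (gatesMat n [.tee i, .tee i, .tee i, .tee i] *ᵥ ψ) y = (if y i = true then -1 else 1) * ψ y := by
  simp only [gatesMat, Gate.mat, i.2, dite_true, Fin.eta, Matrix.one_mul, onWire_mul, phaseMat_mul]
  rw [onWire_mulVec, show Real.pi / 4 + Real.pi / 4 + Real.pi / 4 + Real.pi / 4 = Real.pi by ring]
  have : Function.update y i (y i) = y := Function.update_eq_self i y
  rcases h : y i with _ | _ <;> rw [h] at this <;> simp [phaseMat, this]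

theorem gatesMat_phaseGates {n : ℕ} (z : Bits n) (ψ : Ket n) (y : Bits n) :
    (gatesMat n (phaseGates n (extendBits z)) *ᵥ ψ) y = (bitSign z y : ℂ) * ψ y := by
  have key : ∀ k ≤ n, ∀ y : Bits n, (gatesMat n (phaseGates k (extendBits z)) *ᵥ ψ) y =
      (∏ q ∈ Finset.range k, if (extendBits z q && extendBits y q) = true then -1 else 1) * ψ y := by
    intro k
    induction k with
    | zero => intro _ y; simp [phaseGates, gatesMat]
    | succ k ih =>
      intro hk y
      have h1 : phaseGates (k + 1) (extendBits z) = phaseGates k (extendBits z) ++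
          if extendBits z k = true then [.tee k, .tee k, .tee k, .tee k] else [] := by
        simp [phaseGates, List.range_succ]
      rw [h1, gatesMat_append, ← Matrix.mulVec_mulVec, Finset.prod_range_succ]
      rcases hz : extendBits z k with _ | _
      · simp only [Bool.false_eq_true, if_false, Bool.false_and, gatesMat, Matrix.one_mulVec]
        rw [ih (by omega), mul_one]
      · have hy : extendBits y k = y ⟨k, by omega⟩ := by
          rw [extendBits, dif_pos]
        have := gatesMat_tees ⟨k, by omega⟩ (gatesMat n (phaseGates k (extendBits z)) *ᵥ ψ) y
        simp only [if_true, Bool.true_and, hy] at this ⊢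
        rw [this, ih (by omega)]
        ring
  rw [key n le_rfl, bitSign, Finset.prod_range]
  push_cast
  congr 1
  refine Finset.prod_congr rfl fun q _ => ?_
  by_cases h : (z q && y q) = true <;> simp [extendBits, h]

/-- Orthogonality of characters: the sum factors over the wires, and any wire with `y q = true`
contributes 1 - 1 = 0. -/
theorem sum_bitSign {n : ℕ} (y : Bits n) :
    ∑ z, bitSign z y = if y = fun _ => false then 2 ^ n else 0 := by
  have h : ∑ z, bitSign z y = ∏ q, ∑ b : Bool, if (b && y q) = true then (-1 : ℝ) else 1 := by
    rw [Finset.prod_univ_sum, Fintype.piFinset_univ]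
    rfl
  rw [h]
  split_ifs with hy
  · subst hy
    simp
  · obtain ⟨q, hq⟩ := Function.ne_iff.1 hy
    refine Finset.prod_eq_zero (Finset.mem_univ q) ?_
    simp [(by simpa using hq : y q = true)]

/-- Averaging the signed sums over `z` isolates the term at zero; the Cauchy–Schwarz inequality then
bounds the square of the mean by the mean of the squares. -/
theorem le_average_bitSign {n : ℕ} (c : Bits n → ℂ) :
    ‖c fun _ => false‖ ^ 2 ≤ ∑ z : Bits n, (1 / 2 : ℝ) ^ n * ‖∑ y, (bitSign z y : ℂ) * c y‖ ^ 2 := by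
  have h1 : ∑ z : Bits n, ∑ y, (bitSign z y : ℂ) * c y = 2 ^ n * c fun _ => false := by
    rw [Finset.sum_comm]
    simp only [← Finset.sum_mul, ← Complex.ofReal_sum, sum_bitSign]
    rw [Finset.sum_eq_single fun _ => false]
    · simp
    · intro y _ hy; simp [hy]
    · simp
  have h2 : (2 ^ n * ‖c fun _ => false‖) ^ 2 ≤
      2 ^ n * ∑ z : Bits n, ‖∑ y, (bitSign z y : ℂ) * c y‖ ^ 2 := by
    have e : 2 ^ n * ‖c fun _ => false‖ = ‖∑ z : Bits n, ∑ y, (bitSign z y : ℂ) * c y‖ := by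
      rw [h1]; simp
    rw [e]
    have h3 := sq_sum_le_card_mul_sum_sq (s := (Finset.univ : Finset (Bits n)))
      (f := fun z => ‖∑ y, (bitSign z y : ℂ) * c y‖)
    have h4 : ((Finset.univ : Finset (Bits n)).card : ℝ) = 2 ^ n := by simp
    rw [h4] at h3
    exact (pow_le_pow_left₀ (norm_nonneg _) (norm_sum_le _ _) 2).trans h3
  rw [← Finset.mul_sum, one_div, inv_pow, le_inv_mul_iff₀ (by positivity)]
  have h5 : (0 : ℝ) < 2 ^ n := by positivity
  refine le_of_mul_le_mul_left ?_ h5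
  calc _ = (2 ^ n * ‖c fun _ => false‖) ^ 2 := by ring
    _ ≤ _ := h2

theorem hadKet {n : ℕ} (x : Bits n) :
    ‖(gatesMat n ((List.range n).map .had) *ᵥ zeroKet n) x‖ ^ 2 = (1 / 2 : ℝ) ^ n := by
  -- After `k` Hadamard gates the first `k` wires are uniform and the rest are still zero.
  have key : ∀ k ≤ n, ∀ x : Bits n, (gatesMat n ((List.range k).map .had) *ᵥ zeroKet n) x =
      if ∀ i : Fin n, k ≤ i → x i = false then (1 / (Real.sqrt 2 : ℂ)) ^ k else 0 := by
    intro k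
    induction k with
    | zero =>
      intro _ x
      simp [gatesMat, zeroKet, funext_iff]
    | succ k ih =>
      intro hk x
      have hk' : k < n := hk
      rw [List.range_succ, List.map_append, gatesMat_append, ← Matrix.mulVec_mulVec]
      simp only [List.map_cons, List.map_nil, gatesMat, Matrix.one_mul, Gate.mat, hk', dite_true]
      rw [onWire_mulVec, Fintype.sum_bool, ih hk'.le, ih hk'.le, if_neg, mul_zero, zero_add]
      · have h1 : hadMat (x ⟨k, hk'⟩) false = 1 / (Real.sqrt 2 : ℂ) := by simp [hadMat]
        have h2 : (∀ i : Fin n, k ≤ i → Function.update x ⟨k, hk'⟩ false i = false) ↔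
            ∀ i : Fin n, k + 1 ≤ i → x i = false := by
          refine forall_congr' fun i => ?_
          by_cases hi : i = ⟨k, hk'⟩
          · subst hi; simp
          · have : (i : ℕ) ≠ k := fun h => hi (Fin.ext h)
            rw [Function.update_of_ne hi]
            refine imp_congr_left ?_
            omega
        simp only [h1, h2]
        split_ifs
        · rw [pow_succ']
        · rw [mul_zero]
      · intro H
        simpa using H ⟨k, hk'⟩ le_rfl
  rw [key n le_rfl, if_pos fun i hi => absurd i.2 (by omega), norm_pow, norm_div, norm_one,
    Complex.norm_real, Real.norm_of_nonneg (Real.sqrt_nonneg 2), ← pow_mul, mul_comm, pow_mul, div_pow,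
    Real.sq_sqrt (by norm_num), one_pow]

end

noncomputable section

/-! ### The reduction -/

theorem map_stateKey (S : QCircuit) {α β : Type} (f : α → β) (k : List α) :
    (stateKey S k).map f = stateKey S (k.map f) := by
  simp [stateKey, List.map_take]

theorem map_unitaryKey (S G : QCircuit) {α β : Type} (f : α → β) (k : List α) :
    (unitaryKey S G k).map f = unitaryKey S G (k.map f) := by
  simp [unitaryKey, List.map_take, List.map_drop]

/-- The gates of `g C Z C⁻¹` for a key and phases. -/
def twirlDesc (S G : QCircuit) (n : ℕ) (k : List Bool) (z : Bits n) : List Gate :=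
  invGates (descGates (stateKey S k)) ++ (phaseGates n (extendBits z) ++
    (descGates (stateKey S k) ++ descGates (unitaryKey S G k)))

/-- The wires of `A`, the uniform phase wires and the clean workspace are in a product state before
the classical part. Deferred measurement then reads this as: run `A`, draw `z`, and compute the
description from both. -/
theorem twirlCircuit_expect (S G : QCircuit) (n t : ℕ) (A : QCircuit) (χ : Ket (t * (n + n)))
    (F : List Gate → ℝ) :
    (twirlCircuit S G n t A).expect (pureState χ) (fun d => F (descGates d)) =
      A.expect (pureState χ) fun k => ∑ z : Bits n, (1 / 2 : ℝ) ^ n * F (twirlDesc S G n k z) := by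
  set NA := t * (n + n) + A.anc with hNA
  set K := outWires A NA with hK
  set b := NA + n with hb
  have hKb : ∀ w ∈ K, w < b := by
    intro w hw
    have := List.mem_range.1 hw
    omega
  have hW : ∀ w ∈ stateKey S K, w < b := fun w hw => hKb w (List.mem_of_mem_take hw)
  have hW' : ∀ w ∈ unitaryKey S G K, w < b :=
    fun w hw => hKb w (List.mem_of_mem_drop (List.mem_of_mem_take hw))
  obtain ⟨D, hD⟩ : ∃ D, D = (twirlBits n b (stateKey S K) (unitaryKey S G K)).length := ⟨_, rfl⟩
  obtain ⟨B, hB⟩ : ∃ B, B = twirlBase n b (stateKey S K) (unitaryKey S G K) := ⟨_, rfl⟩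
  have hbB : b ≤ B := by
    rw [hB]
    exact ((readEnd_le _ _).trans (readEnd_le _ _)).trans (Nat.le_add_right _ _)
  have hanc : (twirlCircuit S G n t A).anc = B + D := by rw [hB, hD]; rfl
  have hout : (twirlCircuit S G n t A).out = D := by rw [hD]; rfl
  have hcl : ClassicalOn (t * (n + n) + (twirlCircuit S G n t A).anc)
      (twirlGates n b (stateKey S K) (unitaryKey S G K)) := by
    refine classicalOn_twirlGates (by omega) hW hW' ?_
    rw [hanc, ← hB, ← hD]
    omega
  rw [QCircuit.expect_classical (twirlCircuit S G n t A) χ _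
    (gs := cleanGates NA A.gates ++ (List.range n).map fun q => .had (NA + q))
    (gs' := twirlGates n b (stateKey S K) (unitaryKey S G K)) rfl hcl, hout]
  -- The number of ancillas occurs in the types of states, so it is made a variable before being
  -- replaced.
  generalize (twirlCircuit S G n t A).anc = a at hanc
  subst hanc
  obtain ⟨r, hr⟩ := Nat.exists_eq_add_of_le (show b ≤ t * (n + n) + (B + D) by omega)
  have hs : A.anc + (n + r) = B + D := by omega
  have h1 : NA + (n + r) = t * (n + n) + (B + D) := by omega
  have hanc : addAncKet (B + D) χ =
      ketTens h1 (addAncKet A.anc χ) (ketTens rfl (zeroKet n) (zeroKet r)) := by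
    rw [addAncKet_eq, addAncKet_eq, ← zeroKet_tens, zeroKet_tens hs]
    exact (ketTens_assoc rfl h1 hs rfl χ (zeroKet A.anc) (zeroKet (n + r))).symm
  have hhad : ((List.range n).map fun q => Gate.had (NA + q)) =
      ((List.range n).map Gate.had).map (Gate.shift NA) := by
    rw [List.map_map]; rfl
  have hfit : ∀ g ∈ (List.range n).map Gate.had, Gate.fits n g = true := by
    intro g hg
    obtain ⟨q, hq, rfl⟩ := List.mem_map.1 hg
    have := List.mem_range.1 hq
    rw [Gate.fits_iff]
    simp only [Gate.quad]
    omega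
  have hfit' : ∀ g ∈ (List.range n).map Gate.had, Gate.fits (n + r) g = true := by
    intro g hg
    have := hfit g hg
    rw [Gate.fits_iff] at this ⊢
    omega
  have hstate : gatesMat (t * (n + n) + (B + D))
        (cleanGates NA A.gates ++ (List.range n).map fun q => .had (NA + q)) *ᵥ addAncKet (B + D) χ =
      ketTens h1 (A.ket χ) (ketTens rfl
        (gatesMat n ((List.range n).map .had) *ᵥ zeroKet n) (zeroKet r)) := by
    rw [hhad, gatesMat_append, gatesMat_left h1 fun g hg => fits_of_mem_clean hg,
      gatesMat_right h1 hfit', gatesMat_left rfl hfit, gatesMat_clean, tens_mul, Matrix.one_mul,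
      Matrix.mul_one, hanc, tens_mulVec, tens_mulVec, Matrix.one_mulVec]
    rfl
  rw [hstate, sum_ketTens, QCircuit.expect_pureState]
  refine Finset.sum_congr rfl fun u _ => ?_
  congr 1
  rw [sum_ketTens]
  refine Finset.sum_congr rfl fun z _ => ?_
  rw [sum_zeroKet, hadKet]
  congr 2
  have hmin : min D (t * (n + n) + (B + D)) = D := by omega
  set x := extendBits (joinBits h1 u (joinBits rfl z fun _ => false)) with hx
  have hx0 : ∀ i, b ≤ i → x i = false := by
    intro i hi
    obtain ⟨j, rfl⟩ := Nat.exists_eq_add_of_le hi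
    rw [hx, hb, Nat.add_assoc, extendBits_joinBits_right, extendBits_joinBits_right,
      extendBits_false]
  have hkey : K.map x = (List.ofFn u).take A.out := by
    rw [hK, outWires, ofFn_eq_map_range, take_map_range]
    refine List.map_congr_left fun w hw => ?_
    have := List.mem_range.1 hw
    rw [hx, extendBits_joinBits_left]
    omega
  rw [hmin, hD, descGates_twirl (by omega) hW hW' x hx0, map_stateKey, map_unitaryKey, hkey,
    twirlDesc]
  congr 2
  refine List.flatMap_congr fun q hq => ?_
  have : x (b - n + q) = extendBits z q := by
    rw [show b - n + q = NA + q by omega, hx, extendBits_joinBits_right,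
      extendBits_joinBits_left _ _ _ (List.mem_range.1 hq)]
  simp only [this]

/-- On average over the phases, `g' C Z C⁻¹` maps `s` to `t` at least as well as it would if `s` were
replaced by the state that `C` prepares. -/
theorem twirl_le {n : ℕ} (C g : List Gate) (s r : Ket n) :
    ‖braket (gatesMat n C *ᵥ zeroKet n) s‖ ^ 2 *
        ‖braket (gatesMat n g *ᵥ (gatesMat n C *ᵥ zeroKet n)) r‖ ^ 2 ≤
      ∑ z : Bits n, (1 / 2 : ℝ) ^ n *
        ‖braket (gatesMat n (invGates C ++ (phaseGates n (extendBits z) ++ (C ++ g))) *ᵥ s) r‖ ^ 2 := by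
  -- The contribution of basis state `y` between C⁻¹ and C to the overlap without phases; Z
  -- multiplies it by `bitSign z y`. At `y = 0` it is ⟨s|C0⟩⟨gC0|r⟩, whose squared modulus is the
  -- left-hand side.
  let c (y : Bits n) : ℂ :=
    star (((gatesMat n C)ᴴ *ᵥ s) y) * ((gatesMat n g * gatesMat n C)ᴴ *ᵥ r) y
  have h1 : ∀ z : Bits n, braket (gatesMat n (invGates C ++ (phaseGates n (extendBits z) ++
      (C ++ g))) *ᵥ s) r = ∑ y, (bitSign z y : ℂ) * c y := by
    intro z
    rw [gatesMat_append, gatesMat_append, gatesMat_append, gatesMat_inv, Matrix.mul_assoc,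
      ← Matrix.mulVec_mulVec, ← Matrix.conjTranspose_conjTranspose (gatesMat n g * gatesMat n C),
      ← braket_mulVec, ← Matrix.mulVec_mulVec]
    refine Finset.sum_congr rfl fun y _ => ?_
    rw [Pi.star_apply, gatesMat_phaseGates, star_mul', Complex.star_def, Complex.conj_ofReal,
      mul_assoc]
    rfl
  simp only [h1]
  refine le_of_eq_of_le ?_ (le_average_bitSign c)
  simp only [c]
  rw [norm_mul, norm_star, conjTranspose_mulVec_zero, conjTranspose_mulVec_zero, mul_pow,
    Matrix.mulVec_mulVec]

theorem QCircuit.expect_mono (C : QCircuit) {m : ℕ} (ψ : Ket m) {f f' : List Bool → ℝ}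
    (h : ∀ y, f y ≤ f' y) : C.expect (pureState ψ) f ≤ C.expect (pureState ψ) f' := by
  rw [QCircuit.expect_pureState, QCircuit.expect_pureState]
  exact Finset.sum_le_sum fun x _ => mul_le_mul_of_nonneg_left (h _) (by positivity)

open StackMachine in
/-- The state generator of a group action. -/
def QGA.stateGenerator (Q : QGA) : StateGenerator where
  qubits l := Q.qubits l + Q.qubits l
  keyGen l := keyCircuit (Q.S l) (Q.G l)
  stateGen p := stateCircuit (Q.S p.1) (Q.G p.1) (Q.qubits p.1) p.2
  ver p := verCircuit (Q.S p.1) (Q.G p.1) (Q.qubits p.1) p.2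
  keyGen_qpt := isQPT_iff_pt.2 (PT.keyCircuit (isQPT_iff_pt.1 Q.S_qpt) (isQPT_iff_pt.1 Q.G_qpt))
  stateGen_qpt := by
    have h1 := isQPT_iff_pt.1 Q.S_qpt
    have h2 := isQPT_iff_pt.1 Q.G_qpt
    have h3 := pt_of_polyTime Q.qubits_poly
    exact isQPT_of_pt (PT.stateCircuit (h1.comp PT.fst') (h2.comp PT.fst') (h3.comp PT.fst')
      PT.snd')
  ver_qpt := by
    have h1 := isQPT_iff_pt.1 Q.S_qpt
    have h2 := isQPT_iff_pt.1 Q.G_qpt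
    have h3 := pt_of_polyTime Q.qubits_poly
    exact isQPT_of_pt (PT.verCircuit (h1.comp PT.fst') (h2.comp PT.fst') (h3.comp PT.fst')
      PT.snd')
  stateGen_out _ _ := rfl

theorem QGA.stateGenerator_state (Q : QGA) (l : ℕ) (k : List Bool) :
    Q.stateGenerator.state l k = pureState (keyKet (Q.S l) (Q.G l) (Q.qubits l) k) :=
  stateCircuit_outState _ _ _ _

theorem QGA.stateGenerator_verProb (Q : QGA) (l : ℕ) (k : List Bool)
    (ψ : Ket (Q.qubits l + Q.qubits l)) : Q.stateGenerator.verProb l k (pureState ψ) =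
      ‖braket (keyKet (Q.S l) (Q.G l) (Q.qubits l) k) ψ‖ ^ 2 :=
  verCircuit_acceptProb _ _ _ _ ψ

theorem braket_keyKet (S G : QCircuit) (n : ℕ) (k : List Bool) :
    braket (keyKet S G n k) (keyKet S G n k) = 1 := by
  rw [keyKet_eq, braket_gatesMat]
  simp [braket, dotProduct, zeroKet]

theorem QGA.stateGenerator_isCorrect (Q : QGA) : Q.stateGenerator.IsCorrect := by
  refine ⟨fun _ => 0, Asymptotics.superpolynomialDecay_zero _ _, fun l => ?_⟩
  have h : (fun k => Q.stateGenerator.verProb l k (Q.stateGenerator.state l k)) = fun _ => 1 := by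
    funext k
    rw [Q.stateGenerator_state]
    refine (Q.stateGenerator_verProb l k _).trans ?_
    rw [braket_keyKet]
    simp
  rw [h, noInput_eq, QCircuit.expect_const _ (by simp [braket, dotProduct, noKet]), sub_zero]

theorem QGA.stateGenerator_isPureCanonical (Q : QGA) : Q.stateGenerator.IsPureCanonical :=
  fun l k => ⟨_, Q.stateGenerator_state l k, fun ψ _ => Q.stateGenerator_verProb l k ψ⟩

/-- For fixed challenge and fixed answer of `A`, the overlap of the product states factors, and
`twirl_le` compares it with the average success over the phases. The two experiments otherwise have
the same distribution, so the inequality passes to expectations. -/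
theorem QGA.stateGenerator_winProb_le (Q : QGA) (l t : ℕ) (A : QCircuit) :
    Q.stateGenerator.winProb l t A ≤
      Q.winProb l t (twirlCircuit (Q.S l) (Q.G l) (Q.qubits l) t A) := by
  set S := Q.S l
  set G := Q.G l
  set n := Q.qubits l
  let s (ds : List Bool) : Ket n := descKet n ds
  let gs (ds dg : List Bool) : Ket n := descUnitary n dg *ᵥ s ds
  have h1 : Q.stateGenerator.winProb l t A = S.expect noInput fun ds => G.expect noInput fun dg =>
      A.expect (pureState (copiesKet t (tensorKet (s ds) (gs ds dg)))) fun k' =>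
        ‖braket (keyKet S G n k') (tensorKet (s ds) (gs ds dg))‖ ^ 2 := by
    rw [← keyCircuit_expect]
    refine congrArg (QCircuit.expect _ _) (funext fun k => ?_)
    rw [Q.stateGenerator_state]
    have := copies_pureState t (keyKet S G n k)
    change A.expect (copies t (pureState (keyKet S G n k))) _ = _
    rw [this]
    refine congrArg (QCircuit.expect _ _) (funext fun k' => ?_)
    exact Q.stateGenerator_verProb l k' _
  have h2 : Q.winProb l t (twirlCircuit S G n t A) = S.expect noInput fun ds =>
      G.expect noInput fun dg =>
      A.expect (pureState (copiesKet t (tensorKet (s ds) (gs ds dg)))) fun k' =>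
        ∑ z : Bits n, (1 / 2 : ℝ) ^ n *
          ‖braket (gatesMat n (twirlDesc S G n k' z) *ᵥ s ds) (gs ds dg)‖ ^ 2 := by
    refine congrArg (QCircuit.expect _ _) (funext fun ds => ?_)
    refine congrArg (QCircuit.expect _ _) (funext fun dg => ?_)
    change (twirlCircuit S G n t A).expect (copies t (pureState (tensorKet (s ds) (gs ds dg)))) _ = _
    rw [copies_pureState]
    exact twirlCircuit_expect S G n t A _ fun gates =>
      ‖braket (gatesMat n gates *ᵥ s ds) (gs ds dg)‖ ^ 2
  rw [h1, h2, noInput_eq]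
  refine QCircuit.expect_mono _ _ fun ds => QCircuit.expect_mono _ _ fun dg =>
    QCircuit.expect_mono _ _ fun k' => ?_
  refine le_of_eq_of_le ?_ (twirl_le (descGates (stateKey S k')) (descGates (unitaryKey S G k'))
    (s ds) (gs ds dg))
  rw [keyKet, tensorKet_eq, tensorKet_eq, braket_ketTens, norm_mul, mul_pow, descKet_eq]
  rfl

open StackMachine in
-- The reduction uses the same number of copies and loses nothing; what remains is that its circuits
-- are uniformly computable, which also requires evaluating the polynomial `t` in polynomial time.
theorem QGA.stateGenerator_isOneWay (Q : QGA) (hQ : Q.IsOneWay) : Q.stateGenerator.IsOneWay := by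
  intro A hA t
  have h : PT fun l => twirlCircuit (Q.S l) (Q.G l) (Q.qubits l) (t.eval l) (A l) :=
    PT.twirlCircuit (isQPT_iff_pt.1 Q.S_qpt) (isQPT_iff_pt.1 Q.G_qpt)
      (pt_of_polyTime Q.qubits_poly) (PT.eval t PT.id) (isQPT_iff_pt.1 hA)
  obtain ⟨ν, hν, H⟩ := hQ _ (isQPT_iff_pt.2 h) t
  exact ⟨ν, hν, fun l => (Q.stateGenerator_winProb_le l _ _).trans (H l)⟩

end

theorem lemma3p2 (h : ∃ Q : QGA, Q.IsOneWay) :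
    ∃ W : StateGenerator, W.IsOWSG ∧ W.IsPureCanonical := by
  obtain ⟨Q, hQ⟩ := h
  exact ⟨Q.stateGenerator, ⟨Q.stateGenerator_isCorrect, Q.stateGenerator_isOneWay hQ⟩,
    Q.stateGenerator_isPureCanonical⟩
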